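/- Let $k$ be a field of characteristic $0$. For an algebra $A$ that is free of rank $n$ as a module over a ring $B$, the Galois closure is $G(A/B)=A^{\otimes n}/\langle s_j(a)-e_j(a)\mid a\in A,\ 1\le j\le n\rangle$ (tensor power over $B$), where $t^n+\sum_{j=1}^n(-1)^js_j(a)t^{n-j}$ is the characteristic polynomial of multiplication by $a$ on $A$, and $e_j(a)$ is the $j$-th elementary symmetric function of $a^{(1)},\dots,a^{(n)}$, with $a^{(i)}=1\otimes\cdots\otimes a\otimes\cdots\otimes 1$ ($a$ in position $i$). Let $A_n=k[x_1,\dots,x_{n-1}]/(x_1,\dots,x_{n-1})^2$ and $G(A_n)=G(A_n/k)$. The elements $x_{i,j}=x_i^{(j)}$ generate $G(A_n)$ as a $k$-algebra, and $G(A_n)$ is $\mathbb Z^{n-1}$-graded, $x_{i,j}$ having as multi-degree the $i$-th standard basis vector; the degree is the sum of the entries of the multi-degree. The socle of $G(A_n)$ is the annihilator of the ideal generated by all $x_{i,j}$. A graded $k$-algebra $B=S/I$, with $S$ a polynomial ring over $k$ in finitely many variables of degree $1$ and $I$ a homogeneous ideal, has trivial negative tangents if $T^1(B/k,B)_{<0}=0$,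 i.e. if every $S$-linear map $I\to B$ that is graded of negative degree is the restriction to $I$ of a $k$-derivation $S\to B$. For even $n\ge 6$ let $\mathcal P$ be the set of partitions $\lambda=(\lambda_1\ge\lambda_2\ge\cdots)$ of $n$ with $\lambda_1=\frac n2$ and $\lambda_2\le\frac n2-2$. For $\lambda\in\mathcal P$, written $(\lambda_1,\dots,\lambda_n)$ with zeros allowed, put $m_\lambda=\frac{(n-1)!}{k_0!\cdots k_{n-1}!}$, where $k_j=\#\{i\ne 1\mid\lambda_i=j\}$. Let $R(4)=12$, $R(5)=40$, and $R(n)=C_{n/2}\sum_{\lambda\in\mathcal P}m_\lambda$ for even $n\ge 6$, where $C_m$ is the $m$-th Catalan number. **Corollary.** Let $n=5$ or let $n\ge 4$ be even. For every integer $0\le r\le R(n)$ there exist $k$-linearly independent socle elements $s_1,\dots,s_r\in G(A_n)$ of degree $\lceil\frac n2\rceil$, each $s_i$ lying in a multi-graded component $G(A_n)_{(d_{i,1},\dots,d_{i,n-1})}$, such that: * if $n\ge 6$, then $d_{i,j}\le\frac n2-2$ for all $i,j$; * if $n=4$ or $n=5$, then the quotient $G(A_n)/(s_1,\dots,s_r)$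 has trivial negative tangents, and if $n=5$, moreover, $d_{i,j}\le 1$ for all $i,j$. -/

import Mathlib

open scoped TensorProduct

namespace GaloisClosure

noncomputable section

/-! ### Galois closures -/

/-- The conjugate `a⁽ⁱ⁾ = 1 ⊗ ⋯ ⊗ 1 ⊗ a ⊗ 1 ⊗ ⋯ ⊗ 1` (with `a` in position `i`) in the `n`-fold
tensor power of `A` over `B`. -/
def conj (B : Type*) {A : Type*} [CommRing B] [CommRing A] [Algebra B A] (n : ℕ) (i : Fin n)
    (a : A) : ⨂[B] _ : Fin n, A :=
  PiTensorProduct.singleAlgHom (R := B) (A := fun _ : Fin n => A) i a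

/-- The coefficient `s_j(a)` of the characteristic polynomial
`p_a(t) = ∑_j (-1)^j s_j(a) t^(n - j)` of multiplication by `a` on the free `B`-module `A`
of rank `n`. -/
def charCoeff (B : Type*) {A : Type*} [CommRing B] [CommRing A] [Algebra B A]
    [Module.Free B A] [Module.Finite B A] (n : ℕ) (a : A) (j : ℕ) : B :=
  (-1) ^ j * (LinearMap.mulLeft B a).charpoly.coeff (n - j)

/-- The ideal of `A^{⊗ n}` generated by all `s_j(a) - e_j(a)`, where `e_j(a)` is the `j`-th
elementary symmetric function of `a⁽¹⁾, …, a⁽ⁿ⁾`, for `a ∈ A` and `1 ≤ j ≤ n`. -/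
def closureIdeal (B A : Type*) [CommRing B] [CommRing A] [Algebra B A]
    [Module.Free B A] [Module.Finite B A] (n : ℕ) : Ideal (⨂[B] _ : Fin n, A) :=
  Ideal.span {y | ∃ (a : A) (j : ℕ), 1 ≤ j ∧ j ≤ n ∧
    y = algebraMap B (⨂[B] _ : Fin n, A) (charCoeff B n a j) -
      MvPolynomial.aeval (fun i => conj B n i a) (MvPolynomial.esymm (Fin n) B j)}

/-- The Galois closure `G(A/B)` of a `B`-algebra `A` which is free of rank `n` as a
`B`-module. -/
abbrev Closure (B A : Type*) [CommRing B] [CommRing A] [Algebra B A]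
    [Module.Free B A] [Module.Finite B A] (n : ℕ) : Type _ :=
  (⨂[B] _ : Fin n, A) ⧸ closureIdeal B A n

/-! ### The algebra `A_n` and its Galois closure -/

/-- `A_n = k[x_1, …, x_{n-1}] / (x_1, …, x_{n-1})²`. -/
abbrev An (k : Type*) [Field k] (n : ℕ) : Type _ :=
  MvPolynomial (Fin (n - 1)) k ⧸
    (Ideal.span (Set.range (MvPolynomial.X : Fin (n - 1) → MvPolynomial (Fin (n - 1)) k))) ^ 2

/-- The class of `x_i` in `A_n`. -/
def An.x (k : Type*) [Field k] (n : ℕ) (i : Fin (n - 1)) : An k n :=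
  Ideal.Quotient.mk _ (MvPolynomial.X i)

theorem An.x_mul_x (k : Type*) [Field k] (n : ℕ) (i j : Fin (n - 1)) :
    An.x k n i * An.x k n j = 0 := by
  unfold An.x
  rw [← map_mul, Ideal.Quotient.eq_zero_iff_mem, pow_two]
  exact Ideal.mul_mem_mul (Ideal.subset_span ⟨i, rfl⟩) (Ideal.subset_span ⟨j, rfl⟩)

/-- `A_n` is spanned by `1, x_1, …, x_{n-1}`. -/
theorem An.span_eq_top (k : Type*) [Field k] (n : ℕ) :
    Submodule.span k (Set.range (fun o : Option (Fin (n - 1)) => o.elim 1 (An.x k n))) = ⊤ := by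
  set S := Submodule.span k (Set.range (fun o : Option (Fin (n - 1)) => o.elim 1 (An.x k n)))
    with hS
  have h1 : (1 : An k n) ∈ S := Submodule.subset_span ⟨none, rfl⟩
  have hx : ∀ i, An.x k n i ∈ S := fun i => Submodule.subset_span ⟨some i, rfl⟩
  have hmul : ∀ i, ∀ y ∈ S, y * An.x k n i ∈ S := by
    intro i y hy
    induction hy using Submodule.span_induction with
    | mem y hy =>
      obtain ⟨o, rfl⟩ := hy
      cases o with
      | none => simpa using hx i
      | some j => simp [An.x_mul_x]
    | zero => simp
    | add y z _ _ hy hz => rw [add_mul]; exact S.add_mem hy hz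
    | smul c y _ hy => rw [smul_mul_assoc]; exact S.smul_mem c hy
  rw [eq_top_iff]
  rintro y -
  obtain ⟨p, rfl⟩ := Ideal.Quotient.mk_surjective y
  induction p using MvPolynomial.induction_on with
  | C c =>
    have : (Ideal.Quotient.mk _ (MvPolynomial.C c) : An k n) = c • (1 : An k n) := by
      rw [Algebra.smul_def, mul_one]; rfl
    rw [this]
    exact S.smul_mem c h1
  | add p q hp hq => rw [map_add]; exact S.add_mem hp hq
  | mul_X p i hp => rw [map_mul]; exact hmul i _ hp

instance (k : Type*) [Field k] (n : ℕ) : Module.Finite k (An k n) :=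
  ⟨⟨(Set.finite_range (fun o : Option (Fin (n - 1)) => o.elim 1 (An.x k n))).toFinset, by
    rw [Set.Finite.coe_toFinset]; exact An.span_eq_top k n⟩⟩

/-- `G(A_n) = G(A_n / k)`; note that `A_n` has rank `n` over `k` for `n ≥ 1`. -/
abbrev G (k : Type*) [Field k] (n : ℕ) : Type _ := Closure k (An k n) n

/-- The element `x_{i,j} = x_i⁽ʲ⁾` of `G(A_n)`. -/
def G.x (k : Type*) [Field k] (n : ℕ) (i : Fin (n - 1)) (j : Fin n) : G k n :=
  Ideal.Quotient.mk _ (conj k n j (An.x k n i))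

/-- The map `k[x_{i,j}] → G(A_n)` from the polynomial ring, sending `x_{i,j}` to `x_i⁽ʲ⁾`. -/
def G.presentation (k : Type*) [Field k] (n : ℕ) :
    MvPolynomial (Fin (n - 1) × Fin n) k →ₐ[k] G k n :=
  MvPolynomial.aeval fun p => G.x k n p.1 p.2

/-- The component `G(A_n)_d` of multi-degree `d = (d_1, …, d_{n-1})`, where `x_{i,j}` has as
multi-degree the `i`-th standard basis vector. -/
def G.component (k : Type*) [Field k] (n : ℕ) (d : Fin (n - 1) → ℕ) : Submodule k (G k n) :=
  (MvPolynomial.weightedHomogeneousSubmodule k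
    (fun p : Fin (n - 1) × Fin n => (Pi.single p.1 1 : Fin (n - 1) → ℕ)) d).map
      (G.presentation k n).toLinearMap

/-- The socle of `G(A_n)`: the annihilator of its maximal ideal, which is generated by
the `x_{i,j}`. -/
def G.socle (k : Type*) [Field k] (n : ℕ) : Ideal (G k n) :=
  (Ideal.span (Set.range fun p : Fin (n - 1) × Fin n => G.x k n p.1 p.2)).annihilator

/-! ### Trivial negative tangents -/

/-- For an ideal `I` of `S = k[x_σ]`, an `S`-linear map `φ : I → S/I` is graded of degree
`e ∈ ℤ` if it sends forms of degree `m` to classes of forms of degree `m + e` (where the only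
form of negative degree is `0`). Here every variable has degree `1`. -/
def IsGradedOfDegree {k σ : Type*} [Field k] {I : Ideal (MvPolynomial σ k)}
    (φ : I →ₗ[MvPolynomial σ k] (MvPolynomial σ k ⧸ I)) (e : ℤ) : Prop :=
  ∀ (m : ℤ) (f : I), MvPolynomial.IsWeightedHomogeneous (fun _ : σ => (1 : ℤ)) f.1 m →
    ∃ g : MvPolynomial σ k, MvPolynomial.IsWeightedHomogeneous (fun _ : σ => (1 : ℤ)) g (m + e) ∧
      φ f = Ideal.Quotient.mk I g

/-- For a homogeneous ideal `I` of `S = k[x_σ]`, the graded algebra `A = S/I` has trivial negative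
tangents if `T¹(A/k, A)_{<0} = 0`. As `S` is a polynomial ring, `T¹(A/k, A)` is the cokernel of
the restriction map `Der_k(S, A) → Hom_S(I, A)`; so this says that every homomorphism `I → A`
which is graded of negative degree is the restriction of a derivation `S → A`. -/
def HasTrivialNegativeTangents {k σ : Type*} [Field k] (I : Ideal (MvPolynomial σ k)) : Prop :=
  ∀ (e : ℤ) (φ : I →ₗ[MvPolynomial σ k] (MvPolynomial σ k ⧸ I)), e < 0 → IsGradedOfDegree φ e →
    ∃ D : Derivation k (MvPolynomial σ k) (MvPolynomial σ k ⧸ I), ∀ f : I, φ f = D f.1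

/-! ### The numbers `R(n)` -/

/-- The largest part `λ_1` of a partition. -/
def part₁ {n : ℕ} (p : n.Partition) : ℕ := p.parts.sup

/-- The second part `λ_2` of a partition (`0` if there is none). -/
def part₂ {n : ℕ} (p : n.Partition) : ℕ := (p.parts.erase (part₁ p)).sup

/-- `k_j = #{i ≠ 1 | λ_i = j}` for a partition of `n`, written as `λ_1 ≥ ⋯ ≥ λ_n ≥ 0`. -/
def multiplicity {n : ℕ} (p : n.Partition) (j : ℕ) : ℕ :=
  (p.parts.erase (part₁ p) + Multiset.replicate (n - p.parts.card) 0).count j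

/-- The multinomial coefficient `m_λ = (n - 1)! / (k_0! ⋯ k_{n-1}!)`. -/
def m {n : ℕ} (p : n.Partition) : ℕ :=
  (n - 1).factorial / ∏ j ∈ Finset.range n, (multiplicity p j).factorial

/-- The set of partitions of `n` with `λ_1 = ⌊n/2⌋` and `λ_2 ≤ ⌊n/2⌋ - 2`. -/
def P (n : ℕ) : Finset n.Partition :=
  {p | part₁ p = n / 2 ∧ part₂ p + 2 ≤ n / 2}

/-- `R(4) = 12`, `R(5) = 40`, and `R(n) = C_{n/2} ∑_{λ ∈ P} m_λ` for even `n ≥ 6`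
(other values of `n` play no role). -/
def R (n : ℕ) : ℕ :=
  if n = 4 then 12
  else if n = 5 then 40
  else catalan (n / 2) * ∑ p ∈ P n, m p

end

end GaloisClosure

namespace GaloisClosure

noncomputable section

/-! ### Elementary symmetric functions of square-zero elements with sum zero -/

section SquareZero

open Polynomial

variable {k R : Type*} [Field k] [CharZero k] [CommRing R] [Algebra k R] {σ : Type*} [Fintype σ]

/-! Every element of A_n is a scalar c plus a square-zero vector, so its characteristic polynomial
is (t - c)^n. Square-zero elements with sum zero have vanishing power sums, hence, by Newton's
identities in characteristic 0, vanishing elementary symmetric functions. So the Galois closure only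
imposes the traces ∑_j x_{i,j} = 0 on the tensor power (`Tens.closureIdeal_eq_traceIdeal`), and
G(A_n) is the polynomial ring modulo the products x_{a,j} x_{b,j} and the traces
(`ker_presentation`).

Write v_j for the conjugates of a vector v. Then |J|! ∏_{j ∈ J} v_j = (∑_{j ∈ J} v_j)^|J| = (-∑_{j ∉
J} v_j)^|J|. After multiplication by some x_{a,l} with l ∉ J the term v_l drops out of the last sum,
which then has too few terms if 2|J| ≥ n. Hence the product is in the socle, and so are the
coefficients obtained from a generic v (`G.polarized_mem_socle`).

For even n = 2m ≥ 6, consider functions g on m-subsets whose sum over the supersets of each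
(m-1)-subset is zero. They form a space of dimension at least C(2m, m) - C(2m, m-1) = C_m. Each g
induces a linear map from G(A_n) to k[t] sending the polarized element of (J, d) to a nonzero
multiple of g(J) t^d. So C_m well-chosen subsets J, combined with all multi-degrees d of sum m, give
independent elements (`exists_linearIndependent_polarized`), and the m_λ count multi-degrees with
entries at most m - 2.

For n = 4, 5 let I be the ideal of the quotient. A homomorphism I → S/I of degree at most -2 kills
the relations because of their syzygies. One of degree -1, corrected by a constant derivation, kills
the traces and sends the product of two linear forms a, b in column j to a form M_j(a, b) in column
j. Applied to the syzygy (v_0² - v_1²)(v_2 - v_3) + (v_0 - v_1)(v_2² - v_3²) = (v_0 - v_1)(v_2 -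
v_3) ∑ v_j (for n = 5, a multiple of it), it yields explicit elements of I. These are tested against
iterated directional derivatives, antisymmetrized or with disjoint supports so that they vanish on
I. The outcome is first that M_j(v, v) ∧ v does not depend on j, so that a second derivation makes
all M_j equal, and then that the common M is zero. A homomorphism killing the relations sends the
socle generators to lower-degree socle elements of S/I, which vanish; so it is zero
(`IsAdmissible.hasTrivialNegativeTangents`). -/

theorem aeval_esymm_eq_zero_of_sq_eq_zero {v : σ → R} (hv : ∀ i, v i ^ 2 = 0)
    (hsum : ∑ i, v i = 0) {j : ℕ} (hj : j ≠ 0) :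
    MvPolynomial.aeval v (MvPolynomial.esymm σ k j) = 0 := by
  classical
  -- The first power sum vanishes by `hsum`, the higher ones because the squares do; Newton's
  -- identity then reads j · e_j = 0.
  have hp : ∀ i, i ≠ 0 → MvPolynomial.aeval v (MvPolynomial.psum σ k i) = 0 := by
    intro i hi
    simp only [MvPolynomial.psum, map_sum, map_pow, MvPolynomial.aeval_X]
    obtain rfl | h2 : i = 1 ∨ 2 ≤ i := by omega
    · simpa using hsum
    · exact Finset.sum_eq_zero fun x _ => pow_eq_zero_of_le h2 (hv x)
  have h := congrArg (MvPolynomial.aeval v) (MvPolynomial.mul_esymm_eq_sum σ k j)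
  rw [map_mul, map_mul, map_sum, map_natCast, Finset.sum_eq_zero, mul_zero] at h
  · have hu : IsUnit ((j : ℕ) : R) := by
      have : IsUnit ((j : ℕ) : k) := (Nat.cast_ne_zero.mpr hj).isUnit
      simpa using this.map (algebraMap k R)
    exact (hu.mul_right_eq_zero).1 h
  · intro a ha
    rw [Finset.mem_filter, Finset.HasAntidiagonal.mem_antidiagonal] at ha
    rw [map_mul, hp _ (by omega), mul_zero]

theorem prod_X_add_C_eq_X_pow {v : σ → R} (hv : ∀ i, v i ^ 2 = 0) (hsum : ∑ i, v i = 0)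
    (k : Type*) [Field k] [CharZero k] [Algebra k R] :
    ∏ i, (X + C (v i)) = (X : R[X]) ^ Fintype.card σ := by
  have h := Multiset.prod_X_add_C_eq_sum_esymm (Finset.univ.val.map v)
  rw [Multiset.map_map] at h
  change ∏ i, (X + C (v i)) = _ at h
  rw [h, Finset.sum_eq_single_of_mem 0 (by simp)]
  · simp [Finset.esymm_map_val]
  · intro j _ hj
    rw [← MvPolynomial.aeval_esymm_eq_multiset_esymm σ k j,
      aeval_esymm_eq_zero_of_sq_eq_zero hv hsum hj]
    simp

/-- Substituting X - c in ∏ (X - v_i) = X^N gives ∏ (X - (c + v_i)) = (X - c)^N, and Vieta reads off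
the coefficients. The right side has the shape of `charCoeff`, so that the two sides of the defining
relations can be compared. -/
theorem aeval_esymm_add {v : σ → R} (hv : ∀ i, v i ^ 2 = 0) (hsum : ∑ i, v i = 0)
    (k : Type*) [Field k] [CharZero k] [Algebra k R] (c : R) {j : ℕ} (hj : j ≤ Fintype.card σ) :
    MvPolynomial.aeval (fun i => c + v i) (MvPolynomial.esymm σ k j) =
      (-1) ^ j * ((X - C c) ^ Fintype.card σ).coeff (Fintype.card σ - j) := by
  have h1 : ∏ i, (X - C (c + v i)) = (X - C c) ^ Fintype.card σ := by
    have := prod_X_add_C_eq_X_pow (v := fun i => - v i) (by simpa using hv) (by simp [hsum]) k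
    have h2 := congrArg (fun p => p.comp (X - C c)) this
    simp only [prod_comp, add_comp, X_comp, C_comp, pow_comp] at h2
    rw [← h2]
    exact Finset.prod_congr rfl fun i _ => by simp [sub_eq_add_neg, add_assoc, add_comm]
  have h := Multiset.prod_X_sub_C_coeff (Finset.univ.val.map fun i => c + v i)
    (k := Fintype.card σ - j) (by simp)
  rw [Multiset.map_map] at h
  change (∏ i, (X - C (c + v i))).coeff _ = _ at h
  rw [h1] at h
  rw [h, ← MvPolynomial.aeval_esymm_eq_multiset_esymm σ k]
  simp only [Multiset.card_map, Finset.card_val, Finset.card_univ]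
  rw [Nat.sub_sub_self hj, ← mul_assoc, ← pow_add, ← two_mul, pow_mul]
  simp

end SquareZero

/-! ### Coordinates and characteristic polynomials in A_n -/

section An

variable {k : Type*} [Field k] {n : ℕ}

/-- The homomorphism out of `A_n` given by elements with vanishing products. -/
def An.lift {R : Type*} [CommRing R] [Algebra k R] (v : Fin (n - 1) → R)
    (hv : ∀ i j, v i * v j = 0) : An k n →ₐ[k] R :=
  Ideal.Quotient.liftₐ _ (MvPolynomial.aeval v) (by
    have : (Ideal.span (Set.range
        (MvPolynomial.X : Fin (n - 1) → MvPolynomial (Fin (n - 1)) k))) ^ 2 ≤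
          RingHom.ker (MvPolynomial.aeval v : MvPolynomial (Fin (n - 1)) k →ₐ[k] R) := by
      rw [pow_two, Ideal.span_mul_span', Ideal.span_le]
      rintro _ ⟨_, ⟨i, rfl⟩, _, ⟨j, rfl⟩, rfl⟩
      simp [RingHom.mem_ker, hv]
    exact fun a ha => this ha)

theorem An.lift_x {R : Type*} [CommRing R] [Algebra k R] (v : Fin (n - 1) → R)
    (hv : ∀ i j, v i * v j = 0) (i : Fin (n - 1)) : An.lift v hv (An.x k n i) = v i :=
  MvPolynomial.aeval_X _ _

variable (k n) in
/-- The isomorphism of `A_n` with the trivial square-zero extension, as a homomorphism. -/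
def An.toTrivSqZeroExt : An k n →ₐ[k] TrivSqZeroExt k (Fin (n - 1) → k) :=
  An.lift (fun i => TrivSqZeroExt.inr (Pi.single i (1 : k))) (by simp)

variable (k n) in
/-- The augmentation `A_n → k`. -/
def An.aug : An k n →ₐ[k] k := (TrivSqZeroExt.fstHom k k _).comp (An.toTrivSqZeroExt k n)

variable (k n) in
/-- The vector of the coordinates of an element of `A_n` with respect to the `x_i`. -/
def An.coord : An k n →ₗ[k] (Fin (n - 1) → k) :=
  (TrivSqZeroExt.sndHom k _).comp (An.toTrivSqZeroExt k n).toLinearMap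

variable (k n) in
/-- The linear form `∑ v_i x_i` in `A_n`. -/
def An.vec : (Fin (n - 1) → k) →ₗ[k] An k n := Fintype.linearCombination k (An.x k n)

theorem An.vec_apply (v : Fin (n - 1) → k) : An.vec k n v = ∑ i, v i • An.x k n i :=
  Fintype.linearCombination_apply ..

@[simp] theorem An.vec_single (i : Fin (n - 1)) : An.vec k n (Pi.single i 1) = An.x k n i := by
  simp [An.vec]

theorem An.toTrivSqZeroExt_x (i : Fin (n - 1)) :
    An.toTrivSqZeroExt k n (An.x k n i) = TrivSqZeroExt.inr (Pi.single i (1 : k)) :=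
  An.lift_x ..

@[simp] theorem An.aug_x (i : Fin (n - 1)) : An.aug k n (An.x k n i) = 0 := by
  simp [An.aug, An.toTrivSqZeroExt_x]

@[simp] theorem An.coord_x (i : Fin (n - 1)) :
    An.coord k n (An.x k n i) = Pi.single i 1 := by
  simp [An.coord, An.toTrivSqZeroExt_x]

@[simp] theorem An.coord_one : An.coord k n 1 = 0 := by simp [An.coord]

@[simp] theorem An.aug_vec (v : Fin (n - 1) → k) : An.aug k n (An.vec k n v) = 0 := by
  simp [An.vec_apply]

@[simp] theorem An.coord_vec (v : Fin (n - 1) → k) : An.coord k n (An.vec k n v) = v := by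
  rw [An.vec_apply]
  simp only [map_sum, map_smul, An.coord_x]
  exact (pi_eq_sum_univ' v).symm

theorem An.eq_add_vec (a : An k n) :
    a = algebraMap k _ (An.aug k n a) + An.vec k n (An.coord k n a) := by
  have ha : a ∈ Submodule.span k
      (Set.range (fun o : Option (Fin (n - 1)) => o.elim 1 (An.x k n))) := by
    rw [An.span_eq_top]; trivial
  induction ha using Submodule.span_induction with
  | mem y hy =>
    obtain ⟨o, rfl⟩ := hy
    cases o <;> simp
  | zero => simp
  | add y z _ _ hy hz =>
    conv_lhs => rw [hy, hz]
    simp only [map_add]; ring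
  | smul c y _ hy =>
    conv_lhs => rw [hy]
    rw [map_smul, map_smul (An.coord k n), map_smul (An.vec k n), smul_add, smul_eq_mul, map_mul,
      Algebra.smul_def c (algebraMap k _ _)]

@[simp] theorem An.vec_mul_vec (v w : Fin (n - 1) → k) : An.vec k n v * An.vec k n w = 0 := by
  simp [An.vec_apply, Finset.sum_mul_sum, An.x_mul_x]

theorem An.mul_vec (a : An k n) (v : Fin (n - 1) → k) :
    a * An.vec k n v = An.aug k n a • An.vec k n v := by
  conv_lhs => rw [An.eq_add_vec a]
  rw [add_mul, An.vec_mul_vec, add_zero, Algebra.smul_def]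

theorem An.finrank (hn : 1 ≤ n) : Module.finrank k (An k n) = n := by
  have e : An k n ≃ₗ[k] k × (Fin (n - 1) → k) :=
    { toFun := fun a => (An.aug k n a, An.coord k n a)
      map_add' := fun a b => by simp
      map_smul' := fun a b => by simp
      invFun := fun p => algebraMap k _ p.1 + An.vec k n p.2
      left_inv := fun a => (An.eq_add_vec a).symm
      right_inv := fun p => by
        ext1
        · simp
        · simp [Algebra.algebraMap_eq_smul_one] }
  rw [e.finrank_eq]
  simp; omega

open Polynomial in
theorem charpoly_mulLeft_algebraMap_add {A : Type*} [CommRing A] [Algebra k A] [Module.Finite k A]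
    (c : k) (v : A) :
    (LinearMap.mulLeft k (algebraMap k A c + v)).charpoly =
      (LinearMap.mulLeft k v).charpoly.comp (X - C c) := by
  have h := LinearMap.charpoly_sub_smul (LinearMap.mulLeft k v) (-c)
  have h2 : LinearMap.mulLeft k v - (-c) • 1 = LinearMap.mulLeft k (algebraMap k A c + v) := by
    ext b
    simp [add_mul, Algebra.smul_def, add_comm]
  rw [h2] at h
  simpa [sub_eq_add_neg] using h

open Polynomial in
-- The vector part is nilpotent and contributes X^n; the scalar part only translates the variable.
theorem An.charpoly_mulLeft (hn : 1 ≤ n) (a : An k n) :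
    (LinearMap.mulLeft k a).charpoly = (X - C (An.aug k n a)) ^ n := by
  have h0 : ∀ v, (LinearMap.mulLeft k (An.vec k n v)).charpoly = X ^ n := by
    intro v
    have h := (LinearMap.charpoly_eq_X_pow_iff (LinearMap.mulLeft k (An.vec k n v))).2
      (fun m => ⟨2, by simp [pow_two, ← mul_assoc]⟩)
    rwa [An.finrank hn] at h
  rw [An.eq_add_vec a, charpoly_mulLeft_algebraMap_add, h0]
  simp

end An

end

end GaloisClosure

/-! ### The tensor power and its universal property -/

namespace GaloisClosure

noncomputable section

variable {k : Type*} [Field k] {n : ℕ}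

variable (k n) in
/-- The tensor power `A_n^{⊗ n}`. -/
def Tens : Type _ := ⨂[k] _ : Fin n, An k n

instance : CommRing (Tens k n) :=
  inferInstanceAs (CommRing (⨂[k] _ : Fin n, An k n))

instance : Algebra k (Tens k n) :=
  inferInstanceAs (Algebra k (⨂[k] _ : Fin n, An k n))

/-- The conjugation `a ↦ a⁽ʲ⁾`. -/
def Tens.conj (j : Fin n) : An k n →ₐ[k] Tens k n :=
  PiTensorProduct.singleAlgHom (R := k) (A := fun _ : Fin n => An k n) j

variable (k n) in
/-- The universal multilinear map. -/
def Tens.tprod : MultilinearMap k (fun _ : Fin n => An k n) (Tens k n) :=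
  PiTensorProduct.tprod k

/-- The linear map out of the tensor power given by a multilinear map. -/
def Tens.lift {M : Type*} [AddCommGroup M] [Module k M]
    (Θ : MultilinearMap k (fun _ : Fin n => An k n) M) : Tens k n →ₗ[k] M :=
  PiTensorProduct.lift Θ

theorem Tens.lift_tprod {M : Type*} [AddCommGroup M] [Module k M]
    (Θ : MultilinearMap k (fun _ : Fin n => An k n) M) (a : Fin n → An k n) :
    Tens.lift Θ (Tens.tprod k n a) = Θ a :=
  PiTensorProduct.lift.tprod a

theorem Tens.tprod_mul (a b : Fin n → An k n) :
    Tens.tprod k n a * Tens.tprod k n b = Tens.tprod k n (a * b) :=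
  PiTensorProduct.tprod_mul_tprod a b

theorem Tens.conj_apply (j : Fin n) (a : An k n) :
    Tens.conj j a = Tens.tprod k n (Pi.mulSingle j a) := rfl

theorem Tens.tprod_eq_prod (a : Fin n → An k n) :
    Tens.tprod k n a = ∏ j, Tens.conj j (a j) := by
  let F : (Fin n → An k n) →* Tens k n :=
    { toFun := Tens.tprod k n
      map_one' := rfl
      map_mul' := fun a b => (Tens.tprod_mul a b).symm }
  change F a = ∏ j, F (Pi.mulSingle j (a j))
  rw [← map_prod, Finset.univ_prod_mulSingle]

theorem Tens.induction {p : Tens k n → Prop} (t : Tens k n)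
    (smul : ∀ (c : k) a, p (c • Tens.tprod k n a)) (add : ∀ x y, p x → p y → p (x + y)) : p t :=
  PiTensorProduct.induction_on t smul add

variable (k n) in
/-- The projection onto the Galois closure. -/
def Tens.toG' : Tens k n →+* G k n :=
  Ideal.Quotient.mk (closureIdeal k (An k n) n)

variable (k n) in
/-- The projection onto the Galois closure. -/
def Tens.toG : Tens k n →ₐ[k] G k n :=
  { Tens.toG' k n with commutes' := fun _ => rfl }

theorem Tens.toG_surjective : Function.Surjective (Tens.toG k n) := by
  have h := Ideal.Quotient.mk_surjective (I := GaloisClosure.closureIdeal k (An k n) n)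
  exact h

variable (k n) in
/-- The defining ideal of `G(A_n)`. -/
def Tens.closureIdeal : Ideal (Tens k n) := GaloisClosure.closureIdeal k (An k n) n

theorem Tens.closureIdeal_eq : Tens.closureIdeal k n = Ideal.span {y | ∃ (a : An k n) (j : ℕ),
    1 ≤ j ∧ j ≤ n ∧ y = algebraMap k (Tens k n) (charCoeff k n a j) -
      MvPolynomial.aeval (fun i => Tens.conj i a) (MvPolynomial.esymm (Fin n) k j)} := rfl

theorem Tens.toG_eq_zero_iff (t : Tens k n) : Tens.toG k n t = 0 ↔ t ∈ Tens.closureIdeal k n := by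
  have h := Ideal.Quotient.eq_zero_iff_mem (I := GaloisClosure.closureIdeal k (An k n) n)
    (a := (show ⨂[k] _ : Fin n, An k n from t))
  exact h

end

end GaloisClosure

/-! ### Trace relations and linear maps out of the Galois closure -/

namespace GaloisClosure

noncomputable section

variable {k : Type*} [Field k] {n : ℕ}

theorem Tens.conj_eq_add (j : Fin n) (a : An k n) :
    Tens.conj j a = algebraMap k _ (An.aug k n a) + Tens.conj j (An.vec k n (An.coord k n a)) := by
  conv_lhs => rw [An.eq_add_vec a]
  rw [map_add, AlgHom.commutes]

variable (k n) in
/-- The ideal of `A_n^{⊗ n}` generated by the elements `∑_j x_i⁽ʲ⁾`. -/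
def Tens.traceIdeal : Ideal (Tens k n) :=
  Ideal.span (Set.range fun i => ∑ j, Tens.conj j (An.x k n i))

theorem Tens.sum_conj_vec_mem (v : Fin (n - 1) → k) :
    ∑ j, Tens.conj j (An.vec k n v) ∈ Tens.traceIdeal k n := by
  have : ∑ j, Tens.conj j (An.vec k n v) =
      ∑ i, algebraMap k (Tens k n) (v i) * ∑ j, Tens.conj j (An.x k n i) := by
    simp only [An.vec_apply, map_sum, map_smul]
    rw [Finset.sum_comm]
    simp only [Algebra.smul_def, Finset.mul_sum]
  rw [this]
  exact Ideal.sum_mem _ fun i _ => Ideal.mul_mem_left _ _ (Ideal.subset_span ⟨i, rfl⟩)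

/-- Modulo the traces, the conjugates of the vector part of a are square-zero with sum zero, so
`aeval_esymm_add` shows that e_j(a) agrees with the coefficient of (X - c)^n. Conversely, each trace
is up to sign the relation with a = x_i and j = 1. -/
theorem Tens.closureIdeal_eq_traceIdeal [CharZero k] (hn : 1 ≤ n) :
    Tens.closureIdeal k n = Tens.traceIdeal k n := by
  apply le_antisymm
  · rw [Tens.closureIdeal_eq, Ideal.span_le]
    rintro _ ⟨a, j, hj1, hjn, rfl⟩
    rw [SetLike.mem_coe, ← Ideal.Quotient.eq_zero_iff_mem, map_sub, sub_eq_zero]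
    set π := Ideal.Quotient.mkₐ k (Tens.traceIdeal k n) with hπ
    change π _ = π _
    rw [← AlgHom.comp_apply π (MvPolynomial.aeval _), MvPolynomial.comp_aeval]
    have h := aeval_esymm_add (σ := Fin n)
      (v := fun i => π (Tens.conj i (An.vec k n (An.coord k n a))))
      (fun i => by rw [pow_two, ← map_mul, ← map_mul, An.vec_mul_vec, map_zero, map_zero]) (by
        rw [← map_sum]
        exact Ideal.Quotient.eq_zero_iff_mem.2 (Tens.sum_conj_vec_mem _)) k
      (algebraMap k _ (An.aug k n a)) (j := j) (by simpa using hjn)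
    simp only [Tens.conj_eq_add _ a, map_add, AlgHom.commutes]
    rw [h, charCoeff, An.charpoly_mulLeft hn]
    simp only [Fintype.card_fin, map_mul, map_pow, map_neg, map_one]
    congr 1
    rw [← Polynomial.coeff_map]
    simp
  · unfold Tens.traceIdeal
    rw [Ideal.span_le]
    rintro _ ⟨i, rfl⟩
    rw [SetLike.mem_coe]
    refine (Ideal.neg_mem_iff _).1 ?_
    rw [Tens.closureIdeal_eq]
    apply Ideal.subset_span
    refine ⟨An.x k n i, 1, le_rfl, hn, ?_⟩
    rw [charCoeff, An.charpoly_mulLeft hn]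
    simp only [MvPolynomial.esymm_one, map_sum, MvPolynomial.aeval_X, An.aug_x, map_zero, sub_zero]
    rw [Polynomial.coeff_X_pow, if_neg (by omega)]
    simp

/-- The conjugation `a ↦ a⁽ʲ⁾` as a homomorphism `A_n → G(A_n)`. -/
def G.conj (j : Fin n) : An k n →ₐ[k] G k n := (Tens.toG k n).comp (Tens.conj j)

theorem G.conj_x (i : Fin (n - 1)) (j : Fin n) : G.conj j (An.x k n i) = G.x k n i j := rfl

theorem G.sum_conj_vec [CharZero k] (hn : 1 ≤ n) (v : Fin (n - 1) → k) :
    ∑ j, G.conj j (An.vec k n v) = 0 := by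
  have h := Tens.sum_conj_vec_mem v
  rw [← Tens.closureIdeal_eq_traceIdeal hn, ← Tens.toG_eq_zero_iff, map_sum] at h
  exact h

/-- On a pure tensor, multiplying by the trace of x_i means summing over l the tensors whose l-th
factor is multiplied by x_i. -/
theorem Tens.lift_mul_trace {M : Type*} [AddCommGroup M] [Module k M]
    (Θ : MultilinearMap k (fun _ : Fin n => An k n) M)
    (hΘ : ∀ a i, ∑ l, Θ (Function.update a l (a l * An.x k n i)) = 0) (t : Tens k n)
    (i : Fin (n - 1)) : Tens.lift Θ (t * ∑ j, Tens.conj j (An.x k n i)) = 0 := by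
  induction t using Tens.induction with
  | smul c a =>
    rw [smul_mul_assoc, map_smul, Finset.mul_sum, map_sum, ← smul_zero c, ← hΘ a i]
    congr 1
    refine Finset.sum_congr rfl fun l _ => ?_
    rw [Tens.conj_apply, Tens.tprod_mul, Tens.lift_tprod]
    congr 1
    funext j
    obtain rfl | h := eq_or_ne j l <;> simp [*]
  | add x y hx hy => rw [add_mul, map_add, hx, hy, add_zero]

/-- The linear map out of `G(A_n)` given by a multilinear map killed by the operators `x_i`. -/
def G.lift [CharZero k] (hn : 1 ≤ n) {M : Type*} [AddCommGroup M] [Module k M]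
    (Θ : MultilinearMap k (fun _ : Fin n => An k n) M)
    (hΘ : ∀ a i, ∑ l, Θ (Function.update a l (a l * An.x k n i)) = 0) : G k n →ₗ[k] M :=
  (Submodule.liftQ (LinearMap.ker (Tens.toG k n).toLinearMap) (Tens.lift Θ) (by
    intro y hy
    rw [LinearMap.mem_ker, AlgHom.toLinearMap_apply, Tens.toG_eq_zero_iff,
      Tens.closureIdeal_eq_traceIdeal hn, Tens.traceIdeal, ← Set.image_univ] at hy
    rw [LinearMap.mem_ker]
    obtain ⟨u, -, c, rfl⟩ := (Submodule.mem_span_image_iff_exists_fun (Tens k n)).1 hy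
    rw [map_sum]
    exact Finset.sum_eq_zero fun i _ => Tens.lift_mul_trace Θ hΘ _ _)) ∘ₗ
  ((Tens.toG k n).toLinearMap.quotKerEquivOfSurjective Tens.toG_surjective).symm.toLinearMap

theorem G.lift_toG [CharZero k] (hn : 1 ≤ n) {M : Type*} [AddCommGroup M] [Module k M]
    (Θ : MultilinearMap k (fun _ : Fin n => An k n) M)
    (hΘ : ∀ a i, ∑ l, Θ (Function.update a l (a l * An.x k n i)) = 0) (t : Tens k n) :
    G.lift hn Θ hΘ (Tens.toG k n t) = Tens.lift Θ t := by
  unfold G.lift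
  rw [LinearMap.comp_apply]
  have : ((Tens.toG k n).toLinearMap.quotKerEquivOfSurjective Tens.toG_surjective).symm
      (Tens.toG k n t) = Submodule.Quotient.mk t := by
    rw [LinearEquiv.symm_apply_eq]; rfl
  rw [LinearEquiv.coe_coe, this]
  rfl

theorem G.lift_prod [CharZero k] (hn : 1 ≤ n) {M : Type*} [AddCommGroup M] [Module k M]
    (Θ : MultilinearMap k (fun _ : Fin n => An k n) M)
    (hΘ : ∀ a i, ∑ l, Θ (Function.update a l (a l * An.x k n i)) = 0) (a : Fin n → An k n) :
    G.lift hn Θ hΘ (∏ j, G.conj j (a j)) = Θ a := by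
  have : ∏ j, G.conj j (a j) = Tens.toG k n (Tens.tprod k n a) := by
    rw [Tens.tprod_eq_prod, map_prod]; rfl
  rw [this, G.lift_toG, Tens.lift_tprod]

/-! ### The presentation of `G(A_n)` -/

variable (k n) in
/-- The ideal of relations between the `x_{i,j}`. -/
def relIdeal : Ideal (MvPolynomial (Fin (n - 1) × Fin n) k) :=
  Ideal.span ((Set.range fun p : Fin (n - 1) × Fin (n - 1) × Fin n =>
    (MvPolynomial.X (p.1, p.2.2) * MvPolynomial.X (p.2.1, p.2.2) :
      MvPolynomial (Fin (n - 1) × Fin n) k)) ∪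
    Set.range fun i => ∑ j, MvPolynomial.X (i, j))

theorem presentation_X (p : Fin (n - 1) × Fin n) :
    G.presentation k n (MvPolynomial.X p) = G.conj p.2 (An.x k n p.1) := by
  rw [G.conj_x]
  exact MvPolynomial.aeval_X _ _

theorem relIdeal_le_ker [CharZero k] (hn : 1 ≤ n) :
    relIdeal k n ≤ RingHom.ker (G.presentation k n) := by
  unfold relIdeal
  rw [Ideal.span_le]
  rintro _ (⟨p, rfl⟩ | ⟨i, rfl⟩)
  · rw [SetLike.mem_coe, RingHom.mem_ker, map_mul, presentation_X, presentation_X, ← map_mul,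
      An.x_mul_x, map_zero]
  · have := G.sum_conj_vec (k := k) hn (Pi.single i 1)
    simpa [RingHom.mem_ker, presentation_X] using this

/-- The homomorphism `A_n^{⊗ n} → k[x_{i,j}] / K`, where `K` is the ideal of relations. -/
def Tens.toQuotient : Tens k n →ₐ[k] MvPolynomial (Fin (n - 1) × Fin n) k ⧸ relIdeal k n :=
  let F (j : Fin n) : An k n →ₐ[k] MvPolynomial (Fin (n - 1) × Fin n) k ⧸ relIdeal k n :=
    An.lift (fun i => Ideal.Quotient.mk _ (MvPolynomial.X (i, j))) fun i i' => by
      rw [← map_mul, Ideal.Quotient.eq_zero_iff_mem]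
      exact Ideal.subset_span (Or.inl ⟨(i, i', j), rfl⟩)
  let Θ : MultilinearMap k (fun _ : Fin n => An k n)
      (MvPolynomial (Fin (n - 1) × Fin n) k ⧸ relIdeal k n) :=
    (MultilinearMap.mkPiAlgebra k (Fin n) _).compLinearMap fun j => (F j).toLinearMap
  PiTensorProduct.liftAlgHom (R := k) (A := fun _ : Fin n => An k n) Θ
    (by simp [Θ]) (fun x y => by simp [Θ, Finset.prod_mul_distrib])

theorem Tens.toQuotient_conj_x (i : Fin (n - 1)) (j : Fin n) :
    Tens.toQuotient (Tens.conj j (An.x k n i)) =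
      Ideal.Quotient.mk (relIdeal k n) (MvPolynomial.X (i, j)) := by
  rw [Tens.conj_apply]
  refine (PiTensorProduct.lift.tprod _).trans ?_
  rw [MultilinearMap.compLinearMap_apply, MultilinearMap.mkPiAlgebra_apply,
    Finset.prod_eq_single j]
  · simp [An.lift_x]
  · intro l _ hl
    simp [hl]
  · simp

/-- The map `Tens.toQuotient` kills the traces, and composed with the map from the polynomial ring
to the tensor power it is the quotient map by `relIdeal`. Hence a polynomial whose image in the
tensor power lies in the trace ideal is itself in `relIdeal`. -/
theorem ker_presentation [CharZero k] (hn : 1 ≤ n) :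
    RingHom.ker (G.presentation k n) = relIdeal k n := by
  refine le_antisymm (fun f hf => ?_) (relIdeal_le_ker hn)
  let P : MvPolynomial (Fin (n - 1) × Fin n) k →ₐ[k] Tens k n :=
    MvPolynomial.aeval fun p => Tens.conj p.2 (An.x k n p.1)
  have h1 : G.presentation k n = (Tens.toG k n).comp P := by
    apply MvPolynomial.algHom_ext
    intro p
    simp [P, presentation_X, G.conj]
  have h2 : Tens.toQuotient.comp P = Ideal.Quotient.mkₐ k (relIdeal k n) := by
    apply MvPolynomial.algHom_ext
    intro p
    simp [P, Tens.toQuotient_conj_x]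
  have h3 : Tens.traceIdeal k n ≤ RingHom.ker (Tens.toQuotient (k := k) (n := n)) := by
    unfold Tens.traceIdeal
    rw [Ideal.span_le]
    rintro _ ⟨i, rfl⟩
    rw [SetLike.mem_coe, RingHom.mem_ker, map_sum]
    simp only [Tens.toQuotient_conj_x]
    rw [← map_sum, Ideal.Quotient.eq_zero_iff_mem]
    exact Ideal.subset_span (Or.inr ⟨i, rfl⟩)
  rw [RingHom.mem_ker, h1, AlgHom.comp_apply, Tens.toG_eq_zero_iff,
    Tens.closureIdeal_eq_traceIdeal hn] at hf
  have h4 := h3 hf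
  rw [RingHom.mem_ker, ← AlgHom.comp_apply, h2] at h4
  exact Ideal.Quotient.eq_zero_iff_mem.1 h4

theorem presentation_surjective : Function.Surjective (G.presentation k n) := by
  rw [← AlgHom.range_eq_top, eq_top_iff]
  rintro g -
  obtain ⟨t, rfl⟩ := Tens.toG_surjective g
  induction t using Tens.induction with
  | smul c a =>
    rw [map_smul, Tens.tprod_eq_prod, map_prod]
    refine Subalgebra.smul_mem _ (Subalgebra.prod_mem _ fun j _ => ?_) _
    rw [Tens.conj_eq_add, map_add, AlgHom.commutes, An.vec_apply, map_sum, map_sum]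
    refine Subalgebra.add_mem _ (Subalgebra.algebraMap_mem _ _) (Subalgebra.sum_mem _ fun i _ => ?_)
    rw [map_smul, map_smul]
    exact Subalgebra.smul_mem _ ((AlgHom.mem_range _).2 ⟨MvPolynomial.X (i, j), presentation_X _⟩) _
  | add x y hx hy => rw [map_add]; exact Subalgebra.add_mem _ hx hy

end

end GaloisClosure

/-! ### Socle elements of the Galois closure -/

namespace GaloisClosure

noncomputable section

section SquareZero

variable {R : Type*} [CommRing R] {σ : Type*} [DecidableEq σ]

theorem add_pow_of_sq_eq_zero (x : R) {y : R} (hy : y ^ 2 = 0) (q : ℕ) :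
    (x + y) ^ (q + 1) = x ^ (q + 1) + (q + 1) * x ^ q * y := by
  induction q with
  | zero => simp
  | succ q ih =>
    rw [pow_succ, ih]
    push_cast
    linear_combination ((q : R) + 1) * x ^ q * hy

theorem sum_pow_eq_zero {v : σ → R} (hv : ∀ i, v i ^ 2 = 0) (J : Finset σ) {q : ℕ}
    (hq : J.card < q) : (∑ j ∈ J, v j) ^ q = 0 := by
  induction J using Finset.induction_on generalizing q with
  | empty => simp at hq; simp [hq.ne']
  | insert a J ha ih =>
    rw [Finset.card_insert_of_notMem ha] at hq
    obtain ⟨q, rfl⟩ : ∃ q', q = q' + 1 := ⟨q - 1, by omega⟩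
    rw [Finset.sum_insert ha, add_comm, add_pow_of_sq_eq_zero _ (hv a), ih (by omega),
      ih (by omega)]
    ring

theorem sum_pow_card {v : σ → R} (hv : ∀ i, v i ^ 2 = 0) (J : Finset σ) :
    (∑ j ∈ J, v j) ^ J.card = J.card.factorial * ∏ j ∈ J, v j := by
  induction J using Finset.induction_on with
  | empty => simp
  | insert a J ha ih =>
    rw [Finset.card_insert_of_notMem ha, Finset.sum_insert ha, add_comm,
      add_pow_of_sq_eq_zero _ (hv a), sum_pow_eq_zero hv J (by omega), ih,
      Finset.prod_insert ha, Nat.factorial_succ]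
    push_cast
    ring

/-- In a ring with square-zero elements of sum zero, products of too many of them vanish. -/
theorem prod_mul_eq_zero_of_sq_eq_zero [Fintype σ] (k : Type*) [Field k] [CharZero k] [Algebra k R]
    {v : σ → R} (hv : ∀ i, v i ^ 2 = 0) (hsum : ∑ i, v i = 0) {y : R} {J T : Finset σ}
    (hJT : Disjoint J T) (hy : ∀ t ∈ T, v t * y = 0)
    (hcard : Fintype.card σ < 2 * J.card + T.card) : (∏ j ∈ J, v j) * y = 0 := by
  -- In front of y, the sum over J is minus the sum over the complement of J ∪ T, since the terms of
  -- T annihilate y.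
  have h1 : (∑ j ∈ J, v j) * y = -(∑ j ∈ (J ∪ T)ᶜ, v j) * y := by
    rw [← Finset.sum_add_sum_compl (J ∪ T) v, Finset.sum_union hJT] at hsum
    have h2 : (∑ t ∈ T, v t) * y = 0 := by
      rw [Finset.sum_mul]; exact Finset.sum_eq_zero hy
    linear_combination y * hsum - h2
  have h2 : ∀ p : ℕ, (∑ j ∈ J, v j) ^ p * y = (-(∑ j ∈ (J ∪ T)ᶜ, v j)) ^ p * y := by
    intro p
    induction p with
    | zero => simp
    | succ p ih =>
      rw [pow_succ, mul_assoc, h1, mul_left_comm, ih]; ring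
  -- At exponent |J| the left side is |J|! times the product over J, and the right side vanishes
  -- because fewer than |J| square-zero terms remain.
  have h3 := h2 J.card
  have hc : (J ∪ T).card = J.card + T.card := Finset.card_union_of_disjoint hJT
  have hc' := Finset.card_compl (J ∪ T)
  have hle := Finset.card_le_univ (J ∪ T)
  rw [sum_pow_card hv, neg_pow, sum_pow_eq_zero hv _ (by omega), mul_zero, zero_mul,
    mul_assoc] at h3
  have hu : IsUnit ((J.card.factorial : ℕ) : R) := by
    have : IsUnit ((J.card.factorial : ℕ) : k) :=
      (Nat.cast_ne_zero.mpr J.card.factorial_ne_zero).isUnit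
    simpa using this.map (algebraMap k R)
  exact hu.mul_right_eq_zero.1 h3

end SquareZero

variable {k : Type*} [Field k] {n : ℕ}

theorem G.conj_vec_mul_conj_vec (v w : Fin (n - 1) → k) (j : Fin n) :
    G.conj j (An.vec k n v) * G.conj j (An.vec k n w) = 0 := by
  rw [← map_mul, An.vec_mul_vec, map_zero]

theorem G.mem_socle_iff (s : G k n) :
    s ∈ G.socle k n ↔ ∀ i j, G.x k n i j * s = 0 := by
  rw [G.socle, Submodule.mem_annihilator_span]
  constructor
  · intro h i j
    have := h ⟨_, (i, j), rfl⟩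
    rwa [smul_eq_mul, mul_comm] at this
  · rintro h ⟨_, p, rfl⟩
    rw [smul_eq_mul, mul_comm]
    exact h _ _

/-- If l lies in J or T, then two vectors meet in column l and their product vanishes. Otherwise
x_{i,l} joins the factors of T, and enlarging T by l supplies the extra 1 in the cardinality bound.
-/
theorem G.prod_conj_mem_socle [CharZero k] (v : Fin (n - 1) → k) {J T : Finset (Fin n)}
    (hJT : Disjoint J T) (w : Fin n → Fin (n - 1) → k)
    (hcard : n < 2 * J.card + T.card + 1) :
    (∏ j ∈ J, G.conj j (An.vec k n v)) * ∏ t ∈ T, G.conj t (An.vec k n (w t)) ∈ G.socle k n := by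
  rw [G.mem_socle_iff]
  intro i l
  rw [← G.conj_x, ← An.vec_single]
  by_cases hJ : l ∈ J
  · rw [← Finset.mul_prod_erase J _ hJ, ← mul_assoc, ← mul_assoc, G.conj_vec_mul_conj_vec]
    simp
  by_cases hT : l ∈ T
  · rw [← Finset.mul_prod_erase T _ hT, mul_left_comm, ← mul_assoc (G.conj l _) (G.conj l _),
      G.conj_vec_mul_conj_vec]
    simp
  · rw [mul_left_comm]
    have hn : 1 ≤ n := by have := l.pos; omega
    refine prod_mul_eq_zero_of_sq_eq_zero k (T := insert l T) (fun j => ?_)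
      (G.sum_conj_vec hn v) (by simp [hJT, hJ]) ?_
      (by rw [Finset.card_insert_of_notMem hT]; simpa [← add_assoc] using hcard)
    · rw [pow_two, G.conj_vec_mul_conj_vec]
    · intro t ht
      rw [Finset.mem_insert] at ht
      obtain rfl | ht := ht
      · rw [← mul_assoc, G.conj_vec_mul_conj_vec, zero_mul]
      · rw [← Finset.mul_prod_erase T _ ht, mul_left_comm, ← mul_assoc (G.conj t _) (G.conj t _),
          G.conj_vec_mul_conj_vec]
        simp

/-- The multi-degree of a word in the variables. -/
def content {ι α : Type*} [Fintype ι] (f : ι → α) : α →₀ ℕ := ∑ j, Finsupp.single (f j) 1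

/-- This makes the number of words of content d nonzero, a factor that is divided out in the proof
of linear independence. -/
theorem exists_content_eq {ι α : Type*} [Fintype ι] (d : α →₀ ℕ)
    (hd : (Finsupp.toMultiset d).card = Fintype.card ι) : ∃ f : ι → α, content f = d := by
  classical
  let l := (Finsupp.toMultiset d).toList
  have hl : Fintype.card ι = l.length := by rw [← hd]; simp [l]
  let e : ι ≃ Fin l.length := Fintype.equivFinOfCardEq hl
  refine ⟨fun j => l.get (e j), ?_⟩
  unfold content
  rw [e.sum_comp (fun j => Finsupp.single (l.get j) 1)]
  have h1 : ∑ j, Finsupp.single (l.get j) 1 = (l.map fun a => Finsupp.single a 1).sum := by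
    rw [← List.sum_ofFn]
    congr 1
    apply List.ext_get <;> simp
  rw [h1]
  have h2 : ((Finsupp.toMultiset d).map fun a => Finsupp.single a 1).sum = d := by
    rw [← (Multiset.toFinsupp (α := α)).symm.injective.eq_iff, map_multiset_sum, Multiset.map_map]
    simp
  conv_rhs => rw [← h2]
  rw [← Multiset.coe_toList (Finsupp.toMultiset d), Multiset.map_coe, Multiset.sum_coe]

open Classical in
/-- The coefficient of `t^d` in `∏_{j ∈ J} ∑_i t_i x_{i,j}`. -/
def G.polarized (k : Type*) [Field k] {n : ℕ} (J : Finset (Fin n)) (d : Fin (n - 1) →₀ ℕ) :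
    G k n :=
  ∑ f : J → Fin (n - 1) with content f = d, ∏ j : J, G.x k n (f j) j

theorem G.polarized_eq_coeff (J : Finset (Fin n)) (d : Fin (n - 1) →₀ ℕ) :
    G.polarized k J d =
      (∏ j ∈ J, ∑ i, MvPolynomial.monomial (Finsupp.single i 1) (G.x k n i j)).coeff d := by
  classical
  rw [← Finset.prod_coe_sort, Finset.prod_univ_sum, MvPolynomial.coeff_sum, G.polarized,
    Finset.sum_filter]
  simp only [Fintype.piFinset_univ]
  refine Finset.sum_congr rfl fun f _ => ?_
  rw [← MvPolynomial.monomial_sum_prod, MvPolynomial.coeff_monomial]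
  rfl

/-- The vanishing is proved for generic linear forms: over the polynomial ring in t with
coefficients in G(A_n), the elements ∑_i t_i x_{i,j} are square-zero with sum zero. The coefficient
of t^d is then compared. -/
theorem G.polarized_mem_socle [CharZero k] {J : Finset (Fin n)} (hJ : n ≤ 2 * J.card)
    (d : Fin (n - 1) →₀ ℕ) : G.polarized k J d ∈ G.socle k n := by
  rw [G.mem_socle_iff]
  intro a l
  have hn : 1 ≤ n := by have := l.pos; omega
  set v : Fin n → MvPolynomial (Fin (n - 1)) (G k n) := fun j =>
    ∑ i, MvPolynomial.monomial (Finsupp.single i 1) (G.x k n i j) with hv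
  have hx : ∀ i j a, G.x k n i j * G.x k n a j = 0 := by
    intro i j a
    rw [← G.conj_x, ← G.conj_x, ← map_mul, An.x_mul_x, map_zero]
  have hvx : ∀ j a, v j * MvPolynomial.C (G.x k n a j) = 0 := by
    intro j a
    rw [hv, Finset.sum_mul]
    refine Finset.sum_eq_zero fun i _ => ?_
    rw [mul_comm, MvPolynomial.C_mul_monomial, hx, MvPolynomial.monomial_zero]
  have h : (∏ j ∈ J, v j) * MvPolynomial.C (G.x k n a l) = 0 := by
    by_cases hl : l ∈ J
    · rw [← Finset.mul_prod_erase J _ hl, mul_right_comm, hvx, zero_mul]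
    · refine prod_mul_eq_zero_of_sq_eq_zero k (T := {l}) (fun j => ?_) ?_ (by simpa using hl)
        (by simpa using hvx l a) (by simpa using by omega)
      · rw [sq (v j), hv, Finset.sum_mul_sum]
        refine Finset.sum_eq_zero fun i _ => Finset.sum_eq_zero fun i' _ => ?_
        rw [MvPolynomial.monomial_mul, hx, MvPolynomial.monomial_zero]
      · rw [hv, Finset.sum_comm]
        refine Finset.sum_eq_zero fun i _ => ?_
        have := G.sum_conj_vec (k := k) hn (Pi.single i 1)
        simp only [An.vec_single, G.conj_x] at this
        rw [← map_sum, this, MvPolynomial.monomial_zero]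
  have h2 := congrArg (MvPolynomial.coeff d) h
  rwa [mul_comm, MvPolynomial.coeff_C_mul, MvPolynomial.coeff_zero, ← G.polarized_eq_coeff] at h2

theorem content_apply {ι α : Type*} [Fintype ι] [DecidableEq α] (f : ι → α) (a : α) :
    content f a = ∑ j, (Pi.single (f j) 1 : α → ℕ) a := by
  simp [content, Finsupp.finsetSum_apply, Finsupp.single_apply, Pi.single_apply, eq_comm]

theorem G.prod_x_mem_component {ι : Type*} [Fintype ι] (f : ι → Fin (n - 1)) (e : ι → Fin n) :
    ∏ j, G.x k n (f j) (e j) ∈ G.component k n (content f) := by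
  refine ⟨∏ j, MvPolynomial.X (f j, e j), ?_, ?_⟩
  · rw [SetLike.mem_coe, MvPolynomial.mem_weightedHomogeneousSubmodule]
    have := MvPolynomial.IsWeightedHomogeneous.prod (R := k) Finset.univ
      (fun j : ι => MvPolynomial.X (f j, e j))
      (fun j => (Pi.single (f j) 1 : Fin (n - 1) → ℕ))
      (w := fun p : Fin (n - 1) × Fin n => (Pi.single p.1 1 : Fin (n - 1) → ℕ))
      (fun j _ => MvPolynomial.isWeightedHomogeneous_X k _ _)
    convert this using 1
    funext a
    rw [content_apply, Finset.sum_apply]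
  · rw [AlgHom.toLinearMap_apply, map_prod]
    simp only [presentation_X, G.conj_x]

theorem G.polarized_mem_component (J : Finset (Fin n)) (d : Fin (n - 1) →₀ ℕ) :
    G.polarized k J d ∈ G.component k n d := by
  classical
  refine Submodule.sum_mem _ fun f hf => ?_
  rw [Finset.mem_filter] at hf
  rw [← hf.2]
  exact G.prod_x_mem_component f _

/-! ### Linear independence of polarized elements -/

variable (k n) in
/-- The generic linear form on `A_n`. -/
def An.generic : An k n →ₗ[k] MvPolynomial (Fin (n - 1)) k where
  toFun a := ∑ i, MvPolynomial.monomial (Finsupp.single i 1) (An.coord k n a i)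
  map_add' a b := by simp [Finset.sum_add_distrib]
  map_smul' c a := by simp [Finset.smul_sum, MvPolynomial.smul_monomial]

theorem An.generic_x (i : Fin (n - 1)) : An.generic k n (An.x k n i) = MvPolynomial.X i := by
  change ∑ j, MvPolynomial.monomial (Finsupp.single j 1) (An.coord k n (An.x k n i) j) = _
  rw [Finset.sum_eq_single i]
  · simp [MvPolynomial.X]
  · intro j _ hj; simp [hj]
  · simp

variable (k n) in
/-- The augmentation of `A_n` with values in a polynomial ring. -/
def An.augC : An k n →ₗ[k] MvPolynomial (Fin (n - 1)) k :=
  (Algebra.linearMap k _) ∘ₗ (An.aug k n).toLinearMap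

theorem An.augC_apply (a : An k n) : An.augC k n a = MvPolynomial.C (An.aug k n a) := rfl

theorem An.mul_x (a : An k n) (i : Fin (n - 1)) :
    a * An.x k n i = An.aug k n a • An.x k n i := by
  rw [← An.vec_single, An.mul_vec]

open Classical in
variable (k) in
/-- The down operator on functions on `m`-subsets. -/
def downMap (n m : ℕ) : ({J : Finset (Fin n) // J.card = m} → k) →ₗ[k]
    ({K : Finset (Fin n) // K.card = m - 1} → k) :=
  LinearMap.pi fun K => ∑ J : {J : Finset (Fin n) // J.card = m},
    if K.1 ⊆ J.1 then LinearMap.proj J else 0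

open Classical in
theorem downMap_apply (n m : ℕ) (g : {J : Finset (Fin n) // J.card = m} → k)
    (K : {K : Finset (Fin n) // K.card = m - 1}) :
    downMap k n m g K = ∑ J : {J : Finset (Fin n) // J.card = m},
      if K.1 ⊆ J.1 then g J else 0 := by
  simp only [downMap, LinearMap.pi_apply, LinearMap.sum_apply]
  exact Finset.sum_congr rfl fun J _ => by split_ifs <;> simp

/-- By rank-nullity the kernel has dimension at least C(2m, m) - C(2m, m-1), which is the Catalan
number. -/
theorem catalan_le_finrank_ker_downMap {m : ℕ} (hm : 1 ≤ m) :
    catalan m ≤ Module.finrank k (LinearMap.ker (downMap k (2 * m) m)) := by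
  have h1 := (downMap k (2 * m) m).finrank_range_add_finrank_ker
  have h2 := Submodule.finrank_le (LinearMap.range (downMap k (2 * m) m))
  simp only [Module.finrank_fintype_fun_eq_card, Fintype.card_finset_len, Fintype.card_fin]
    at h1 h2
  have h3 := succ_mul_catalan_eq_centralBinom m
  rw [Nat.centralBinom_eq_two_mul_choose] at h3
  have h4 := Nat.choose_succ_right_eq (2 * m) (m - 1)
  rw [Nat.sub_add_cancel hm, show 2 * m - (m - 1) = m + 1 by omega] at h4
  have h5 : (m + 1) * (2 * m).choose (m - 1) = (m + 1) * (m * catalan m) := by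
    rw [mul_comm, ← h4, ← h3]; ring
  have h6 := Nat.eq_of_mul_eq_mul_left (Nat.succ_pos m) h5
  have h7 : (2 * m).choose m = (2 * m).choose (m - 1) + catalan m := by
    rw [← h3, h6]; ring
  omega

/-- The multilinear map which takes `∏_{j ∈ J} x_{f(j),j}` to `g(J) ∏_{j ∈ J} t_{f(j)}`. -/
def subsetForm {m : ℕ} (g : {J : Finset (Fin n) // J.card = m} → k) :
    MultilinearMap k (fun _ : Fin n => An k n) (MvPolynomial (Fin (n - 1)) k) :=
  ∑ J, g J • (MultilinearMap.mkPiAlgebra k (Fin n) _).compLinearMap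
    fun j => if j ∈ J.1 then An.generic k n else An.augC k n

theorem subsetForm_apply {m : ℕ} (g : {J : Finset (Fin n) // J.card = m} → k)
    (a : Fin n → An k n) : subsetForm g a =
      ∑ J, g J • ∏ j, if j ∈ J.1 then An.generic k n (a j) else An.augC k n (a j) := by
  unfold subsetForm
  rw [sum_apply]
  refine Finset.sum_congr rfl fun J _ => ?_
  rw [smul_apply, MultilinearMap.compLinearMap_apply,
    MultilinearMap.mkPiAlgebra_apply]
  congr 1
  exact Finset.prod_congr rfl fun j _ => by split_ifs <;> rfl

theorem subsetForm_update {m : ℕ} (g : {J : Finset (Fin n) // J.card = m} → k)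
    (a : Fin n → An k n) (i : Fin (n - 1)) (l : Fin n) :
    subsetForm g (Function.update a l (a l * An.x k n i)) =
      ∑ J : {J : Finset (Fin n) // J.card = m}, if l ∈ J.1 then
        g J • (MvPolynomial.X i * ∏ j, if j ∈ J.1.erase l then An.generic k n (a j)
          else An.augC k n (a j)) else 0 := by
  rw [subsetForm_apply]
  refine Finset.sum_congr rfl fun J _ => ?_
  split_ifs with h
  · congr 1
    rw [← Finset.mul_prod_erase _ _ (Finset.mem_univ l),
      ← Finset.mul_prod_erase _ (fun j => if j ∈ J.1.erase l then _ else _) (Finset.mem_univ l),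
      if_pos h, if_neg (Finset.notMem_erase l _), ← mul_assoc]
    congr 1
    · rw [Function.update_self, An.mul_x, map_smul, An.generic_x, An.augC_apply,
        MvPolynomial.smul_eq_C_mul, mul_comm]
    · refine Finset.prod_congr rfl fun j hj => ?_
      rw [Function.update_of_ne (Finset.ne_of_mem_erase hj)]
      simp [Finset.ne_of_mem_erase hj]
  · rw [Finset.prod_eq_zero (Finset.mem_univ l), smul_zero]
    rw [if_neg h, Function.update_self, An.mul_x, map_smul, An.augC_apply, An.aug_x, map_zero,
      smul_zero]

/-- Multiplying factor l by x_i turns the summand of a set J containing l into g(J) t_i times the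
product belonging to J \ {l}. Collecting terms by K = J \ {l}, the coefficient is the sum of g over
the m-subsets containing K, which is zero. -/
theorem sum_subsetForm_update {m : ℕ} (hm : 1 ≤ m) {g : {J : Finset (Fin n) // J.card = m} → k}
    (hg : g ∈ LinearMap.ker (downMap k n m)) (a : Fin n → An k n) (i : Fin (n - 1)) :
    ∑ l, subsetForm g (Function.update a l (a l * An.x k n i)) = 0 := by
  classical
  simp only [subsetForm_update]
  set W : Finset (Fin n) → MvPolynomial (Fin (n - 1)) k := fun K =>
    MvPolynomial.X i * ∏ j, if j ∈ K then An.generic k n (a j) else An.augC k n (a j) with hW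
  rw [Finset.sum_comm]
  have key : ∀ J : {J : Finset (Fin n) // J.card = m},
      (∑ l, if l ∈ J.1 then g J • W (J.1.erase l) else 0) =
      ∑ K : {K : Finset (Fin n) // K.card = m - 1}, (if K.1 ⊆ J.1 then g J else 0) • W K := by
    intro J
    rw [← Finset.sum_filter]
    simp only [ite_smul, zero_smul]
    rw [← Finset.sum_filter]
    refine Finset.sum_bij (fun l hl => ⟨J.1.erase l, ?_⟩) ?_ ?_ ?_ ?_
    · rw [Finset.card_erase_of_mem (by simpa using hl), J.2]
    · intro l hl
      simp [Finset.erase_subset]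
    · intro l hl l' hl' h
      simp only [Finset.mem_filter, Finset.mem_univ, true_and] at hl hl'
      exact Finset.erase_injOn J.1 hl hl' (congrArg Subtype.val h)
    · intro K hK
      simp only [Finset.mem_filter, Finset.mem_univ, true_and] at hK
      obtain ⟨l, hl⟩ : (J.1 \ K.1).Nonempty := by
        rw [← Finset.card_pos, Finset.card_sdiff_of_subset hK, J.2, K.2]
        omega
      rw [Finset.mem_sdiff] at hl
      refine ⟨l, by simpa using hl.1, Subtype.ext (Finset.eq_of_subset_of_card_le ?_ ?_).symm⟩
      · intro j hj
        exact Finset.mem_erase.2 ⟨fun h => hl.2 (h ▸ hj), hK hj⟩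
      · rw [Finset.card_erase_of_mem hl.1, J.2, K.2]
    · intro l hl; rfl
  rw [Finset.sum_congr rfl fun J _ => key J, Finset.sum_comm]
  refine Finset.sum_eq_zero fun K _ => ?_
  rw [← Finset.sum_smul, ← downMap_apply, LinearMap.mem_ker.1 hg, Pi.zero_apply, zero_smul]

/-- On ∏_{j ∈ J} x_{f(j),j} only the summand of J survives: any other m-subset contains a column
whose factor is 1, on which the generic linear form vanishes. All words of content d give the same
monomial, which accounts for the cardinality. -/
theorem subsetForm_lift_polarized [CharZero k] (hn : 1 ≤ n) {m : ℕ} (hm : 1 ≤ m)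
    {g : {J : Finset (Fin n) // J.card = m} → k} (hg : g ∈ LinearMap.ker (downMap k n m))
    (J : {J : Finset (Fin n) // J.card = m}) (d : Fin (n - 1) →₀ ℕ) :
    G.lift hn (subsetForm g) (sum_subsetForm_update hm hg) (G.polarized k J.1 d) =
      MvPolynomial.monomial d
        ((Fintype.card {f : J.1 → Fin (n - 1) // content f = d} : k) * g J) := by
  classical
  have key : ∀ f : J.1 → Fin (n - 1),
      G.lift hn (subsetForm g) (sum_subsetForm_update hm hg) (∏ j : J.1, G.x k n (f j) j) =
        MvPolynomial.monomial (content f) (g J) := by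
    intro f
    set a : Fin n → An k n := fun j => if h : j ∈ J.1 then An.x k n (f ⟨j, h⟩) else 1 with ha
    have h1 : ∏ j : J.1, G.x k n (f j) j = ∏ j, G.conj j (a j) := by
      have h2 : ∀ j : J.1, G.x k n (f j) j = G.conj j.1 (a j.1) := by
        intro j
        rw [ha]; simp only [j.2, dif_pos, G.conj_x]
      rw [Fintype.prod_congr _ _ h2, Finset.prod_coe_sort J.1 fun j => G.conj j (a j)]
      refine Finset.prod_subset (Finset.subset_univ J.1) fun j _ hj => ?_
      rw [ha]; simp only [hj, not_false_eq_true, dif_neg, map_one]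
    rw [h1, G.lift_prod, subsetForm_apply, Finset.sum_eq_single J]
    · rw [← Finset.prod_subset (Finset.subset_univ J.1), ← Finset.prod_coe_sort]
      · have h2 : ∀ j : J.1, (if j.1 ∈ J.1 then An.generic k n (a j) else An.augC k n (a j)) =
            MvPolynomial.monomial (Finsupp.single (f j) 1) 1 := by
          intro j
          rw [if_pos j.2, ha]; simp only [j.2, dif_pos, An.generic_x]
          rfl
        rw [Finset.prod_congr rfl (fun (j : J.1) _ => h2 j), ← MvPolynomial.monomial_sum_one,
          MvPolynomial.smul_monomial, smul_eq_mul, mul_one]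
        rfl
      · intro j _ hj
        rw [if_neg hj, ha]; simp [hj, An.augC_apply]
    · intro J' _ hJ'
      obtain ⟨j, hj, hjJ⟩ : ∃ j ∈ J'.1, j ∉ J.1 := by
        by_contra h
        push Not at h
        exact hJ' (Subtype.ext (Finset.eq_of_subset_of_card_le h (by rw [J.2, J'.2])))
      have h0 : (if j ∈ J'.1 then An.generic k n (a j) else An.augC k n (a j)) = 0 := by
        rw [if_pos hj, ha]
        simp [hjJ, An.generic]
      rw [Finset.prod_eq_zero (Finset.mem_univ j) h0, smul_zero]
    · simp
  rw [G.polarized, map_sum, Finset.sum_congr rfl fun f _ => key f]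
  rw [Finset.sum_congr rfl fun f hf => by rw [(Finset.mem_filter.1 hf).2]]
  rw [Finset.sum_const, Fintype.card_subtype, ← map_nsmul, nsmul_eq_mul]

/-- The evaluations at m-subsets separate the points of the kernel of the down operator, so they
span its dual and C_m of them are independent. Different multi-degrees are kept apart by the
monomials t^d. -/
theorem exists_linearIndependent_polarized [CharZero k] {m : ℕ} (hm : 1 ≤ m) :
    ∃ J : Fin (catalan m) → {J : Finset (Fin (2 * m)) // J.card = m},
      LinearIndependent k (fun p : Fin (catalan m) ×
        {d : Fin (2 * m - 1) →₀ ℕ // (Finsupp.toMultiset d).card = m} =>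
          G.polarized k (J p.1).1 p.2.1) := by
  classical
  have hn : 1 ≤ 2 * m := by omega
  set D := LinearMap.ker (downMap k (2 * m) m) with hD
  let ev (J : {J : Finset (Fin (2 * m)) // J.card = m}) : Module.Dual k D :=
    LinearMap.proj J ∘ₗ D.subtype
  have hspan : Submodule.span k (Set.range ev) = ⊤ := by
    rw [← Subspace.dualCoannihilator_dualAnnihilator_eq
      (W := Submodule.span k (Set.range ev))]
    have : (Submodule.span k (Set.range ev)).dualCoannihilator = ⊥ := by
      rw [eq_bot_iff]
      intro g hg
      rw [Submodule.mem_dualCoannihilator] at hg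
      rw [Submodule.mem_bot]
      ext J
      exact hg _ (Submodule.subset_span ⟨J, rfl⟩)
    rw [this, Submodule.dualAnnihilator_bot]
  obtain ⟨F, hF, -, hli⟩ := Submodule.exists_fun_fin_finrank_span_eq k (Set.range ev)
  have hcard : catalan m ≤ Module.finrank k (Submodule.span k (Set.range ev)) := by
    rw [hspan, finrank_top, Subspace.dual_finrank_eq]
    exact catalan_le_finrank_ker_downMap hm
  choose J hJ using hF
  refine ⟨fun i => J (Fin.castLE hcard i), ?_⟩
  replace hli : LinearIndependent k fun i => ev (J (Fin.castLE hcard i)) := by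
    have := hli.comp _ (Fin.castLE_injective hcard)
    simpa only [Function.comp_def, ← hJ] using this
  rw [linearIndependent_iff']
  intro s c hc p hp
  set N : Fin (catalan m) → k := fun i =>
    (Fintype.card {f : (J (Fin.castLE hcard i)).1 → Fin (2 * m - 1) // content f = p.2.1} : k)
    with hN
  have hN0 : N p.1 ≠ 0 := by
    rw [hN]
    obtain ⟨f, hf⟩ := exists_content_eq (ι := (J (Fin.castLE hcard p.1)).1) p.2.1
      (by rw [p.2.2, Fintype.card_coe, (J _).2])
    have : Nonempty {f : (J (Fin.castLE hcard p.1)).1 → Fin (2 * m - 1) // content f = p.2.1} :=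
      ⟨⟨f, hf⟩⟩
    exact Nat.cast_ne_zero.2 Fintype.card_ne_zero
  -- Applying the functional of an arbitrary g to the relation and taking the coefficient of t^d,
  -- for the d of p, leaves a relation among the chosen evaluations.
  have hsum : ∑ i, (if (i, p.2) ∈ s then c (i, p.2) * N i else 0) •
      ev (J (Fin.castLE hcard i)) = 0 := by
    ext g
    have h1 := congrArg (G.lift hn (subsetForm g.1) (sum_subsetForm_update hm g.2)) hc
    rw [map_sum, map_zero] at h1
    simp only [map_smul] at h1
    rw [Finset.sum_congr rfl fun q _ => by
      rw [subsetForm_lift_polarized hn hm g.2]] at h1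
    have h2 := congrArg (MvPolynomial.coeff p.2.1) h1
    rw [MvPolynomial.coeff_sum, MvPolynomial.coeff_zero] at h2
    simp only [MvPolynomial.coeff_smul, MvPolynomial.coeff_monomial, smul_eq_mul, mul_ite,
      mul_zero] at h2
    rw [← Finset.sum_filter] at h2
    rw [LinearMap.sum_apply, LinearMap.zero_apply]
    refine Eq.trans ?_ h2
    simp only [LinearMap.smul_apply, smul_eq_mul, ite_mul, zero_mul]
    rw [← Finset.sum_filter]
    refine Finset.sum_bij (fun i _ => (i, p.2)) ?_ ?_ ?_ ?_
    · intro i hi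
      simpa using hi
    · intro i _ j _ h
      exact congrArg Prod.fst h
    · rintro ⟨i, d⟩ hi
      rw [Finset.mem_filter] at hi
      have hd : d = p.2 := Subtype.ext hi.2
      subst hd
      exact ⟨i, by simpa using hi.1, rfl⟩
    · intro i _
      rw [mul_assoc]
      rfl
  have h3 := Fintype.linearIndependent_iff.1 hli _ hsum p.1
  rw [if_pos (by simpa using hp)] at h3
  exact (mul_eq_zero.1 h3).resolve_right hN0

end

end GaloisClosure

/-! ### Counting multi-degrees, and the case of even n ≥ 6 -/

namespace GaloisClosure

noncomputable section

theorem exists_map_univ_eq {α : Type*} {N : ℕ} (M : Multiset α) (hM : M.card = N) :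
    ∃ f : Fin N → α, Finset.univ.val.map f = M := by
  subst hM
  induction M using Quotient.inductionOn with
  | h l =>
    refine ⟨fun i => l.get i, ?_⟩
    rw [Fin.univ_val_map]
    exact congrArg _ (List.ofFn_get l)

/-- Orbit counting: every fibre of σ ↦ f ∘ σ is a coset of the stabilizer of f, whose order is the
product of the factorials of the multiplicities. -/
theorem card_image_comp_perm {α β : Type*} [Fintype α] [DecidableEq α] [DecidableEq β]
    (f : α → β) :
    (Finset.univ.image fun σ : Equiv.Perm α => f ∘ σ).card *
      ∏ b ∈ Finset.univ.image f, ((Finset.univ.val.map f).count b).factorial =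
        (Fintype.card α).factorial := by
  have h := Finset.card_eq_sum_card_image (fun σ : Equiv.Perm α => f ∘ σ) Finset.univ
  rw [Finset.card_univ, Fintype.card_perm] at h
  rw [h, ← smul_eq_mul, ← Finset.sum_const]
  refine Finset.sum_congr rfl fun d hd => ?_
  obtain ⟨σ₀, -, rfl⟩ := Finset.mem_image.1 hd
  have h1 := DomMulAct.stabilizer_card' f
  have h2 : ∀ b, (Finset.univ.val.map f).count b = Fintype.card {a // f a = b} := by
    intro b
    rw [Multiset.count_map, Fintype.card_subtype, ← Finset.filter_val, Finset.card_val]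
    simp [eq_comm]
  simp only [h2]
  rw [← h1, Fintype.card_subtype]
  refine (Finset.card_bij (fun σ _ => σ * σ₀⁻¹) ?_ ?_ ?_).symm
  · intro σ hσ
    simp only [Finset.mem_filter, Finset.mem_univ, true_and] at hσ ⊢
    rw [Equiv.Perm.coe_mul, ← Function.comp_assoc, hσ, Function.comp_assoc, ← Equiv.Perm.coe_mul]
    simp
  · intro σ _ τ _ h
    exact mul_right_cancel h
  · intro σ hσ
    simp only [Finset.mem_filter, Finset.mem_univ, true_and] at hσ
    refine ⟨σ * σ₀, ?_, by simp⟩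
    simp only [Finset.mem_filter, Finset.mem_univ, true_and]
    rw [Equiv.Perm.coe_mul, ← Function.comp_assoc, hσ]

/-- The parts other than the largest one, padded by zeros. -/
def tailParts {n : ℕ} (p : n.Partition) : Multiset ℕ :=
  p.parts.erase (part₁ p) + Multiset.replicate (n - p.parts.card) 0

theorem part₁_mem {n : ℕ} (hn : 1 ≤ n) (p : n.Partition) : part₁ p ∈ p.parts := by
  have hne : p.parts ≠ 0 := by
    intro h
    have := p.parts_sum
    rw [h] at this
    simp at this
    omega
  have : ∀ s : Multiset ℕ, s ≠ 0 → s.sup ∈ s := by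
    intro s
    induction s using Multiset.induction_on with
    | empty => simp
    | cons a s ih =>
      intro _
      rw [Multiset.sup_cons, Multiset.mem_cons]
      obtain rfl | hs := eq_or_ne s 0
      · simp
      · obtain h | h := le_total a s.sup
        · rw [sup_eq_right.2 h]; exact Or.inr (ih hs)
        · rw [sup_eq_left.2 h]; exact Or.inl rfl
  exact this _ hne

theorem card_parts_le {n : ℕ} (p : n.Partition) : p.parts.card ≤ n := by
  conv_rhs => rw [← p.parts_sum]
  rw [← mul_one p.parts.card, ← smul_eq_mul]
  exact Multiset.card_nsmul_le_sum fun i hi => p.parts_pos hi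

theorem card_tailParts {n : ℕ} (hn : 1 ≤ n) (p : n.Partition) : (tailParts p).card = n - 1 := by
  have h := part₁_mem hn p
  have h1 := card_parts_le p
  have h2 := Multiset.card_pos_iff_exists_mem.2 ⟨_, h⟩
  rw [tailParts, Multiset.card_add, Multiset.card_erase_of_mem h, Multiset.card_replicate,
    Nat.pred_eq_sub_one]
  omega

theorem sum_tailParts {n : ℕ} (hn : 1 ≤ n) (p : n.Partition) :
    (tailParts p).sum + part₁ p = n := by
  have h := Multiset.sum_erase (part₁_mem hn p)
  rw [p.parts_sum] at h
  rw [tailParts, Multiset.sum_add, Multiset.sum_replicate]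
  simp; omega

theorem le_part₂_of_mem_tailParts {n : ℕ} {p : n.Partition} {i : ℕ} (hi : i ∈ tailParts p) :
    i ≤ part₂ p := by
  rw [tailParts, Multiset.mem_add] at hi
  obtain hi | hi := hi
  · exact Multiset.le_sup hi
  · rw [Multiset.eq_of_mem_replicate hi]; exact Nat.zero_le _

/-- A partition is recovered from λ_1 and its padded tail; since λ_1 is fixed on `P n`, arrangements
of the tails of different partitions are different. -/
theorem parts_eq_of_tailParts {n : ℕ} (hn : 1 ≤ n) (p : n.Partition) :
    p.parts = part₁ p ::ₘ (tailParts p).filter (· ≠ 0) := by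
  rw [tailParts, Multiset.filter_add]
  have h1 : (Multiset.replicate (n - p.parts.card) 0).filter (· ≠ 0) = 0 := by
    rw [Multiset.filter_eq_nil]
    intro a ha
    simp [Multiset.eq_of_mem_replicate ha]
  have h2 : (p.parts.erase (part₁ p)).filter (· ≠ 0) = p.parts.erase (part₁ p) := by
    rw [Multiset.filter_eq_self]
    intro a ha
    exact (p.parts_pos (Multiset.mem_of_mem_erase ha)).ne'
  rw [h1, h2, add_zero, Multiset.cons_erase (part₁_mem hn p)]

/-- The vectors of sum `m` with entries at most `m - 2`. -/
def boundedDegrees (N m : ℕ) : Finset (Fin N → ℕ) :=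
  {d ∈ Fintype.piFinset fun _ => Finset.range (m - 1) | ∑ j, d j = m}

/-- The number m_λ counts the arrangements of the n - 1 entries of the tail of λ. Such an
arrangement has sum n - λ_1 = m and entries at most λ_2 ≤ m - 2, so it is a bounded multi-degree. -/
theorem sum_m_le_card_boundedDegrees {n m : ℕ} (hm : 2 ≤ m) (hn : n = 2 * m) :
    ∑ p ∈ P n, GaloisClosure.m p ≤ (boundedDegrees (n - 1) m).card := by
  classical
  have hn1 : 1 ≤ n := by omega
  choose f hf using fun p : n.Partition => exists_map_univ_eq (tailParts p) (card_tailParts hn1 p)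
  let I (p : n.Partition) : Finset (Fin (n - 1) → ℕ) :=
    Finset.univ.image fun σ : Equiv.Perm (Fin (n - 1)) => f p ∘ σ
  have hI : ∀ p, ∀ d ∈ I p, Finset.univ.val.map d = tailParts p := by
    intro p d hd
    obtain ⟨σ, -, rfl⟩ := Finset.mem_image.1 hd
    rw [← hf p, ← Multiset.map_map]
    congr 1
    exact congrArg Finset.val (Finset.map_univ_equiv σ)
  have hm1 : ∀ p ∈ P n, GaloisClosure.m p = (I p).card := by
    intro p hp
    have h := card_image_comp_perm (f p)
    rw [hf p, Fintype.card_fin] at h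
    -- The range of j covers all entries of the tail, because they are at most λ_2 < n, and values
    -- that do not occur contribute 0! = 1.
    have h1 : ∏ b ∈ Finset.univ.image (f p), ((tailParts p).count b).factorial =
        ∏ j ∈ Finset.range n, (multiplicity p j).factorial := by
      refine Finset.prod_subset ?_ ?_
      · intro b hb
        obtain ⟨j, -, rfl⟩ := Finset.mem_image.1 hb
        have h2 : f p j ∈ tailParts p := by
          rw [← hf p]; exact Multiset.mem_map_of_mem _ (Finset.mem_univ j)
        have h3 := le_part₂_of_mem_tailParts h2
        simp only [P, Finset.mem_filter] at hp
        rw [Finset.mem_range]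
        omega
      · intro b _ hb
        have : b ∉ tailParts p := by
          rw [← hf p]
          intro h
          obtain ⟨j, -, rfl⟩ := Multiset.mem_map.1 h
          exact hb (Finset.mem_image_of_mem _ (Finset.mem_univ j))
        rw [Multiset.count_eq_zero_of_notMem this, Nat.factorial_zero]
    rw [GaloisClosure.m, ← h1, ← h]
    exact Nat.mul_div_cancel _ (Finset.prod_pos fun b _ => Nat.factorial_pos _)
  rw [Finset.sum_congr rfl hm1, ← Finset.card_biUnion]
  · refine Finset.card_le_card fun d hd => ?_
    obtain ⟨p, hp, hd⟩ := Finset.mem_biUnion.1 hd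
    have h1 := hI p d hd
    simp only [P, Finset.mem_filter] at hp
    rw [boundedDegrees, Finset.mem_filter, Fintype.mem_piFinset]
    constructor
    · intro j
      have h2 : d j ∈ tailParts p := by
        rw [← h1]; exact Multiset.mem_map_of_mem _ (Finset.mem_univ j)
      have h3 := le_part₂_of_mem_tailParts h2
      rw [Finset.mem_range]
      omega
    · have h2 := sum_tailParts hn1 p
      rw [← h1] at h2
      change ∑ j, d j + _ = n at h2
      omega
  · intro p hp q hq hpq
    rw [Function.onFun, Finset.disjoint_left]
    intro d hd hd'
    apply hpq
    simp only [P, Finset.coe_filter, Set.mem_ofPred_eq] at hp hq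
    apply Nat.Partition.ext
    rw [parts_eq_of_tailParts hn1 p, parts_eq_of_tailParts hn1 q, ← hI p d hd, ← hI q d hd',
      hp.2.1, hq.2.1]

theorem exists_socle_of_even {k : Type*} [Field k] [CharZero k] {n : ℕ} (hn : 6 ≤ n)
    (he : Even n) {r : ℕ} (hr : r ≤ R n) :
    ∃ (s : Fin r → G k n) (d : Fin r → Fin (n - 1) → ℕ),
      LinearIndependent k s ∧ (∀ i, s i ∈ G.socle k n) ∧
      (∀ i, s i ∈ G.component k n (d i)) ∧ (∀ i, ∑ j, d i j = (n + 1) / 2) ∧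
      ∀ i j, d i j ≤ n / 2 - 2 := by
  obtain ⟨m, hm⟩ := he
  obtain rfl : n = 2 * m := by omega
  rw [R, if_neg (by omega), if_neg (by omega), Nat.mul_div_cancel_left _ (by norm_num)] at hr
  have hcard : r ≤ Fintype.card (Fin (catalan m) × boundedDegrees (2 * m - 1) m) := by
    rw [Fintype.card_prod, Fintype.card_fin, Fintype.card_coe]
    exact hr.trans (Nat.mul_le_mul_left _ (sum_m_le_card_boundedDegrees (by omega) rfl))
  obtain ⟨e⟩ := Function.Embedding.nonempty_of_card_le (α := Fin r)
    (β := Fin (catalan m) × boundedDegrees (2 * m - 1) m) (by simpa using hcard)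
  obtain ⟨J, hJ⟩ := exists_linearIndependent_polarized (k := k) (m := m) (by omega)
  have hsum : ∀ d : boundedDegrees (2 * m - 1) m, ∑ j, d.1 j = m := fun d =>
    (Finset.mem_filter.1 d.2).2
  let F (p : Fin (catalan m) × boundedDegrees (2 * m - 1) m) : Fin (catalan m) ×
      {d : Fin (2 * m - 1) →₀ ℕ // (Finsupp.toMultiset d).card = m} :=
    (p.1, ⟨Finsupp.equivFunOnFinite.symm p.2.1, by
      rw [Finsupp.card_toMultiset, Finsupp.sum_fintype _ _ (fun _ => rfl)]
      exact hsum p.2⟩)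
  have hF : Function.Injective F := by
    rintro ⟨i, d⟩ ⟨i', d'⟩ h
    simp only [F, Prod.mk.injEq, Subtype.mk.injEq, EmbeddingLike.apply_eq_iff_eq] at h
    exact Prod.ext h.1 (Subtype.ext h.2)
  refine ⟨_, fun i => (e i).2.1, hJ.comp _ (hF.comp e.injective), fun i => ?_, fun i => ?_,
    fun i => ?_, fun i j => ?_⟩
  · change G.polarized k (J (F (e i)).1).1 (F (e i)).2.1 ∈ _
    exact G.polarized_mem_socle (by rw [(J _).2]) _
  · exact G.polarized_mem_component (k := k) (J (F (e i)).1).1 (F (e i)).2.1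
  · rw [hsum]; omega
  · have h1 := Fintype.mem_piFinset.1 (Finset.mem_filter.1 (e i).2.2).1 j
    rw [Finset.mem_range] at h1
    change (e i).2.1 j ≤ _
    omega

end

end GaloisClosure

/-! ### Derivative functionals that vanish on the relations -/

namespace GaloisClosure

noncomputable section

variable {k : Type*} [Field k] {n : ℕ}

/-- The linear form `∑_i v_i x_{i,j}`. -/
def lin (j : Fin n) : (Fin (n - 1) → k) →ₗ[k] MvPolynomial (Fin (n - 1) × Fin n) k :=
  Fintype.linearCombination k fun i => MvPolynomial.X (i, j)

theorem lin_apply (j : Fin n) (v : Fin (n - 1) → k) :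
    lin j v = ∑ i, v i • (MvPolynomial.X (i, j) : MvPolynomial (Fin (n - 1) × Fin n) k) :=
  Fintype.linearCombination_apply ..

@[simp] theorem lin_single (j : Fin n) (i : Fin (n - 1)) :
    lin j (Pi.single i (1 : k)) = MvPolynomial.X (i, j) := by
  simp [lin]

theorem presentation_lin (j : Fin n) (v : Fin (n - 1) → k) :
    G.presentation k n (lin j v) = G.conj j (An.vec k n v) := by
  rw [lin_apply, An.vec_apply, map_sum, map_sum]
  exact Finset.sum_congr rfl fun i _ => by rw [map_smul, map_smul, presentation_X]

theorem sum_lin_mem_relIdeal (v : Fin (n - 1) → k) : ∑ j, lin j v ∈ relIdeal k n := by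
  simp only [lin_apply]
  rw [Finset.sum_comm]
  refine Ideal.sum_mem _ fun a _ => ?_
  rw [← Finset.smul_sum]
  exact Submodule.smul_of_tower_mem _ _ (Ideal.subset_span (Or.inr ⟨a, rfl⟩))

@[simp] theorem constantCoeff_lin (j : Fin n) (v : Fin (n - 1) → k) :
    MvPolynomial.constantCoeff (lin j v) = 0 := by
  simp [lin_apply, MvPolynomial.smul_eq_C_mul]

/-- The derivation `x_{i,j} ↦ ξ_i α_j`. -/
def der (ξ : Fin (n - 1) → k) (α : Fin n → k) :
    Derivation k (MvPolynomial (Fin (n - 1) × Fin n) k) (MvPolynomial (Fin (n - 1) × Fin n) k) :=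
  MvPolynomial.mkDerivation k fun p => MvPolynomial.C (ξ p.1 * α p.2)

theorem der_X (ξ : Fin (n - 1) → k) (α : Fin n → k) (p : Fin (n - 1) × Fin n) :
    der ξ α (MvPolynomial.X p) = MvPolynomial.C (ξ p.1 * α p.2) :=
  MvPolynomial.mkDerivation_X ..

@[simp] theorem der_lin (ξ : Fin (n - 1) → k) (α : Fin n → k) (j : Fin n) (v : Fin (n - 1) → k) :
    der ξ α (lin j v) = MvPolynomial.C ((ξ ⬝ᵥ v) * α j) := by
  rw [lin_apply, map_sum, dotProduct, Finset.sum_mul, map_sum]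
  refine Finset.sum_congr rfl fun i _ => ?_
  rw [Derivation.map_smul, der_X, MvPolynomial.smul_eq_C_mul, ← map_mul]
  ring_nf

/-- The condition ∑ α = 0, which recurs below, says that the direction is tangent to the trace
relations. -/
theorem der_sum_X {ξ : Fin (n - 1) → k} {α : Fin n → k} (hα : ∑ j, α j = 0) (i : Fin (n - 1)) :
    der ξ α (∑ j, MvPolynomial.X (i, j)) = 0 := by
  simp only [map_sum, der_X]
  rw [← map_sum, ← Finset.mul_sum, hα, mul_zero, map_zero]

@[simp] theorem der_C (ξ : Fin (n - 1) → k) (α : Fin n → k) (c : k) :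
    der ξ α (MvPolynomial.C c) = 0 := Derivation.map_algebraMap _ c

theorem der_mul (ξ : Fin (n - 1) → k) (α : Fin n → k)
    (f g : MvPolynomial (Fin (n - 1) × Fin n) k) :
    der ξ α (f * g) = f * der ξ α g + g * der ξ α f := by
  rw [Derivation.leibniz]; rfl

/-- The first order functional of a direction. -/
def T1 (ξ : Fin (n - 1) → k) (α : Fin n → k) : MvPolynomial (Fin (n - 1) × Fin n) k →ₗ[k] k :=
  (MvPolynomial.lcoeff k 0) ∘ₗ (der ξ α).toLinearMap

/-- The second order functional of a pair of directions. -/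
def T2 (ξ : Fin (n - 1) → k) (α : Fin n → k) (ζ : Fin (n - 1) → k) (β : Fin n → k) :
    MvPolynomial (Fin (n - 1) × Fin n) k →ₗ[k] k :=
  T1 ξ α ∘ₗ (der ζ β).toLinearMap

/-- The third order functional of a triple of directions. -/
def T3 (ξ : Fin (n - 1) → k) (α : Fin n → k) (ζ : Fin (n - 1) → k) (β : Fin n → k)
    (η : Fin (n - 1) → k) (γ : Fin n → k) : MvPolynomial (Fin (n - 1) × Fin n) k →ₗ[k] k :=
  T2 ξ α ζ β ∘ₗ (der η γ).toLinearMap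

theorem T1_apply (ξ : Fin (n - 1) → k) (α : Fin n → k) (f) :
    T1 ξ α f = MvPolynomial.constantCoeff (der ξ α f) := rfl

theorem T2_apply (ξ : Fin (n - 1) → k) (α : Fin n → k) (ζ : Fin (n - 1) → k) (β : Fin n → k) (f) :
    T2 ξ α ζ β f = MvPolynomial.constantCoeff (der ξ α (der ζ β f)) := rfl

theorem T3_apply (ξ : Fin (n - 1) → k) (α : Fin n → k) (ζ : Fin (n - 1) → k) (β : Fin n → k)
    (η : Fin (n - 1) → k) (γ : Fin n → k) (f) :
    T3 ξ α ζ β η γ f = MvPolynomial.constantCoeff (der ξ α (der ζ β (der η γ f))) := rfl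

theorem T1_lin (ξ : Fin (n - 1) → k) (α : Fin n → k) (s : Fin n) (a : Fin (n - 1) → k) :
    T1 ξ α (lin s a) = (ξ ⬝ᵥ a) * α s := by
  rw [T1_apply, der_lin, MvPolynomial.constantCoeff_C]

theorem T1_lin_mul (ξ : Fin (n - 1) → k) (α : Fin n → k) (s t : Fin n) (a b : Fin (n - 1) → k) :
    T1 ξ α (lin s a * lin t b) = 0 := by
  simp [T1_apply]

theorem T1_lin_mul_mul (ξ : Fin (n - 1) → k) (α : Fin n → k) (s t u : Fin n)
    (a b c : Fin (n - 1) → k) : T1 ξ α (lin s a * lin t b * lin u c) = 0 := by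
  simp [T1_apply]

theorem T2_lin_mul (ξ : Fin (n - 1) → k) (α : Fin n → k) (ζ : Fin (n - 1) → k) (β : Fin n → k)
    (s t : Fin n) (a b : Fin (n - 1) → k) : T2 ξ α ζ β (lin s a * lin t b) =
      (ξ ⬝ᵥ a) * α s * ((ζ ⬝ᵥ b) * β t) + (ξ ⬝ᵥ b) * α t * ((ζ ⬝ᵥ a) * β s) := by
  simp only [T2_apply, der_mul, der_lin, map_add, der_C, map_mul, MvPolynomial.constantCoeff_C,
    mul_zero, add_zero, zero_add]
  ring

theorem T2_lin_mul_mul (ξ : Fin (n - 1) → k) (α : Fin n → k) (ζ : Fin (n - 1) → k) (β : Fin n → k)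
    (s t u : Fin n) (a b c : Fin (n - 1) → k) :
    T2 ξ α ζ β (lin s a * lin t b * lin u c) = 0 := by
  simp [T2_apply]

theorem T3_lin_mul_mul (ξ : Fin (n - 1) → k) (α : Fin n → k) (ζ : Fin (n - 1) → k) (β : Fin n → k)
    (η : Fin (n - 1) → k) (γ : Fin n → k)
    (s t u : Fin n) (a b c : Fin (n - 1) → k) :
    T3 ξ α ζ β η γ (lin s a * lin t b * lin u c) =
      (ξ ⬝ᵥ a) * α s * ((ζ ⬝ᵥ b) * β t) * ((η ⬝ᵥ c) * γ u) +
      (ξ ⬝ᵥ b) * α t * ((ζ ⬝ᵥ a) * β s) * ((η ⬝ᵥ c) * γ u) +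
      (ξ ⬝ᵥ a) * α s * ((ζ ⬝ᵥ c) * β u) * ((η ⬝ᵥ b) * γ t) +
      (ξ ⬝ᵥ c) * α u * ((ζ ⬝ᵥ a) * β s) * ((η ⬝ᵥ b) * γ t) +
      (ξ ⬝ᵥ b) * α t * ((ζ ⬝ᵥ c) * β u) * ((η ⬝ᵥ a) * γ s) +
      (ξ ⬝ᵥ c) * α u * ((ζ ⬝ᵥ b) * β t) * ((η ⬝ᵥ a) * γ s) := by
  simp only [T3_apply, der_mul, der_lin, map_add, der_C, map_mul, MvPolynomial.constantCoeff_C,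
    mul_zero, add_zero, zero_add]
  ring

/-- A linear functional kills the ideal of relations if it kills multiples of the generators. -/
theorem relIdeal_le_of_forall {Λ : MvPolynomial (Fin (n - 1) × Fin n) k →ₗ[k] k}
    (hq : ∀ f j a b, Λ (f * (lin j a * lin j b)) = 0)
    (hL : ∀ f i, Λ (f * ∑ j, MvPolynomial.X (i, j)) = 0) {f} (hf : f ∈ relIdeal k n) :
    Λ f = 0 := by
  have : relIdeal k n = Submodule.span (MvPolynomial (Fin (n - 1) × Fin n) k)
      (Set.range (Sum.elim (fun p : Fin (n - 1) × Fin (n - 1) × Fin n =>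
        (MvPolynomial.X (p.1, p.2.2) * MvPolynomial.X (p.2.1, p.2.2) :
          MvPolynomial (Fin (n - 1) × Fin n) k))
        fun i => ∑ j, MvPolynomial.X (i, j))) := by
    rw [Set.Sum.elim_range]; rfl
  rw [this, Submodule.mem_span_range_iff_exists_fun] at hf
  obtain ⟨c, rfl⟩ := hf
  rw [map_sum]
  refine Finset.sum_eq_zero fun p _ => ?_
  obtain ⟨a, b, j⟩ | i := p
  · have h := hq (c (Sum.inl (a, b, j))) j (Pi.single a 1) (Pi.single b 1)
    rw [lin_single, lin_single] at h
    exact h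
  · exact hL _ _

variable {ξ ζ η : Fin (n - 1) → k} {α β γ : Fin n → k}

theorem T1_mul_sum_X (hα : ∑ j, α j = 0) (f) (i : Fin (n - 1)) :
    T1 ξ α (f * ∑ j, MvPolynomial.X (i, j)) = 0 := by
  rw [T1_apply, der_mul, der_sum_X hα]; simp

theorem T2_mul_sum_X (hα : ∑ j, α j = 0) (hβ : ∑ j, β j = 0) (f) (i : Fin (n - 1)) :
    T2 ξ α ζ β (f * ∑ j, MvPolynomial.X (i, j)) = 0 := by
  rw [T2, LinearMap.comp_apply]
  change T1 ξ α (der ζ β _) = 0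
  rw [der_mul, der_sum_X hβ, mul_zero, zero_add, mul_comm, T1_mul_sum_X hα]

theorem T3_mul_sum_X (hα : ∑ j, α j = 0) (hβ : ∑ j, β j = 0) (hγ : ∑ j, γ j = 0) (f)
    (i : Fin (n - 1)) : T3 ξ α ζ β η γ (f * ∑ j, MvPolynomial.X (i, j)) = 0 := by
  rw [T3, LinearMap.comp_apply]
  change T2 ξ α ζ β (der η γ _) = 0
  rw [der_mul, der_sum_X hγ, mul_zero, zero_add, mul_comm, T2_mul_sum_X hα hβ]

theorem T1_mul_lin_mul_lin (f) (j : Fin n) (a b : Fin (n - 1) → k) :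
    T1 ξ α (f * (lin j a * lin j b)) = 0 := by
  simp [T1_apply]

/-- Both derivatives must hit the two factors in column j, so only the constant term of f enters.
The factor α_j β_j disappears if the supports are disjoint, and by its symmetry it cancels upon
antisymmetrization in α and β. -/
theorem T2_mul_lin_mul_lin (f) (j : Fin n) (a b : Fin (n - 1) → k) :
    T2 ξ α ζ β (f * (lin j a * lin j b)) = MvPolynomial.constantCoeff f *
      (((ξ ⬝ᵥ a) * (ζ ⬝ᵥ b) + (ξ ⬝ᵥ b) * (ζ ⬝ᵥ a)) * (α j * β j)) := by
  simp only [T2_apply, der_mul, der_lin, map_add, der_C, map_mul, MvPolynomial.constantCoeff_C,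
    constantCoeff_lin, mul_zero, zero_mul, add_zero, zero_add]
  ring

/-- One derivative falls on f and the other two on the product in column j, so each term contains
the product of two of the directions at j. -/
theorem T3_mul_lin_mul_lin (f) (j : Fin n) (a b : Fin (n - 1) → k) :
    T3 ξ α ζ β η γ (f * (lin j a * lin j b)) =
      T1 ξ α f * (((ζ ⬝ᵥ a) * (η ⬝ᵥ b) + (ζ ⬝ᵥ b) * (η ⬝ᵥ a)) * (β j * γ j)) +
      T1 ζ β f * (((ξ ⬝ᵥ a) * (η ⬝ᵥ b) + (ξ ⬝ᵥ b) * (η ⬝ᵥ a)) * (α j * γ j)) +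
      T1 η γ f * (((ξ ⬝ᵥ a) * (ζ ⬝ᵥ b) + (ξ ⬝ᵥ b) * (ζ ⬝ᵥ a)) * (α j * β j)) := by
  simp only [T3_apply, T1_apply, der_mul, der_lin, map_add, der_C, map_mul,
    MvPolynomial.constantCoeff_C, constantCoeff_lin, mul_zero, zero_mul, add_zero,
    zero_add]
  ring

theorem T1_relIdeal (hα : ∑ j, α j = 0) {f} (hf : f ∈ relIdeal k n) : T1 ξ α f = 0 :=
  relIdeal_le_of_forall T1_mul_lin_mul_lin (T1_mul_sum_X hα) hf

theorem T2_relIdeal (hα : ∑ j, α j = 0) (hβ : ∑ j, β j = 0) (h : ∀ j, α j * β j = 0)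
    {f} (hf : f ∈ relIdeal k n) : T2 ξ α ζ β f = 0 :=
  relIdeal_le_of_forall (fun f j a b => by rw [T2_mul_lin_mul_lin, h]; ring)
    (T2_mul_sum_X hα hβ) hf

variable (ξ ζ η α β γ) in
/-- The second order functional which is alternating in the directions. -/
def Alt2 : MvPolynomial (Fin (n - 1) × Fin n) k →ₗ[k] k := T2 ξ α ζ β - T2 ξ β ζ α

theorem Alt2_lin_mul (s t : Fin n) (a b : Fin (n - 1) → k) :
    Alt2 ξ ζ α β (lin s a * lin t b) =
      (α s * β t - α t * β s) * ((ξ ⬝ᵥ a) * (ζ ⬝ᵥ b) - (ξ ⬝ᵥ b) * (ζ ⬝ᵥ a)) := by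
  rw [Alt2, LinearMap.sub_apply, T2_lin_mul, T2_lin_mul]; ring

theorem Alt2_lin_mul_mul (s t u : Fin n) (a b c : Fin (n - 1) → k) :
    Alt2 ξ ζ α β (lin s a * lin t b * lin u c) = 0 := by
  rw [Alt2, LinearMap.sub_apply, T2_lin_mul_mul, T2_lin_mul_mul, sub_zero]

theorem Alt2_relIdeal (hα : ∑ j, α j = 0) (hβ : ∑ j, β j = 0) {f} (hf : f ∈ relIdeal k n) :
    Alt2 ξ ζ α β f = 0 :=
  relIdeal_le_of_forall
    (fun f j a b => by
      rw [Alt2, LinearMap.sub_apply, T2_mul_lin_mul_lin, T2_mul_lin_mul_lin]; ring)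
    (fun f i => by
      rw [Alt2, LinearMap.sub_apply, T2_mul_sum_X hα hβ, T2_mul_sum_X hβ hα, sub_zero]) hf

variable (ξ ζ η α β γ) in
/-- The third order functional which is alternating in the first two directions. -/
def Hook3 : MvPolynomial (Fin (n - 1) × Fin n) k →ₗ[k] k :=
  T3 ξ α ζ β η γ - T3 ξ β ζ α η γ

/-- The terms with α_j γ_j or β_j γ_j vanish by disjointness of supports; the term with α_j β_j is
symmetric and cancels in the antisymmetrization. -/
theorem Hook3_relIdeal (hα : ∑ j, α j = 0) (hβ : ∑ j, β j = 0) (hγ : ∑ j, γ j = 0)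
    (hαγ : ∀ j, α j * γ j = 0) (hβγ : ∀ j, β j * γ j = 0) {f} (hf : f ∈ relIdeal k n) :
    Hook3 ξ ζ η α β γ f = 0 :=
  relIdeal_le_of_forall
    (fun f j a b => by
      rw [Hook3, LinearMap.sub_apply, T3_mul_lin_mul_lin, T3_mul_lin_mul_lin, hαγ, hβγ]; ring)
    (fun f i => by
      rw [Hook3, LinearMap.sub_apply, T3_mul_sum_X hα hβ hγ, T3_mul_sum_X hβ hα hγ, sub_zero]) hf

variable (ξ ζ η α β γ) in
/-- The third order functional which is alternating in all directions. -/
def Alt3 : MvPolynomial (Fin (n - 1) × Fin n) k →ₗ[k] k :=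
  T3 ξ α ζ β η γ - T3 ξ β ζ α η γ + T3 ξ β ζ γ η α - T3 ξ γ ζ β η α + T3 ξ γ ζ α η β -
    T3 ξ α ζ γ η β

theorem Alt3_relIdeal (hα : ∑ j, α j = 0) (hβ : ∑ j, β j = 0) (hγ : ∑ j, γ j = 0)
    {f} (hf : f ∈ relIdeal k n) : Alt3 ξ ζ η α β γ f = 0 :=
  relIdeal_le_of_forall
    (fun f j a b => by
      simp only [Alt3, LinearMap.sub_apply, LinearMap.add_apply, T3_mul_lin_mul_lin]
      ring)
    (fun f i => by
      simp only [Alt3, LinearMap.sub_apply, LinearMap.add_apply, T3_mul_sum_X, hα, hβ, hγ]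
      simp) hf

end

end GaloisClosure

namespace GaloisClosure

noncomputable section

/-! ### Forms -/

section Forms

variable {k : Type*} [Field k] {σ : Type*}

theorem weight_one_int (d : σ →₀ ℕ) : Finsupp.weight (fun _ => (1 : ℤ)) d = (d.degree : ℤ) := by
  rw [Finsupp.weight_apply, Finsupp.sum, Finsupp.degree_apply]
  simp

theorem isWeightedHomogeneous_int_iff {f : MvPolynomial σ k} {d : ℕ} :
    f.IsWeightedHomogeneous (fun _ => (1 : ℤ)) (d : ℤ) ↔ f.IsHomogeneous d := by
  refine forall_congr' fun e => imp_congr_right fun _ => ?_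
  rw [weight_one_int, Finsupp.degree_eq_weight_one, Nat.cast_inj]
  rfl

theorem eq_zero_of_isWeightedHomogeneous_int {f : MvPolynomial σ k} {e : ℤ} (he : e < 0)
    (hf : f.IsWeightedHomogeneous (fun _ => (1 : ℤ)) e) : f = 0 := by
  ext d
  by_contra h
  have := hf h
  rw [weight_one_int] at this
  omega

theorem eq_C_of_isHomogeneous_zero {f : MvPolynomial σ k} (hf : f.IsHomogeneous 0) :
    f = MvPolynomial.C (f.coeff 0) := by
  rwa [← MvPolynomial.totalDegree_zero_iff_isHomogeneous,
    MvPolynomial.totalDegree_eq_zero_iff_eq_C] at hf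

theorem eq_sum_X_of_isHomogeneous_one [Fintype σ] {f : MvPolynomial σ k} (hf : f.IsHomogeneous 1) :
    ∃ c : σ → k, f = ∑ p, c p • MvPolynomial.X p := by
  refine ⟨fun p => (MvPolynomial.pderiv p f).coeff 0, ?_⟩
  have h := hf.sum_X_mul_pderiv
  rw [one_smul] at h
  conv_lhs => rw [← h]
  refine Finset.sum_congr rfl fun p _ => ?_
  conv_lhs => rw [eq_C_of_isHomogeneous_zero (hf.pderiv (i := p))]
  rw [MvPolynomial.smul_eq_C_mul, mul_comm]

end Forms

variable {k : Type*} [Field k] {n : ℕ}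

local notation "Poly" => MvPolynomial (Fin (n - 1) × Fin n) k

theorem eq_sum_lin_of_isHomogeneous_one {f : MvPolynomial (Fin (n - 1) × Fin n) k}
    (hf : f.IsHomogeneous 1) : ∃ F : Fin n → Fin (n - 1) → k, f = ∑ j, lin j (F j) := by
  obtain ⟨c, rfl⟩ := eq_sum_X_of_isHomogeneous_one hf
  refine ⟨fun j i => c (i, j), ?_⟩
  simp only [lin_apply]
  rw [Fintype.sum_prod_type, Finset.sum_comm]

/-! ### Admissible ideals -/

/-- Ideals which contain the relations of `G(A_n)`, and on which the first order functionals and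
the alternating second order functionals vanish. -/
structure IsAdmissible (I : Ideal (MvPolynomial (Fin (n - 1) × Fin n) k)) : Prop where
  relIdeal_le : relIdeal k n ≤ I
  T1_eq_zero {ξ : Fin (n - 1) → k} {α : Fin n → k} (hα : ∑ j, α j = 0) {f} (hf : f ∈ I) :
    T1 ξ α f = 0
  Alt2_eq_zero {ξ ζ : Fin (n - 1) → k} {α β : Fin n → k} (hα : ∑ j, α j = 0)
    (hβ : ∑ j, β j = 0) {f} (hf : f ∈ I) : Alt2 ξ ζ α β f = 0

theorem T1_sum_lin (ξ : Fin (n - 1) → k) (α : Fin n → k) (F : Fin n → Fin (n - 1) → k) :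
    T1 ξ α (∑ j, lin j (F j)) = ∑ j, (ξ ⬝ᵥ F j) * α j := by
  rw [map_sum]
  exact Finset.sum_congr rfl fun j _ => T1_lin ..

/-- These directions make the functional read off a coordinate of c ∧ w, where w = ∑_t β_t F_t. -/
theorem Alt2_lin_mul_sum_lin (ξ ζ : Fin (n - 1) → k) {α β : Fin n → k} {j : Fin n} (hα : α j = 1)
    (hβ : β j = 0) (c : Fin (n - 1) → k) (F : Fin n → Fin (n - 1) → k) :
    Alt2 ξ ζ α β (lin j c * ∑ t, lin t (F t)) =
      (ξ ⬝ᵥ c) * T1 ζ β (∑ t, lin t (F t)) - (ζ ⬝ᵥ c) * T1 ξ β (∑ t, lin t (F t)) := by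
  rw [Finset.mul_sum, map_sum, T1_sum_lin, T1_sum_lin, Finset.mul_sum, Finset.mul_sum,
    ← Finset.sum_sub_distrib]
  refine Finset.sum_congr rfl fun t _ => ?_
  rw [Alt2_lin_mul, hα, hβ]
  ring

theorem sum_single_sub_single (i j : Fin n) :
    ∑ t, (Pi.single i 1 - Pi.single j 1 : Fin n → k) t = 0 := by
  simp

theorem T1_single_sub_single (i : Fin (n - 1)) (s t : Fin n) (F : Fin n → Fin (n - 1) → k) :
    T1 (Pi.single i 1) (Pi.single s 1 - Pi.single t 1) (∑ j, lin j (F j)) = F s i - F t i := by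
  rw [T1_sum_lin]
  simp [mul_sub, Finset.sum_sub_distrib, Pi.single_apply]

/-- Subtracting the trace relation of u clears all columns except j. -/
theorem sum_lin_congr_const {F : Fin n → Fin (n - 1) → k} {j : Fin n} {u : Fin (n - 1) → k}
    (h : ∀ t, t ≠ j → F t = u) :
    ∑ t, lin t (F t) - lin j (F j - u) ∈ relIdeal k n := by
  have : ∑ t, lin t (F t) - lin j (F j - u) = ∑ t, lin t u := by
    rw [sub_eq_iff_eq_add, ← Finset.sum_erase_add _ _ (Finset.mem_univ j),
      ← Finset.sum_erase_add (a := j) (f := fun t => lin t u) _ (Finset.mem_univ j), map_sub]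
    rw [Finset.sum_congr rfl fun t ht => by rw [h t (Finset.ne_of_mem_erase ht)]]
    ring
  rw [this]
  exact sum_lin_mem_relIdeal u

theorem exists_ne_ne (hn : 3 ≤ n) (s t : Fin n) : ∃ j, j ≠ s ∧ j ≠ t := by
  have : ({s, t} : Finset (Fin n)).card < Fintype.card (Fin n) := by
    rw [Fintype.card_fin]
    exact lt_of_le_of_lt Finset.card_le_two (by omega)
  obtain ⟨j, hj⟩ := Finset.exists_mem_notMem_of_card_lt_card (s := {s, t}) (t := Finset.univ) this
  exact ⟨j, by simpa [not_or] using hj⟩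

theorem IsAdmissible.lin_mem {I : Ideal Poly} (hI : IsAdmissible I) (hn : 2 ≤ n) {j : Fin n}
    {v : Fin (n - 1) → k} (h : lin j v ∈ I) : v = 0 := by
  have : Nontrivial (Fin n) := Fin.nontrivial_iff_two_le.2 hn
  obtain ⟨t, ht⟩ := exists_ne j
  ext i
  have := hI.T1_eq_zero (ξ := Pi.single i 1) (sum_single_sub_single j t) h
  rw [T1_lin] at this
  simpa [ht.symm] using this

theorem IsAdmissible.mem_of_forall_X_mul_mem_zero {I : Ideal Poly} (hI : IsAdmissible I)
    (hn : 2 ≤ n) {g : Poly} (hg : g.IsHomogeneous 0) (h : ∀ p, MvPolynomial.X p * g ∈ I) :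
    g ∈ I := by
  rw [eq_C_of_isHomogeneous_zero hg] at h ⊢
  set c := g.coeff 0
  have h1 := h (⟨0, by omega⟩, ⟨0, by omega⟩)
  rw [mul_comm, ← MvPolynomial.smul_eq_C_mul, ← lin_single, ← map_smul] at h1
  have := congrFun (hI.lin_mem hn h1) ⟨0, by omega⟩
  simp only [Pi.smul_apply, Pi.single_eq_same, smul_eq_mul, mul_one, Pi.zero_apply] at this
  rw [this, map_zero]
  exact I.zero_mem

/-- Multiplying g by a variable in a column other than s and t, and testing with `Alt2`, shows that
columns s and t of g agree. A linear form with equal columns is a combination of traces. -/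
theorem IsAdmissible.mem_of_forall_X_mul_mem_one {I : Ideal Poly} (hI : IsAdmissible I)
    (hn : 3 ≤ n) {g : Poly} (hg : g.IsHomogeneous 1) (h : ∀ p, MvPolynomial.X p * g ∈ I) :
    g ∈ I := by
  obtain ⟨F, rfl⟩ := eq_sum_lin_of_isHomogeneous_one hg
  have key : ∀ s t, F s = F t := by
    intro s t
    obtain ⟨j, hjs, hjt⟩ := exists_ne_ne hn s t
    ext i
    have : Nontrivial (Fin (n - 1)) := Fin.nontrivial_iff_two_le.2 (by omega)
    obtain ⟨p, hp⟩ := exists_ne i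
    have h1 := h (p, j)
    rw [← lin_single] at h1
    have := hI.Alt2_eq_zero (ξ := Pi.single p 1) (ζ := Pi.single i 1)
      (sum_single_sub_single j s) (sum_single_sub_single s t) h1
    rw [Alt2_lin_mul_sum_lin _ _ (by simp [hjs]) (by simp [hjs, hjt]),
      T1_single_sub_single, T1_single_sub_single] at this
    simpa [hp, hp.symm, sub_eq_zero] using this
  have := sum_lin_congr_const (F := F) (j := ⟨0, by omega⟩) (u := F ⟨0, by omega⟩)
    fun t _ => key _ _
  rw [sub_self, map_zero, sub_zero] at this
  exact hI.relIdeal_le this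

/-- The hypothesis is e_c ∧ l(a, b) = e_a ∧ l(b, c) in coordinates. Taking c = p distinct from a and
q kills l(a, b)_q for a ≠ q; by symmetry only l(b, b)_b is left, which the hypothesis reduces to a
coordinate already known to vanish. -/
theorem eq_zero_of_symmetric_of_alternating {ι : Type*} [Fintype ι] [DecidableEq ι]
    (hι : 3 ≤ Fintype.card ι) {l : ι → ι → ι → k} (hs : ∀ a b, l a b = l b a)
    (h : ∀ a b c p q, (Pi.single p 1 : ι → k) c * l a b q - (Pi.single q 1 : ι → k) c * l a b p =
      (Pi.single p 1 : ι → k) a * l b c q - (Pi.single q 1 : ι → k) a * l b c p) (a b : ι) :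
    l a b = 0 := by
  have h1 : ∀ a b q, a ≠ q → l a b q = 0 := by
    intro a b q haq
    have : ({a, q} : Finset ι).card < Fintype.card ι :=
      lt_of_le_of_lt Finset.card_le_two (by omega)
    obtain ⟨p, -, hp⟩ := Finset.exists_mem_notMem_of_card_lt_card (t := Finset.univ) this
    simp only [Finset.mem_insert, Finset.mem_singleton, not_or] at hp
    have := h a b p p q
    simpa [hp.2, haq, Ne.symm hp.1] using this
  ext q
  by_cases ha : a = q
  · by_cases hb : b = q
    · subst ha
      subst hb
      have : Nontrivial ι := Fintype.one_lt_card_iff_nontrivial.1 (by omega)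
      obtain ⟨p, hp⟩ := exists_ne b
      have := h b b p p b
      simpa [hp, hp.symm, h1 b p p hp.symm] using this
    · rw [hs]; exact h1 _ _ _ hb
  · exact h1 _ _ _ ha

/-- The correspondence `f ↦ g` with `φ f = [g]`, for a linear map `φ : I → S/I`, is a module
`Γ` such that `(0, g) ∈ Γ` exactly for `g ∈ I`. If the products `x_{a,j} x_{b,j}` correspond to
linear forms, then to linear forms in the `j`-th column. -/
theorem IsAdmissible.exists_bilinear {I : Ideal Poly} (hI : IsAdmissible I) (hn : 4 ≤ n)
    {Γ : Submodule Poly (Poly × Poly)} (h0 : ∀ g, ((0, g) : Poly × Poly) ∈ Γ ↔ g ∈ I)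
    (hq : ∀ a b j, ∃ g : Poly, g.IsHomogeneous 1 ∧
      ((MvPolynomial.X (a, j) * MvPolynomial.X (b, j), g) : Poly × Poly) ∈ Γ) :
    ∃ M : Fin n → (Fin (n - 1) → k) →ₗ[k] (Fin (n - 1) → k) →ₗ[k] (Fin (n - 1) → k),
      (∀ j a b, M j a b = M j b a) ∧
      ∀ j a b, ((lin j a * lin j b, lin j (M j a b)) : Poly × Poly) ∈ Γ := by
  have hsub : ∀ {f g g' : Poly}, (f, g) ∈ Γ → (f, g') ∈ Γ → g - g' ∈ I := by
    intro f g g' h h'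
    have := Γ.sub_mem h h'
    rwa [Prod.mk_sub_mk, sub_self, h0] at this
  have hq' : ∀ a b j, ∃ F : Fin n → Fin (n - 1) → k,
      ((MvPolynomial.X (a, j) * MvPolynomial.X (b, j), ∑ t, lin t (F t)) : Poly × Poly) ∈ Γ := by
    intro a b j
    obtain ⟨g, hg, hg'⟩ := hq a b j
    obtain ⟨F, rfl⟩ := eq_sum_lin_of_isHomogeneous_one hg
    exact ⟨F, hg'⟩
  choose F hF using hq'
  -- Off column j the columns of the image are equal: the two evaluations of x_{a,j} x_{b,j} x_{c,j}
  -- agree modulo I, and `Alt2` turns this into the wedge identity for differences of columns.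
  have hconst : ∀ j s t, s ≠ j → t ≠ j → ∀ a b, F a b j s = F a b j t := by
    intro j s t hs ht a b
    rw [← sub_eq_zero]
    refine eq_zero_of_symmetric_of_alternating (l := fun a b => F a b j s - F a b j t) ?_ ?_ ?_ a b
    · rw [Fintype.card_fin]; omega
    · intro a b
      ext i
      have := hI.T1_eq_zero (ξ := Pi.single i 1) (sum_single_sub_single s t)
        (hsub (hF a b j) (mul_comm (MvPolynomial.X (b, j) : Poly) _ ▸ hF b a j))
      rw [map_sub, T1_single_sub_single, T1_single_sub_single, sub_eq_zero] at this
      exact this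
    · intro a b c p q
      have h1 := Γ.sub_mem (Γ.smul_mem (MvPolynomial.X (c, j)) (hF a b j))
        (Γ.smul_mem (MvPolynomial.X (a, j)) (hF b c j))
      have h2 : MvPolynomial.X (c, j) * (MvPolynomial.X (a, j) * MvPolynomial.X (b, j)) -
        MvPolynomial.X (a, j) * (MvPolynomial.X (b, j) * MvPolynomial.X (c, j)) = (0 : Poly) := by
        ring
      rw [Prod.smul_mk, Prod.smul_mk, Prod.mk_sub_mk, smul_eq_mul, smul_eq_mul, h2, h0,
        smul_eq_mul, smul_eq_mul, ← lin_single, ← lin_single] at h1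
      have := hI.Alt2_eq_zero (ξ := Pi.single p 1) (ζ := Pi.single q 1)
        (sum_single_sub_single j s) (sum_single_sub_single s t) h1
      rw [map_sub, Alt2_lin_mul_sum_lin _ _ (by simp [hs.symm]) (by simp [hs.symm, ht.symm]),
        Alt2_lin_mul_sum_lin _ _ (by simp [hs.symm]) (by simp [hs.symm, ht.symm])] at this
      simp only [T1_single_sub_single] at this
      simp only [Pi.sub_apply]
      rw [sub_eq_zero] at this
      simpa [Pi.single_apply, eq_comm] using this
  -- The common value of the columns other than j is removed by a trace relation.
  have hM : ∀ j a b, ∃ m : Fin (n - 1) → k,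
      ((MvPolynomial.X (a, j) * MvPolynomial.X (b, j), lin j m) : Poly × Poly) ∈ Γ := by
    intro j a b
    obtain ⟨t, ht, -⟩ := exists_ne_ne (by omega) j j
    refine ⟨F a b j j - F a b j t, ?_⟩
    have h1 := (h0 _).2 (hI.relIdeal_le (sum_lin_congr_const (F := F a b j) (j := j)
      fun s hs => hconst j s t hs ht a b))
    have := Γ.sub_mem (hF a b j) h1
    rwa [Prod.mk_sub_mk, sub_zero, sub_sub_cancel] at this
  choose m hm using hM
  have key : ∀ j a b, ((lin j a * lin j b, lin j (∑ i, ∑ l, (a i * b l) • m j i l)) :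
      Poly × Poly) ∈ Γ := by
    intro j a b
    have : ((lin j a * lin j b, lin j (∑ i, ∑ l, (a i * b l) • m j i l)) : Poly × Poly) =
        ∑ i, ∑ l, (MvPolynomial.C (a i * b l) : Poly) •
          ((MvPolynomial.X (i, j) * MvPolynomial.X (l, j), lin j (m j i l)) : Poly × Poly) := by
      refine Prod.ext ?_ ?_
      · simp only [Prod.fst_sum, Prod.smul_fst, lin_apply, Finset.sum_mul_sum]
        refine Finset.sum_congr rfl fun i _ => Finset.sum_congr rfl fun l _ => ?_
        rw [smul_mul_smul_comm, MvPolynomial.smul_eq_C_mul, smul_eq_mul]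
      · simp only [Prod.snd_sum, Prod.smul_snd, map_sum]
        refine Finset.sum_congr rfl fun i _ => Finset.sum_congr rfl fun l _ => ?_
        rw [map_smul, MvPolynomial.smul_eq_C_mul, smul_eq_mul]
    rw [this]
    exact Γ.sum_mem fun i _ => Γ.sum_mem fun l _ => Γ.smul_mem _ (hm j i l)
  refine ⟨fun j => LinearMap.mk₂ k (fun a b => ∑ i, ∑ l, (a i * b l) • m j i l) ?_ ?_ ?_ ?_, ?_, ?_⟩
  · intro a a' b; simp [add_mul, add_smul, Finset.sum_add_distrib]
  · intro c a b; simp [Finset.smul_sum, smul_smul, mul_assoc]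
  · intro a b b'; simp [mul_add, add_smul, Finset.sum_add_distrib]
  · intro c a b; simp [Finset.smul_sum, smul_smul, mul_left_comm]
  · intro j a b
    rw [LinearMap.mk₂_apply, LinearMap.mk₂_apply, ← sub_eq_zero]
    refine hI.lin_mem (by omega) (j := j) ?_
    rw [map_sub]
    exact hsub (key j a b) (mul_comm (lin j b) (lin j a) ▸ key j b a)
  · intro j a b
    exact key j a b

end

end GaloisClosure

namespace GaloisClosure

noncomputable section

/-! ### The correspondence given by a homomorphism -/

section Graph

variable {k : Type*} [Field k] {σ : Type*} {I : Ideal (MvPolynomial σ k)}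

/-- The correspondence `f ↦ g` with `φ f = [g]`, for a linear map `φ : I → S/I`. -/
def liftGraph (φ : I →ₗ[MvPolynomial σ k] (MvPolynomial σ k ⧸ I)) :
    Submodule (MvPolynomial σ k) (MvPolynomial σ k × MvPolynomial σ k) where
  carrier := {x | ∃ h : x.1 ∈ I, φ ⟨x.1, h⟩ = Ideal.Quotient.mk I x.2}
  zero_mem' := ⟨I.zero_mem, by
    rw [Prod.snd_zero, map_zero]; exact φ.map_zero⟩
  add_mem' := by
    rintro x y ⟨hx, hx'⟩ ⟨hy, hy'⟩
    refine ⟨I.add_mem hx hy, ?_⟩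
    rw [Prod.snd_add, map_add, ← hx', ← hy', ← map_add]; rfl
  smul_mem' := by
    rintro c x ⟨hx, hx'⟩
    refine ⟨I.mul_mem_left c hx, ?_⟩
    rw [Prod.smul_snd, smul_eq_mul, map_mul, ← hx']
    exact φ.map_smul c ⟨x.1, hx⟩

theorem zero_mem_liftGraph {φ : I →ₗ[MvPolynomial σ k] (MvPolynomial σ k ⧸ I)}
    {g : MvPolynomial σ k} : ((0, g) : MvPolynomial σ k × _) ∈ liftGraph φ ↔ g ∈ I := by
  constructor
  · rintro ⟨h, h'⟩
    rw [← Ideal.Quotient.eq_zero_iff_mem, ← h']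
    exact φ.map_zero
  · intro h
    exact ⟨I.zero_mem, by rw [Ideal.Quotient.eq_zero_iff_mem.2 h]; exact φ.map_zero⟩

theorem IsGradedOfDegree.exists_mem_liftGraph
    {φ : I →ₗ[MvPolynomial σ k] (MvPolynomial σ k ⧸ I)} {e : ℤ} (hφ : IsGradedOfDegree φ e)
    {f : MvPolynomial σ k} (hf : f ∈ I) {m d : ℕ} (hm : f.IsHomogeneous m)
    (hd : (m : ℤ) + e = d) : ∃ g, g.IsHomogeneous d ∧ (f, g) ∈ liftGraph φ := by
  obtain ⟨g, hg, h⟩ := hφ m ⟨f, hf⟩ (isWeightedHomogeneous_int_iff.2 hm)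
  rw [hd] at hg
  exact ⟨g, isWeightedHomogeneous_int_iff.1 hg, hf, h⟩

theorem IsGradedOfDegree.mem_liftGraph_zero
    {φ : I →ₗ[MvPolynomial σ k] (MvPolynomial σ k ⧸ I)} {e : ℤ} (hφ : IsGradedOfDegree φ e)
    {f : MvPolynomial σ k} (hf : f ∈ I) {m : ℕ} (hm : f.IsHomogeneous m)
    (hd : (m : ℤ) + e < 0) : (f, 0) ∈ liftGraph φ := by
  obtain ⟨g, hg, h⟩ := hφ m ⟨f, hf⟩ (isWeightedHomogeneous_int_iff.2 hm)
  rw [eq_zero_of_isWeightedHomogeneous_int hd hg] at h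
  exact ⟨hf, h⟩

/-- The restriction to `I` of a derivation modulo `I`. -/
def derivationMap (I : Ideal (MvPolynomial σ k))
    (D : Derivation k (MvPolynomial σ k) (MvPolynomial σ k)) :
    I →ₗ[MvPolynomial σ k] (MvPolynomial σ k ⧸ I) where
  toFun f := Ideal.Quotient.mk I (D f.1)
  map_add' f g := by rw [← map_add, ← map_add]; rfl
  map_smul' c f := by
    have : D (c • f).1 = c * D f.1 + f.1 * D c := by
      rw [← smul_eq_mul, ← smul_eq_mul, ← D.leibniz]; rfl
    rw [this, map_add, map_mul, map_mul, Ideal.Quotient.eq_zero_iff_mem.2 f.2, zero_mul, add_zero]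
    rfl

theorem mem_liftGraph_sub {φ : I →ₗ[MvPolynomial σ k] (MvPolynomial σ k ⧸ I)}
    (D : Derivation k (MvPolynomial σ k) (MvPolynomial σ k)) {f g : MvPolynomial σ k}
    (h : (f, g) ∈ liftGraph φ) : (f, g - D f) ∈ liftGraph (φ - derivationMap I D) := by
  obtain ⟨hf, h⟩ := h
  refine ⟨hf, ?_⟩
  rw [LinearMap.sub_apply, map_sub, h]
  rfl

variable [Fintype σ]

/-- The derivation with constant coefficients `x_p ↦ c_p`. -/
def constDer (c : σ → k) : Derivation k (MvPolynomial σ k) (MvPolynomial σ k) :=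
  ∑ p, (MvPolynomial.C (c p) : MvPolynomial σ k) • MvPolynomial.pderiv p

theorem constDer_apply (c : σ → k) (f : MvPolynomial σ k) :
    constDer c f = ∑ p, MvPolynomial.C (c p) * MvPolynomial.pderiv p f := by
  classical
  have : ∀ s : Finset σ, (∑ p ∈ s, (MvPolynomial.C (c p) : MvPolynomial σ k) • MvPolynomial.pderiv p :
      Derivation k (MvPolynomial σ k) (MvPolynomial σ k)) f =
      ∑ p ∈ s, MvPolynomial.C (c p) * MvPolynomial.pderiv p f := by
    intro s
    induction s using Finset.induction_on with
    | empty => simp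
    | insert a s ha ih =>
      rw [Finset.sum_insert ha, Finset.sum_insert ha, Derivation.add_apply, ih]
      rfl
  exact this _

theorem constDer_X (c : σ → k) (q : σ) : constDer c (MvPolynomial.X q) = MvPolynomial.C (c q) := by
  classical
  rw [constDer_apply]
  simp [MvPolynomial.pderiv_X, Pi.single_apply]

theorem IsGradedOfDegree.sub_constDer {φ : I →ₗ[MvPolynomial σ k] (MvPolynomial σ k ⧸ I)}
    (hφ : IsGradedOfDegree φ (-1)) (c : σ → k) :
    IsGradedOfDegree (φ - derivationMap I (constDer c)) (-1) := by
  intro m f hf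
  obtain ⟨g, hg, h⟩ := hφ m f hf
  refine ⟨g - constDer c f.1, ?_, ?_⟩
  · refine (MvPolynomial.weightedHomogeneousSubmodule k _ _).sub_mem hg ?_
    rw [constDer_apply]
    refine Submodule.sum_mem _ fun p _ => ?_
    rw [← MvPolynomial.smul_eq_C_mul]
    exact Submodule.smul_mem _ _ (MvPolynomial.IsWeightedHomogeneous.pderiv hf (by ring))
  · rw [LinearMap.sub_apply, map_sub, h]
    rfl

end Graph

/-! ### Reduction of homomorphisms of negative degree by derivations -/

variable {k : Type*} [Field k] {n : ℕ}

local notation "Poly" => MvPolynomial (Fin (n - 1) × Fin n) k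

/-- Two bilinear maps which differ by a map `Δ` with `Δ(v, v) ∧ v = 0`. -/
theorem exists_eq_smul_add_smul [CharZero k] {ι : Type*} [Fintype ι] [DecidableEq ι]
    {Δ : (ι → k) →ₗ[k] (ι → k) →ₗ[k] (ι → k)} (hs : ∀ a b, Δ a b = Δ b a)
    (h : ∀ v p q, Δ v v p * v q = Δ v v q * v p) :
    ∃ c : ι → k, ∀ a b, Δ a b = (c ⬝ᵥ a) • b + (c ⬝ᵥ b) • a := by
  set e : ι → ι → k := fun i => Pi.single i 1 with he
  -- The value is forced by the case a = b = e_i of the conclusion.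
  refine ⟨fun i => Δ (e i) (e i) i / 2, ?_⟩
  set c : ι → k := fun i => Δ (e i) (e i) i / 2 with hc
  have hd : ∀ i p, p ≠ i → Δ (e i) (e i) p = 0 := by
    intro i p hp
    have := h (e i) p i
    simpa [he, hp] using this
  -- The hypothesis at e_i + e_l and, below, at e_i - e_l isolates the mixed values Δ(e_i, e_l).
  have hplus : ∀ i l p q, (Δ (e i) (e i) p + 2 * Δ (e i) (e l) p + Δ (e l) (e l) p) *
      (e i q + e l q) =
      (Δ (e i) (e i) q + 2 * Δ (e i) (e l) q + Δ (e l) (e l) q) * (e i p + e l p) := by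
    intro i l p q
    have := h (e i + e l) p q
    simp only [map_add, LinearMap.add_apply, Pi.add_apply, hs (e l) (e i)] at this
    linear_combination this
  have hminus : ∀ i l p q, (Δ (e i) (e i) p - 2 * Δ (e i) (e l) p + Δ (e l) (e l) p) *
      (e i q - e l q) =
      (Δ (e i) (e i) q - 2 * Δ (e i) (e l) q + Δ (e l) (e l) q) * (e i p - e l p) := by
    intro i l p q
    have := h (e i - e l) p q
    simp only [map_sub, LinearMap.sub_apply, Pi.sub_apply, hs (e l) (e i)] at this
    linear_combination this
  have h2 : (2 : k) ≠ 0 := two_ne_zero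
  have hil : ∀ i l, i ≠ l → Δ (e i) (e l) i = c l := by
    intro i l hne
    have h1 := hplus i l i l
    have h3 := hminus i l i l
    simp only [hd _ _ hne, hd _ _ hne.symm] at h1 h3
    simp only [he, Pi.single_eq_same, Pi.single_eq_of_ne hne, Pi.single_eq_of_ne hne.symm] at h1 h3
    simp only [hc, he]
    field_simp
    apply mul_left_cancel₀ h2
    linear_combination h1 + h3
  have hb : ∀ i l, Δ (e i) (e l) = c i • e l + c l • e i := by
    intro i l
    ext p
    by_cases hne : i = l
    · subst hne
      by_cases hp : p = i
      · subst hp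
        simp only [hc, he, Pi.add_apply, Pi.smul_apply, Pi.single_eq_same, smul_eq_mul]
        field_simp
        norm_num
      · rw [hd _ _ hp]
        simp [he, hp]
    · by_cases hpi : p = i
      · subst hpi
        rw [hil _ _ hne]
        simp [he, hne]
      · by_cases hpl : p = l
        · subst hpl
          rw [hs, hil _ _ (Ne.symm hne)]
          simp [he, hpi]
        · have := hplus i l p i
          simp only [hd _ _ hpi, hd _ _ hpl] at this
          simp only [he, Pi.single_eq_same, Pi.single_eq_of_ne hne, Pi.single_eq_of_ne hpi,
            Pi.single_eq_of_ne hpl] at this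
          simp [he, hpi, hpl]
          simpa using this
  intro a b
  have key : Δ = LinearMap.mk₂ k (fun a b => (c ⬝ᵥ a) • b + (c ⬝ᵥ b) • a)
      (fun a a' b => by simp only [dotProduct_add, add_smul, smul_add]; abel)
      (fun r a b => by simp only [dotProduct_smul, smul_add, smul_smul, smul_eq_mul, mul_comm r])
      (fun a b b' => by simp only [dotProduct_add, add_smul, smul_add]; abel)
      (fun r a b => by
        simp only [dotProduct_smul, smul_add, smul_smul, smul_eq_mul, mul_comm r]) := by
    refine LinearMap.ext_basis (Pi.basisFun k ι) (Pi.basisFun k ι) fun i l => ?_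
    have := hb i l
    simp only [he] at this
    rw [Pi.basisFun_apply, Pi.basisFun_apply, this, LinearMap.mk₂_apply]
    simp [hc, he]
  conv_lhs => rw [key]
  rw [LinearMap.mk₂_apply]

/-- The normal form of the correspondence of a homomorphism of degree `-1` on the relations. -/
structure IsTangent (I : Ideal (MvPolynomial (Fin (n - 1) × Fin n) k))
    (Γ : Submodule (MvPolynomial (Fin (n - 1) × Fin n) k)
      (MvPolynomial (Fin (n - 1) × Fin n) k × MvPolynomial (Fin (n - 1) × Fin n) k))
    (M : Fin n → (Fin (n - 1) → k) →ₗ[k] (Fin (n - 1) → k) →ₗ[k] (Fin (n - 1) → k)) : Prop where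
  zero_mem_iff (g) : (0, g) ∈ Γ ↔ g ∈ I
  sum_lin_mem (v) : (∑ j, lin j v, 0) ∈ Γ
  lin_mul_lin_mem (j a b) : (lin j a * lin j b, lin j (M j a b)) ∈ Γ
  symm (j a b) : M j a b = M j b a
  exists_lift {f} (hf : f ∈ I) {m : ℕ} (hm : f.IsHomogeneous (m + 1)) :
    ∃ g, g.IsHomogeneous m ∧ (f, g) ∈ Γ

theorem constDer_lin (c : Fin n → Fin (n - 1) → k) (j : Fin n) (v : Fin (n - 1) → k) :
    constDer (fun p : Fin (n - 1) × Fin n => c p.2 p.1) (lin j v) = MvPolynomial.C (c j ⬝ᵥ v) := by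
  rw [lin_apply, map_sum, dotProduct, map_sum]
  refine Finset.sum_congr rfl fun i _ => ?_
  rw [Derivation.map_smul, constDer_X, MvPolynomial.smul_eq_C_mul, ← map_mul, mul_comm]

theorem X_mul_X_mem_relIdeal (a b : Fin (n - 1)) (j : Fin n) :
    (MvPolynomial.X (a, j) * MvPolynomial.X (b, j) : Poly) ∈ relIdeal k n :=
  Ideal.subset_span (Or.inl ⟨(a, b, j), rfl⟩)

theorem sum_X_mem_relIdeal (a : Fin (n - 1)) :
    (∑ j, MvPolynomial.X (a, j) : Poly) ∈ relIdeal k n :=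
  Ideal.subset_span (Or.inr ⟨a, rfl⟩)

theorem sum_X_isHomogeneous (a : Fin (n - 1)) :
    (∑ j, MvPolynomial.X (a, j) : Poly).IsHomogeneous 1 :=
  MvPolynomial.IsHomogeneous.sum _ _ _ fun _ _ => MvPolynomial.isHomogeneous_X _ _

theorem X_mul_X_isHomogeneous (a b : Fin (n - 1)) (j : Fin n) :
    (MvPolynomial.X (a, j) * MvPolynomial.X (b, j) : Poly).IsHomogeneous 2 :=
  (MvPolynomial.isHomogeneous_X _ _).mul (MvPolynomial.isHomogeneous_X _ _)

theorem relIdeal_le_of {J : Ideal Poly} (hq : ∀ a b j, MvPolynomial.X (a, j) *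
    MvPolynomial.X (b, j) ∈ J) (hL : ∀ a, ∑ j, MvPolynomial.X (a, j) ∈ J) : relIdeal k n ≤ J := by
  refine Ideal.span_le.2 ?_
  rintro _ (⟨⟨a, b, j⟩, rfl⟩ | ⟨a, rfl⟩)
  · exact hq a b j
  · exact hL a

/-- A homomorphism of degree `-1` is tangent, up to the restriction of a derivation. -/
theorem IsAdmissible.exists_isTangent {I : Ideal Poly} (hI : IsAdmissible I) (hn : 4 ≤ n)
    {φ : I →ₗ[Poly] (Poly ⧸ I)} (hφ : IsGradedOfDegree φ (-1)) :
    ∃ (c : Fin (n - 1) × Fin n → k) (M : _),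
      IsTangent I (liftGraph (φ - derivationMap I (constDer c))) M := by
  have h1 : ∀ a, ∃ t : k, ((∑ j, MvPolynomial.X (a, j), MvPolynomial.C t) : Poly × Poly) ∈
      liftGraph φ := by
    intro a
    obtain ⟨g, hg, h⟩ := hφ.exists_mem_liftGraph (d := 0) (hI.relIdeal_le (sum_X_mem_relIdeal a))
      (sum_X_isHomogeneous a) (by norm_num)
    rw [eq_C_of_isHomogeneous_zero hg] at h
    exact ⟨_, h⟩
  choose t ht using h1
  -- With the whole correction in column 0, the constant derivation takes the a-th trace to t_a, so
  -- subtracting it makes the traces map to zero.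
  set c : Fin (n - 1) × Fin n → k := fun p => (Pi.single ⟨0, by omega⟩ (t p.1) : Fin n → k) p.2
    with hc
  have hψ := hφ.sub_constDer c
  have hL : ∀ a, ((∑ j, MvPolynomial.X (a, j), 0) : Poly × Poly) ∈
      liftGraph (φ - derivationMap I (constDer c)) := by
    intro a
    have := mem_liftGraph_sub (constDer c) (ht a)
    rw [map_sum] at this
    simp only [constDer_X] at this
    rw [← map_sum, ← map_sub, hc] at this
    simpa using this
  obtain ⟨M, hs, hM⟩ := hI.exists_bilinear hn (fun g => zero_mem_liftGraph)
    (Γ := liftGraph (φ - derivationMap I (constDer c))) fun a b j =>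
      hψ.exists_mem_liftGraph (hI.relIdeal_le (X_mul_X_mem_relIdeal a b j))
        (X_mul_X_isHomogeneous a b j) (by norm_num)
  refine ⟨c, M, fun g => zero_mem_liftGraph, fun v => ?_, hM, hs,
    fun hf _ hm => hψ.exists_mem_liftGraph hf hm (by push_cast; ring)⟩
  have : ((∑ j, lin j v, 0) : Poly × Poly) = ∑ i, (MvPolynomial.C (v i) : Poly) •
      ((∑ j, MvPolynomial.X (i, j), 0) : Poly × Poly) := by
    refine Prod.ext ?_ ?_
    · simp only [Prod.fst_sum, Prod.smul_fst, lin_apply, MvPolynomial.smul_eq_C_mul]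
      rw [Finset.sum_comm]
      simp only [Finset.mul_sum, smul_eq_mul]
    · simp only [Prod.snd_sum, Prod.smul_snd, smul_zero, Finset.sum_const_zero]
  rw [this]
  exact Submodule.sum_mem _ fun i _ => Submodule.smul_mem _ _ (hL i)

/-- If the forms `M_j(v, v) ∧ v` agree, then one can arrange that the `M_j` agree. -/
theorem IsTangent.exists_const [CharZero k] {I : Ideal Poly} (hn : 1 ≤ n)
    {φ : I →ₗ[Poly] (Poly ⧸ I)} (hφ : IsGradedOfDegree φ (-1)) {M : _}
    (h : IsTangent I (liftGraph φ) M)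
    (hM : ∀ i j v p q, M i v v p * v q - M i v v q * v p = M j v v p * v q - M j v v q * v p) :
    ∃ (c : Fin (n - 1) × Fin n → k) (M' : _),
      IsTangent I (liftGraph (φ - derivationMap I (constDer c))) fun _ => M' := by
  have h0 : ∀ j, ∃ c : Fin (n - 1) → k, ∀ a b,
      (M j - M ⟨0, hn⟩) a b = (c ⬝ᵥ a) • b + (c ⬝ᵥ b) • a := by
    refine fun j => exists_eq_smul_add_smul (fun a b => ?_) fun v p q => ?_
    · rw [LinearMap.sub_apply, LinearMap.sub_apply, LinearMap.sub_apply, LinearMap.sub_apply,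
        h.symm j, h.symm _ a]
    · simp only [LinearMap.sub_apply, Pi.sub_apply]
      linear_combination hM j ⟨0, hn⟩ v p q
  choose l hl using h0
  -- After subtraction of the mean the coefficients of the derivation sum to zero over the columns,
  -- so the traces stay killed; the mean itself is absorbed into the common bilinear map.
  set avg : Fin (n - 1) → k := (n : k)⁻¹ • ∑ j, l j with havg
  have hn' : (n : k) ≠ 0 := by exact_mod_cast (by omega : n ≠ 0)
  have hsum : ∑ j, (l j - avg) = 0 := by
    rw [Finset.sum_sub_distrib, Finset.sum_const, Finset.card_univ, Fintype.card_fin, havg,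
      ← Nat.cast_smul_eq_nsmul k, smul_smul, mul_inv_cancel₀ hn', one_smul, sub_self]
  have hM' : ∀ j a b, M j a b - (((l j - avg) ⬝ᵥ a) • b + ((l j - avg) ⬝ᵥ b) • a) =
      M ⟨0, hn⟩ a b + ((avg ⬝ᵥ a) • b + (avg ⬝ᵥ b) • a) := by
    intro j a b
    have := hl j a b
    rw [LinearMap.sub_apply, LinearMap.sub_apply, sub_eq_iff_eq_add] at this
    rw [this, sub_dotProduct, sub_dotProduct, sub_smul, sub_smul]
    abel
  refine ⟨fun p => (l p.2 - avg) p.1, M ⟨0, hn⟩ + LinearMap.mk₂ k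
      (fun a b => (avg ⬝ᵥ a) • b + (avg ⬝ᵥ b) • a)
      (fun a a' b => by simp only [dotProduct_add, add_smul, smul_add]; abel)
      (fun r a b => by simp only [dotProduct_smul, smul_add, smul_smul, smul_eq_mul, mul_comm r])
      (fun a b b' => by simp only [dotProduct_add, add_smul, smul_add]; abel)
      (fun r a b => by simp only [dotProduct_smul, smul_add, smul_smul, smul_eq_mul, mul_comm r]),
      fun g => zero_mem_liftGraph, fun v => ?_, fun j a b => ?_, fun j a b => ?_,
      fun hf _ hm => (hφ.sub_constDer _).exists_mem_liftGraph hf hm (by push_cast; ring)⟩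
  · have := mem_liftGraph_sub (constDer fun p => (l p.2 - avg) p.1) (h.sum_lin_mem v)
    rw [map_sum] at this
    simp only [constDer_lin (fun j => l j - avg)] at this
    rw [← map_sum, ← sum_dotProduct, hsum, zero_dotProduct, map_zero, sub_zero] at this
    exact this
  · have := mem_liftGraph_sub (constDer fun p => (l p.2 - avg) p.1) (h.lin_mul_lin_mem j a b)
    rw [Derivation.leibniz, constDer_lin (fun j => l j - avg), constDer_lin (fun j => l j - avg),
      smul_eq_mul, smul_eq_mul, mul_comm (lin j a) (MvPolynomial.C _),
      mul_comm (lin j b) (MvPolynomial.C _),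
      ← MvPolynomial.smul_eq_C_mul, ← MvPolynomial.smul_eq_C_mul, ← map_smul, ← map_smul,
      ← map_add, ← map_sub, add_comm (_ • a), hM'] at this
    exact this
  · rw [LinearMap.add_apply, LinearMap.add_apply, LinearMap.mk₂_apply, LinearMap.add_apply,
      LinearMap.add_apply, LinearMap.mk₂_apply, h.symm, add_comm (_ • b)]

/-- A homomorphism of degree at most `-2` vanishes on the relations. -/
theorem IsAdmissible.relIdeal_le_of_degree_le {I : Ideal Poly} (hI : IsAdmissible I) (hn : 3 ≤ n)
    {φ : I →ₗ[Poly] (Poly ⧸ I)} {e : ℤ} (he : e ≤ -2) (hφ : IsGradedOfDegree φ e) :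
    relIdeal k n ≤ (liftGraph φ).comap (LinearMap.inl Poly Poly Poly) := by
  refine relIdeal_le_of (fun a b j => ?_) fun a => ?_
  · rw [Submodule.mem_comap, LinearMap.inl_apply]
    rcases he.lt_or_eq with he | rfl
    · exact hφ.mem_liftGraph_zero (hI.relIdeal_le (X_mul_X_mem_relIdeal a b j))
        (X_mul_X_isHomogeneous a b j) (by push_cast; omega)
    -- In degree -2 the images are constants t. The syzygy x_c · (x_a x_b) = x_a · (x_b x_c) within
    -- column j, with c ≠ a, puts t x_c - t' x_a into I, which forces t = 0.
    have h1 : ∀ a b, ∃ t : k, ((MvPolynomial.X (a, j) * MvPolynomial.X (b, j),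
        MvPolynomial.C t) : Poly × Poly) ∈ liftGraph φ := by
      intro a b
      obtain ⟨g, hg, h⟩ := hφ.exists_mem_liftGraph (d := 0)
        (hI.relIdeal_le (X_mul_X_mem_relIdeal a b j)) (X_mul_X_isHomogeneous a b j) (by norm_num)
      rw [eq_C_of_isHomogeneous_zero hg] at h
      exact ⟨_, h⟩
    have : Nontrivial (Fin (n - 1)) := Fin.nontrivial_iff_two_le.2 (by omega)
    obtain ⟨c, hc⟩ := exists_ne a
    obtain ⟨t, ht⟩ := h1 a b
    obtain ⟨t', ht'⟩ := h1 b c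
    have h2 := (liftGraph φ).sub_mem ((liftGraph φ).smul_mem (MvPolynomial.X (c, j)) ht)
      ((liftGraph φ).smul_mem (MvPolynomial.X (a, j)) ht')
    have h3 : MvPolynomial.X (c, j) * (MvPolynomial.X (a, j) * MvPolynomial.X (b, j)) -
      MvPolynomial.X (a, j) * (MvPolynomial.X (b, j) * MvPolynomial.X (c, j)) = (0 : Poly) := by
      ring
    rw [Prod.smul_mk, Prod.smul_mk, Prod.mk_sub_mk, smul_eq_mul, smul_eq_mul, h3,
      zero_mem_liftGraph, smul_eq_mul, smul_eq_mul, mul_comm, ← MvPolynomial.smul_eq_C_mul,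
      mul_comm, ← MvPolynomial.smul_eq_C_mul, ← lin_single, ← lin_single, ← map_smul, ← map_smul,
      ← map_sub] at h2
    have := congrFun (hI.lin_mem (by omega) h2) c
    simp [hc] at this
    rw [this, map_zero] at ht
    exact ht
  · exact hφ.mem_liftGraph_zero (hI.relIdeal_le (sum_X_mem_relIdeal a)) (sum_X_isHomogeneous a)
      (by push_cast; omega)

/-- A homomorphism which vanishes on the relations vanishes, if the remaining generators of `I`
lie in the socle and if `S/I` has no socle in small degrees. -/
theorem eq_zero_of_relIdeal_le {I : Ideal Poly} {ι : Type*} {σ : ι → Poly}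
    (hIσ : I = relIdeal k n ⊔ Ideal.span (Set.range σ)) {d : ℕ} (hσ : ∀ i, (σ i).IsHomogeneous d)
    (hX : ∀ i p, MvPolynomial.X p * σ i ∈ relIdeal k n)
    {φ : I →ₗ[Poly] (Poly ⧸ I)} {e : ℤ} (hφ : IsGradedOfDegree φ e)
    (hsoc : ∀ m : ℕ, (d : ℤ) + e = m → ∀ g : Poly, g.IsHomogeneous m →
      (∀ p, MvPolynomial.X p * g ∈ I) → g ∈ I)
    (hrel : relIdeal k n ≤ (liftGraph φ).comap (LinearMap.inl Poly Poly Poly)) : φ = 0 := by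
  have hσI : ∀ i, σ i ∈ I := fun i => by
    rw [hIσ]
    exact Ideal.mem_sup_right (Ideal.subset_span ⟨i, rfl⟩)
  have key : ∀ i, ((σ i, 0) : Poly × Poly) ∈ liftGraph φ := by
    intro i
    rcases lt_or_ge ((d : ℤ) + e) 0 with h | h
    · exact hφ.mem_liftGraph_zero (hσI i) (hσ i) h
    · obtain ⟨m, hm⟩ := Int.eq_ofNat_of_zero_le h
      obtain ⟨g, hg, h1⟩ := hφ.exists_mem_liftGraph (hσI i) (hσ i) hm
      -- Since x_p σ_i is a relation, each x_p annihilates the image of σ_i, which therefore lies in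
      -- the socle of S/I.
      have h2 : g ∈ I := by
        refine hsoc m hm g hg fun p => ?_
        have h3 := hrel (hX i p)
        rw [Submodule.mem_comap, LinearMap.inl_apply] at h3
        have := (liftGraph φ).sub_mem ((liftGraph φ).smul_mem (MvPolynomial.X p) h1) h3
        rwa [Prod.smul_mk, Prod.mk_sub_mk, smul_eq_mul, smul_eq_mul, sub_self, sub_zero,
          zero_mem_liftGraph] at this
      have := (liftGraph φ).sub_mem h1 (zero_mem_liftGraph.2 h2)
      rwa [Prod.mk_sub_mk, sub_zero, sub_self] at this
  have hle : I ≤ (liftGraph φ).comap (LinearMap.inl Poly Poly Poly) := by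
    conv_lhs => rw [hIσ]
    refine sup_le hrel (Ideal.span_le.2 ?_)
    rintro _ ⟨i, rfl⟩
    exact key i
  ext f
  obtain ⟨_, h⟩ := hle f.2
  exact h.trans (map_zero (Ideal.Quotient.mk I))

/-- A criterion for trivial negative tangents. -/
theorem IsAdmissible.hasTrivialNegativeTangents [CharZero k] {I : Ideal Poly}
    (hI : IsAdmissible I) (hn : 4 ≤ n) {ι : Type*} {σ : ι → Poly}
    (hIσ : I = relIdeal k n ⊔ Ideal.span (Set.range σ)) {d : ℕ} (hσ : ∀ i, (σ i).IsHomogeneous d)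
    (hX : ∀ i p, MvPolynomial.X p * σ i ∈ relIdeal k n)
    (hsoc : ∀ m : ℕ, m < d → ∀ g : Poly, g.IsHomogeneous m →
      (∀ p, MvPolynomial.X p * g ∈ I) → g ∈ I)
    (hM : ∀ Γ M, IsTangent I Γ M → ∀ i j v p q,
      M i v v p * v q - M i v v q * v p = M j v v p * v q - M j v v q * v p)
    (hM' : ∀ Γ M, IsTangent I Γ (fun _ => M) → M = 0) : HasTrivialNegativeTangents I := by
  intro e φ he hφ
  rcases lt_or_ge e (-1) with he' | he'
  · have : φ = 0 := eq_zero_of_relIdeal_le hIσ hσ hX hφ (fun m hm => hsoc m (by omega))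
      (hI.relIdeal_le_of_degree_le (by omega) (by omega) hφ)
    exact ⟨0, fun f => by rw [this]; rfl⟩
  obtain rfl : e = -1 := by omega
  obtain ⟨c, M, h⟩ := hI.exists_isTangent hn hφ
  obtain ⟨c', M', h'⟩ := h.exists_const (by omega) (hφ.sub_constDer c) (hM _ _ h)
  obtain rfl := hM' _ _ h'
  have h0 := eq_zero_of_relIdeal_le hIσ hσ hX ((hφ.sub_constDer c).sub_constDer c')
    (fun m hm => hsoc m (by omega)) (relIdeal_le_of (fun a b j => ?_) fun a => ?_)
  · refine ⟨(Ideal.Quotient.mkₐ Poly I).toLinearMap.compDer (constDer c + constDer c'),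
      fun f => ?_⟩
    rw [sub_sub, sub_eq_zero] at h0
    rw [h0, LinearMap.add_apply]
    exact (map_add (Ideal.Quotient.mk I) _ _).symm
  · have := h'.lin_mul_lin_mem j (Pi.single a 1) (Pi.single b 1)
    rw [lin_single, lin_single] at this
    simpa using this
  · have := h'.sum_lin_mem (Pi.single a 1)
    simp only [lin_single] at this
    exact this

/-- The ideal of a quotient of `G(A_n)`. -/
theorem comap_presentation_span [CharZero k] (hn : 1 ≤ n) {ι : Type*} (σ : ι → Poly) :
    (Ideal.span (Set.range fun i => G.presentation k n (σ i))).comap (G.presentation k n) =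
      relIdeal k n ⊔ Ideal.span (Set.range σ) := by
  have h1 : Ideal.span (Set.range fun i => G.presentation k n (σ i)) =
      (Ideal.span (Set.range σ)).map (G.presentation k n) := by
    rw [Ideal.map_span, ← Set.range_comp]; rfl
  rw [h1, Ideal.comap_map_of_surjective _ presentation_surjective, sup_comm, ← ker_presentation hn]
  rfl

/-- Functionals on the ideal generated by the relations and by elements of the socle. -/
theorem eq_zero_of_mem_sup_span {ι : Type*} {σ : ι → Poly}
    (hX : ∀ i p, MvPolynomial.X p * σ i ∈ relIdeal k n) {Λ : Poly →ₗ[k] k}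
    (hrel : ∀ f ∈ relIdeal k n, Λ f = 0) (hσ : ∀ i, Λ (σ i) = 0) {f : Poly}
    (hf : f ∈ relIdeal k n ⊔ Ideal.span (Set.range σ)) : Λ f = 0 := by
  have h1 : ∀ i (g : Poly), Λ (g * σ i) = 0 := by
    intro i g
    induction g using MvPolynomial.induction_on with
    | C c => rw [← MvPolynomial.smul_eq_C_mul, map_smul, hσ, smul_zero]
    | add p q hp hq => rw [add_mul, map_add, hp, hq, add_zero]
    | mul_X p q _ => rw [mul_assoc]; exact hrel _ (Ideal.mul_mem_left _ _ (hX i q))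
  obtain ⟨r, hr, s, hs, rfl⟩ := Submodule.mem_sup.1 hf
  rw [map_add, hrel r hr, zero_add]
  clear hf
  obtain ⟨c, rfl⟩ := (Finsupp.mem_ideal_span_range_iff_exists_finsupp).1 hs
  rw [Finsupp.sum, map_sum]
  exact Finset.sum_eq_zero fun i _ => h1 i _

theorem isAdmissible_sup_span {ι : Type*} {σ : ι → Poly}
    (hX : ∀ i p, MvPolynomial.X p * σ i ∈ relIdeal k n)
    (h1 : ∀ i ξ α, T1 ξ α (σ i) = 0) (h2 : ∀ i ξ ζ α β, Alt2 ξ ζ α β (σ i) = 0) :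
    IsAdmissible (relIdeal k n ⊔ Ideal.span (Set.range σ)) where
  relIdeal_le := le_sup_left
  T1_eq_zero hα _ hf :=
    eq_zero_of_mem_sup_span hX (fun _ h => T1_relIdeal hα h) (fun i => h1 i _ _) hf
  Alt2_eq_zero hα hβ _ hf :=
    eq_zero_of_mem_sup_span hX (fun _ h => Alt2_relIdeal hα hβ h) (fun i => h2 i _ _ _ _) hf

end

end GaloisClosure

namespace GaloisClosure

noncomputable section

variable {k : Type*} [Field k] {n : ℕ}

local notation "Poly" => MvPolynomial (Fin (n - 1) × Fin n) k

/-! ### Symmetric products of linear forms -/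

/-- The form `a_i b_j + b_i a_j`. -/
def sym2 (i j : Fin n) (a b : Fin (n - 1) → k) : MvPolynomial (Fin (n - 1) × Fin n) k :=
  lin i a * lin j b + lin i b * lin j a

theorem isHomogeneous_lin (j : Fin n) (a : Fin (n - 1) → k) : (lin j a : Poly).IsHomogeneous 1 := by
  rw [lin_apply]
  refine MvPolynomial.IsHomogeneous.sum _ _ _ fun i _ => ?_
  rw [MvPolynomial.smul_eq_C_mul]
  exact (MvPolynomial.isHomogeneous_X k _).C_mul _

theorem isHomogeneous_sym2 (i j : Fin n) (a b : Fin (n - 1) → k) :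
    (sym2 i j a b).IsHomogeneous 2 :=
  ((isHomogeneous_lin _ _).mul (isHomogeneous_lin _ _)).add
    ((isHomogeneous_lin _ _).mul (isHomogeneous_lin _ _))

theorem T2_sym2 (ξ : Fin (n - 1) → k) (α : Fin n → k) (ζ : Fin (n - 1) → k) (β : Fin n → k)
    (i j : Fin n) (a b : Fin (n - 1) → k) : T2 ξ α ζ β (sym2 i j a b) =
      ((ξ ⬝ᵥ a) * (ζ ⬝ᵥ b) + (ξ ⬝ᵥ b) * (ζ ⬝ᵥ a)) * (α i * β j + α j * β i) := by
  rw [sym2, map_add, T2_lin_mul, T2_lin_mul]; ring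

theorem Alt2_sym2 (ξ ζ : Fin (n - 1) → k) (α β : Fin n → k) (i j : Fin n)
    (a b : Fin (n - 1) → k) : Alt2 ξ ζ α β (sym2 i j a b) = 0 := by
  rw [sym2, map_add, Alt2_lin_mul, Alt2_lin_mul]; ring

theorem T1_sym2 (ξ : Fin (n - 1) → k) (α : Fin n → k) (i j : Fin n) (a b : Fin (n - 1) → k) :
    T1 ξ α (sym2 i j a b) = 0 := by
  rw [sym2, map_add, T1_lin_mul, T1_lin_mul, add_zero]

theorem X_mul_mem_relIdeal_iff [CharZero k] (hn : 1 ≤ n) (f : Poly) :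
    (∀ p, MvPolynomial.X p * f ∈ relIdeal k n) ↔ G.presentation k n f ∈ G.socle k n := by
  rw [G.mem_socle_iff, Prod.forall]
  refine forall_congr' fun i => forall_congr' fun j => ?_
  rw [← ker_presentation hn, RingHom.mem_ker, map_mul]
  have : (G.presentation k n : Poly →+* G k n) (MvPolynomial.X (i, j)) = G.x k n i j :=
    presentation_X (i, j)
  rw [← this]
  rfl

/-- This polarizes `G.prod_conj_mem_socle` for J = {i, j}, using the vectors a + b, a and b. -/
theorem presentation_sym2_mul_mem_socle [CharZero k] {i j : Fin n} (hij : i ≠ j)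
    (a b : Fin (n - 1) → k) {T : Finset (Fin n)} (hi : i ∉ T) (hj : j ∉ T)
    (hT : n < T.card + 5) (w : Fin n → Fin (n - 1) → k) :
    G.presentation k n (sym2 i j a b * ∏ t ∈ T, lin t (w t)) ∈ G.socle k n := by
  have hd : Disjoint ({i, j} : Finset (Fin n)) T := by
    rw [Finset.disjoint_left]
    intro x hx
    rcases Finset.mem_insert.1 hx with rfl | hx
    · exact hi
    · rwa [Finset.mem_singleton.1 hx]
  have key : ∀ v, G.conj i (An.vec k n v) * G.conj j (An.vec k n v) *
      ∏ t ∈ T, G.conj t (An.vec k n (w t)) ∈ G.socle k n := by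
    intro v
    have := G.prod_conj_mem_socle v hd w (by rw [Finset.card_pair hij]; omega)
    rwa [Finset.prod_pair hij] at this
  have h := (G.socle k n).sub_mem ((G.socle k n).sub_mem (key (a + b)) (key a)) (key b)
  rw [map_mul, map_prod, sym2]
  simp only [map_add, map_mul, presentation_lin] at h ⊢
  convert h using 1
  ring

/-! ### Lemmas on symmetric bilinear maps -/

theorem eq_zero_of_forall_apply_self [CharZero k] {V W : Type*} [AddCommGroup V] [Module k V]
    [AddCommGroup W] [Module k W] {M : V →ₗ[k] V →ₗ[k] W} (hs : ∀ a b, M a b = M b a)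
    (h : ∀ v, M v v = 0) : M = 0 := by
  ext a b
  have h1 := h (a + b)
  simp only [map_add, LinearMap.add_apply, h, hs b a, zero_add, add_zero] at h1
  rw [← two_smul k, smul_eq_zero] at h1
  simpa using h1

/-- If v_p ≠ 0 it can be cancelled; if v_p = 0, the identities at v + e_p, v - e_p and e_p together
isolate M(v, v)_p. -/
theorem eq_zero_of_apply_self_mul [CharZero k] {ι : Type*} [DecidableEq ι]
    {M : (ι → k) →ₗ[k] (ι → k) →ₗ[k] (ι → k)} (hs : ∀ a b, M a b = M b a)
    (h : ∀ v p, M v v p * v p = 0) : M = 0 := by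
  refine eq_zero_of_forall_apply_self hs fun v => funext fun p => ?_
  rcases mul_eq_zero.1 (h v p) with h0 | h0
  · exact h0
  have he := h (Pi.single p 1) p
  have h1 := h (v + Pi.single p 1) p
  have h2 := h (v - Pi.single p 1) p
  simp only [map_add, map_sub, LinearMap.add_apply, LinearMap.sub_apply, Pi.add_apply,
    Pi.sub_apply, Pi.single_eq_same, h0, hs _ v, mul_one] at he h1 h2
  rw [Pi.zero_apply]
  have : (2 : k) * M v v p = 0 := by linear_combination h1 - h2 - 2 * he
  simpa using this

/-- The hypothesis is M(c, e_i) ∧ e_j + M(c, e_j) ∧ e_i + c ∧ M(e_i, e_j) = 0. On basis vectors it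
first kills M(e_i, e_i), then the mixed values. -/
theorem eq_zero_of_wedge_eq_zero [CharZero k] {ι : Type*} [Fintype ι] [DecidableEq ι]
    (hι : 2 ≤ Fintype.card ι)
    {M : (ι → k) →ₗ[k] (ι → k) →ₗ[k] (ι → k)} (hs : ∀ a b, M a b = M b a)
    (h : ∀ c i j p q, ((M c (Pi.single i 1) p * (Pi.single j 1 : ι → k) q -
        M c (Pi.single i 1) q * (Pi.single j 1 : ι → k) p) +
      (M c (Pi.single j 1) p * (Pi.single i 1 : ι → k) q -
        M c (Pi.single j 1) q * (Pi.single i 1 : ι → k) p) +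
      (c p * M (Pi.single i 1) (Pi.single j 1) q - c q * M (Pi.single i 1) (Pi.single j 1) p)) = 0) :
    M = 0 := by
  set e : ι → ι → k := fun i => Pi.single i 1 with he
  have e1 : ∀ i, e i i = 1 := fun i => Pi.single_eq_same _ _
  have e0 : ∀ {i j}, j ≠ i → e i j = 0 := fun h => Pi.single_eq_of_ne h _
  change ∀ c i j p q, ((M c (e i) p * e j q - M c (e i) q * e j p) +
      (M c (e j) p * e i q - M c (e j) q * e i p) +
      (c p * M (e i) (e j) q - c q * M (e i) (e j) p)) = 0 at h
  have h1 : ∀ i p, p ≠ i → M (e i) (e i) p = 0 := by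
    intro i p hp
    have := h (e i) i i p i
    rw [e1, e0 hp] at this
    linear_combination this
  have : Nontrivial ι := Fintype.one_lt_card_iff_nontrivial.1 (by omega)
  have h2 : ∀ i, M (e i) (e i) i = 0 := by
    intro i
    obtain ⟨l, hl⟩ := exists_ne i
    have := h (e i) i l i l
    rw [e1, e1, e0 hl, e0 hl.symm, h1 i l hl] at this
    linear_combination this
  have h3 : ∀ i, M (e i) (e i) = 0 := fun i => funext fun p => by
    by_cases hp : p = i
    · subst hp; exact h2 _
    · exact h1 _ _ hp
  have h4 : ∀ i l p, p ≠ i → M (e l) (e i) p = 0 := by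
    intro i l p hp
    have := h (e l) i i p i
    rw [e1, e0 hp, h3] at this
    simp only [Pi.zero_apply] at this
    have h5 : (2 : k) * M (e l) (e i) p = 0 := by linear_combination this
    simpa using h5
  refine LinearMap.ext_basis (Pi.basisFun k ι) (Pi.basisFun k ι) fun i l => ?_
  rw [Pi.basisFun_apply, Pi.basisFun_apply]
  change M (e i) (e l) = 0
  by_cases hil : i = l
  · subst hil; exact h3 i
  ext p
  by_cases hp : p = l
  · rw [hs]
    exact h4 _ _ _ fun h => hil (h.symm.trans hp)
  · exact h4 _ _ _ hp

/-! ### Tangents for `n = 4` -/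

section Four

local notation "Poly₄" => MvPolynomial (Fin (4 - 1) × Fin 4) k

/-- The correspondence is applied to the syzygy (v_0² - v_1²)(v_2 - v_3) + (v_0 - v_1)(v_2² - v_3²)
= (v_0 - v_1)(v_2 - v_3) ∑ v_j, with columns permuted by e. -/
theorem IsTangent.four_mem {I : Ideal Poly₄} {Γ : Submodule Poly₄ (Poly₄ × Poly₄)} {M : _}
    (h : IsTangent I Γ M) (e : Equiv.Perm (Fin 4)) (v : Fin (4 - 1) → k) :
    (lin (e 0) (M (e 0) v v) - lin (e 1) (M (e 1) v v)) * (lin (e 2) v - lin (e 3) v) +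
      (lin (e 0) v - lin (e 1) v) * (lin (e 2) (M (e 2) v v) - lin (e 3) (M (e 3) v v)) ∈ I := by
  rw [← h.zero_mem_iff]
  have hL := h.sum_lin_mem v
  rw [← Equiv.sum_comp e, Fin.sum_univ_four] at hL
  have hq := fun j => h.lin_mul_lin_mem (e j) v v
  have := Γ.sub_mem (Γ.add_mem
    (Γ.smul_mem (lin (e 2) v - lin (e 3) v) (Γ.sub_mem (hq 0) (hq 1)))
    (Γ.smul_mem (lin (e 0) v - lin (e 1) v) (Γ.sub_mem (hq 2) (hq 3))))
    (Γ.smul_mem ((lin (e 0) v - lin (e 1) v) * (lin (e 2) v - lin (e 3) v)) hL)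
  convert this using 1
  refine Prod.ext ?_ ?_
  · simp only [Prod.fst_sub, Prod.fst_add, Prod.smul_fst, smul_eq_mul]
    ring
  · simp only [Prod.snd_sub, Prod.snd_add, Prod.smul_snd, smul_eq_mul]
    ring

/-- Comparing the identities for e and for e composed with the transposition of 0 and 2 gives 3 (μ(e
0) - μ(e 2)) = 0. -/
theorem eq_of_forall_perm {n : ℕ} [CharZero k] {μ : Fin (n + 3) → k}
    (h : ∀ e : Equiv.Perm (Fin (n + 3)), 2 * μ (e 2) = μ (e 0) + μ (e 1)) (i j : Fin (n + 3)) :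
    μ i = μ j := by
  have h20 : (2 : Fin (n + 3)) ≠ 0 := by
    simp [Fin.ext_iff, Nat.mod_eq_of_lt (show 2 < n + 3 by omega)]
  have h21 : (2 : Fin (n + 3)) ≠ 1 := by
    simp [Fin.ext_iff, Nat.mod_eq_of_lt (show 2 < n + 3 by omega)]
  have h10 : (1 : Fin (n + 3)) ≠ 0 := by simp
  have h1 : ∀ e : Equiv.Perm (Fin (n + 3)), μ (e 0) = μ (e 2) := by
    intro e
    have h1 := h e
    have h2 := h (e * Equiv.swap 0 2)
    simp only [Equiv.Perm.mul_apply, Equiv.swap_apply_left, Equiv.swap_apply_right,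
      Equiv.swap_apply_of_ne_of_ne h10 h21.symm] at h2
    have : (3 : k) * (μ (e 0) - μ (e 2)) = 0 := by linear_combination h2 - h1
    simpa [sub_eq_zero] using this
  have h2 : ∀ j, μ j = μ 0 := by
    intro j
    by_cases hj : j = 0
    · rw [hj]
    · have := h1 (Equiv.swap 2 j)
      rwa [Equiv.swap_apply_left, Equiv.swap_apply_of_ne_of_ne h20.symm (Ne.symm hj), eq_comm] at this
  rw [h2 i, h2 j]

theorem sum_comp_symm_eq_zero {n : ℕ} (e : Equiv.Perm (Fin n)) {α : Fin n → k} (h : ∑ j, α j = 0) :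
    ∑ j, (α ∘ e.symm) j = 0 := by
  rw [← h]; exact Equiv.sum_comp e.symm α

theorem IsTangent.four_wedge [CharZero k] {I : Ideal Poly₄} (hI : IsAdmissible I)
    {Γ : Submodule Poly₄ (Poly₄ × Poly₄)} {M : _}
    (h : IsTangent I Γ M) (i j : Fin 4) (v : Fin (4 - 1) → k) (p q : Fin (4 - 1)) :
    M i v v p * v q - M i v v q * v p = M j v v p * v q - M j v v q * v p := by
  refine eq_of_forall_perm (n := 1) (μ := fun i => M i v v p * v q - M i v v q * v p)
    (fun e => ?_) i j
  -- Both directions vanish on column e 3, which drops out; what remains is 2 μ(e 2) = μ(e 0) + μ(e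
  -- 1).
  have h1 := hI.Alt2_eq_zero (ξ := Pi.single p 1) (ζ := Pi.single q 1)
    (sum_comp_symm_eq_zero e (α := ![1, -1, 0, 0]) (by simp [Fin.sum_univ_four]))
    (sum_comp_symm_eq_zero e (α := ![0, 1, -1, 0]) (by simp [Fin.sum_univ_four]))
    (h.four_mem e v)
  simp only [mul_sub, sub_mul, map_add, map_sub, Alt2_lin_mul, Function.comp_apply,
    Equiv.symm_apply_apply, single_one_dotProduct] at h1
  simp at h1
  linear_combination h1

end Four

end

end GaloisClosure

namespace GaloisClosure

noncomputable section

variable {k : Type*} [Field k] {n : ℕ}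

/-! ### The quotients of `G(A_4)` -/

/-- The polarization of `(v_i - v_j)(v_l - v_m)`. -/
def quad (i j l m : Fin n) (a b : Fin (n - 1) → k) : MvPolynomial (Fin (n - 1) × Fin n) k :=
  sym2 i l a b - sym2 i m a b - sym2 j l a b + sym2 j m a b

theorem isHomogeneous_quad (i j l m : Fin n) (a b : Fin (n - 1) → k) :
    (quad i j l m a b).IsHomogeneous 2 :=
  (((isHomogeneous_sym2 ..).sub (isHomogeneous_sym2 ..)).sub (isHomogeneous_sym2 ..)).add
    (isHomogeneous_sym2 ..)

theorem T1_quad (ξ : Fin (n - 1) → k) (α : Fin n → k) (i j l m : Fin n) (a b : Fin (n - 1) → k) :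
    T1 ξ α (quad i j l m a b) = 0 := by
  simp [quad, T1_sym2]

theorem Alt2_quad (ξ ζ : Fin (n - 1) → k) (α β : Fin n → k) (i j l m : Fin n)
    (a b : Fin (n - 1) → k) : Alt2 ξ ζ α β (quad i j l m a b) = 0 := by
  simp [quad, Alt2_sym2]

theorem T2_quad (ξ : Fin (n - 1) → k) (α : Fin n → k) (ζ : Fin (n - 1) → k) (β : Fin n → k)
    (i j l m : Fin n) (a b : Fin (n - 1) → k) : T2 ξ α ζ β (quad i j l m a b) =
      ((ξ ⬝ᵥ a) * (ζ ⬝ᵥ b) + (ξ ⬝ᵥ b) * (ζ ⬝ᵥ a)) *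
        ((α i - α j) * (β l - β m) + (α l - α m) * (β i - β j)) := by
  simp only [quad, map_add, map_sub, T2_sym2]; ring

local notation "Poly₄" => MvPolynomial (Fin (4 - 1) × Fin 4) k

theorem presentation_quad_mem_socle [CharZero k] {i j l m : Fin 4} (hil : i ≠ l) (him : i ≠ m)
    (hjl : j ≠ l) (hjm : j ≠ m) (a b : Fin (4 - 1) → k) :
    G.presentation k 4 (quad i j l m a b) ∈ G.socle k 4 := by
  have key : ∀ {i j : Fin 4}, i ≠ j → G.presentation k 4 (sym2 i j a b) ∈ G.socle k 4 := by
    intro i j hij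
    have := presentation_sym2_mul_mem_socle hij a b (T := ∅) (by simp) (by simp) (by simp) 0
    rwa [Finset.prod_empty, mul_one] at this
  rw [quad, map_add, map_sub, map_sub]
  exact Ideal.add_mem _ (Ideal.sub_mem _ (Ideal.sub_mem _ (key hil) (key him)) (key hjl)) (key hjm)

/-- The functional with weights `w₀₁ = w₂₃ = w₀₂ = w₁₃ = 1` and `w₀₃ = w₁₂ = -2`. -/
def thetaA (ξ ζ : Fin (4 - 1) → k) : Poly₄ →ₗ[k] k :=
  T2 ξ ![1, -1, 0, 0] ζ ![0, 0, 1, -1] + T2 ξ ![1, 0, -1, 0] ζ ![0, 1, 0, -1]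

/-- The functional with weights `w₀₁ = w₂₃ = 2` and `w₀₂ = w₁₃ = w₀₃ = w₁₂ = -1`. -/
def thetaB (ξ ζ : Fin (4 - 1) → k) : Poly₄ →ₗ[k] k :=
  T2 ξ ![1, 0, -1, 0] ζ ![0, 1, 0, -1] + T2 ξ ![1, 0, 0, -1] ζ ![0, 1, -1, 0]

theorem thetaA_relIdeal (ξ ζ : Fin (4 - 1) → k) {f} (hf : f ∈ relIdeal k 4) :
    thetaA ξ ζ f = 0 := by
  rw [thetaA, LinearMap.add_apply, T2_relIdeal _ _ _ hf, T2_relIdeal _ _ _ hf, add_zero]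
  all_goals simp [Fin.sum_univ_four, Fin.forall_fin_succ]

theorem thetaB_relIdeal (ξ ζ : Fin (4 - 1) → k) {f} (hf : f ∈ relIdeal k 4) :
    thetaB ξ ζ f = 0 := by
  rw [thetaB, LinearMap.add_apply, T2_relIdeal _ _ _ hf, T2_relIdeal _ _ _ hf, add_zero]
  all_goals simp [Fin.sum_univ_four, Fin.forall_fin_succ]

/-- With the three evaluations that follow, `thetaA` and `thetaB` are, up to the factor 6, dual to
the polarizations of (v_0 - v_1)(v_2 - v_3) and (v_0 - v_3)(v_1 - v_2). -/
theorem thetaA_quad (ξ ζ a b : Fin (4 - 1) → k) : thetaA ξ ζ (quad 0 3 1 2 a b) = 0 := by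
  rw [thetaA, LinearMap.add_apply, T2_quad, T2_quad]
  simp
  try ring

theorem thetaA_quad' (ξ ζ a b : Fin (4 - 1) → k) : thetaA ξ ζ (quad 0 1 2 3 a b) =
    6 * ((ξ ⬝ᵥ a) * (ζ ⬝ᵥ b) + (ξ ⬝ᵥ b) * (ζ ⬝ᵥ a)) := by
  rw [thetaA, LinearMap.add_apply, T2_quad, T2_quad]
  simp
  ring

theorem thetaB_quad (ξ ζ a b : Fin (4 - 1) → k) : thetaB ξ ζ (quad 0 3 1 2 a b) =
    6 * ((ξ ⬝ᵥ a) * (ζ ⬝ᵥ b) + (ξ ⬝ᵥ b) * (ζ ⬝ᵥ a)) := by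
  rw [thetaB, LinearMap.add_apply, T2_quad, T2_quad]
  simp
  ring

theorem thetaB_quad' (ξ ζ a b : Fin (4 - 1) → k) : thetaB ξ ζ (quad 0 1 2 3 a b) = 0 := by
  rw [thetaB, LinearMap.add_apply, T2_quad, T2_quad]
  simp
  try ring

/-- Pairing `thetaA` in the direction e_p with the element of `IsTangent.four_mem` gives 12 M(v,
v)_p v_p. -/
theorem IsTangent.four_eq_zero_of_thetaA [CharZero k] {I : Ideal Poly₄}
    (hI : ∀ ξ, ∀ f ∈ I, thetaA ξ ξ f = 0) {Γ : Submodule Poly₄ (Poly₄ × Poly₄)} {M : _}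
    (h : IsTangent I Γ fun _ => M) : M = 0 := by
  refine eq_zero_of_apply_self_mul (h.symm 0) fun v p => ?_
  have h1 := hI (Pi.single p 1) _ (h.four_mem 1 v)
  simp only [Equiv.Perm.one_apply, thetaA, LinearMap.add_apply, mul_sub, sub_mul, map_add, map_sub,
    T2_lin_mul, single_one_dotProduct] at h1
  simp only [Matrix.cons_val] at h1
  have : (12 : k) * (M v v p * v p) = 0 := by linear_combination h1
  simpa using this

/-- Eliminating column 3 by the traces, c_0 times the generator becomes 2 c_0 a_0 (b_1 - b_2) + 2
c_0 b_0 (a_1 - a_2) + 2 c_0 (a_1 b_1 - a_2 b_2), a combination of products within a column. Applying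
the correspondence to this syzygy gives the element. -/
theorem IsTangent.mul_quad_mem {I : Ideal Poly₄} {Γ : Submodule Poly₄ (Poly₄ × Poly₄)} {M : _}
    (h : IsTangent I Γ fun _ => M) (a b c : Fin (4 - 1) → k) {g : Poly₄}
    (hg : (quad 0 3 1 2 a b, g) ∈ Γ) (e : Equiv.Perm (Fin 4)) (u : k)
    (he : quad (e 0) (e 3) (e 1) (e 2) a b = MvPolynomial.C u * quad 0 3 1 2 a b) :
    2 * (lin (e 0) (M c a) * (lin (e 1) b - lin (e 2) b)) +
      2 * (lin (e 0) (M c b) * (lin (e 1) a - lin (e 2) a)) +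
      2 * (lin (e 0) c * (lin (e 1) (M a b) - lin (e 2) (M a b))) -
      MvPolynomial.C u * (lin (e 0) c * g) ∈ I := by
  rw [← h.zero_mem_iff]
  have hL : ∀ v, ((lin (e 0) v + lin (e 1) v + lin (e 2) v + lin (e 3) v, 0) : Poly₄ × Poly₄) ∈ Γ := by
    intro v
    have := h.sum_lin_mem v
    rwa [← Equiv.sum_comp e, Fin.sum_univ_four] at this
  have hq := fun j a b => h.lin_mul_lin_mem (e j) a b
  have := Γ.sub_mem (Γ.sub_mem (Γ.sub_mem (Γ.add_mem (Γ.add_mem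
    (Γ.smul_mem (2 * (lin (e 1) b - lin (e 2) b)) (hq 0 c a))
    (Γ.smul_mem (2 * (lin (e 1) a - lin (e 2) a)) (hq 0 c b)))
    (Γ.smul_mem (2 * lin (e 0) c) (Γ.sub_mem (hq 1 a b) (hq 2 a b))))
    (Γ.smul_mem (lin (e 0) c * (lin (e 1) b - lin (e 2) b)) (hL a)))
    (Γ.smul_mem (lin (e 0) c * (lin (e 1) a - lin (e 2) a)) (hL b)))
    (Γ.smul_mem (MvPolynomial.C u * lin (e 0) c) hg)
  convert this using 1
  refine Prod.ext ?_ ?_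
  · simp only [Prod.fst_sub, Prod.fst_add, Prod.smul_fst, smul_eq_mul]
    have h2 : MvPolynomial.C u * lin (e 0) c * quad 0 3 1 2 a b =
        lin (e 0) c * quad (e 0) (e 3) (e 1) (e 2) a b := by rw [he]; ring
    rw [h2]
    simp only [quad, sym2]
    ring
  · simp only [Prod.snd_sub, Prod.snd_add, Prod.smul_snd, smul_eq_mul]
    ring

/-- Exchanging columns 0 and 3 negates the generator but fixes columns 1 and 2. So the unknown image
of the generator enters the two instances of `IsTangent.mul_quad_mem` with opposite signs and
cancels in the sum, leaving the identity of `eq_zero_of_wedge_eq_zero`. -/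
theorem IsTangent.four_eq_zero_of_quad_mem [CharZero k] {I : Ideal Poly₄} (hI : IsAdmissible I)
    (hq : ∀ i j, quad 0 3 1 2 (Pi.single i 1) (Pi.single j 1) ∈ I)
    {Γ : Submodule Poly₄ (Poly₄ × Poly₄)} {M : _}
    (h : IsTangent I Γ fun _ => M) : M = 0 := by
  refine eq_zero_of_wedge_eq_zero (by simp) (h.symm 0) fun c i j p q => ?_
  set a : Fin (4 - 1) → k := Pi.single i 1
  set b : Fin (4 - 1) → k := Pi.single j 1
  obtain ⟨g, hg, hg'⟩ := h.exists_lift (hq i j) (m := 1) (isHomogeneous_quad ..)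
  obtain ⟨F, rfl⟩ := eq_sum_lin_of_isHomogeneous_one hg
  have h1 := h.mul_quad_mem a b c hg' 1 1 (by simp)
  have h2 := h.mul_quad_mem a b c hg' (Equiv.swap 0 3) (-1) (by
    have e1 : Equiv.swap (0 : Fin 4) 3 1 = 1 := rfl
    have e2 : Equiv.swap (0 : Fin 4) 3 2 = 2 := rfl
    rw [Equiv.swap_apply_left, Equiv.swap_apply_right, e1, e2, quad, quad, map_neg, map_one]
    ring)
  have key : ∀ e : Equiv.Perm (Fin 4), ∀ u, 2 * (lin (e 0) (M c a) * (lin (e 1) b - lin (e 2) b)) +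
      2 * (lin (e 0) (M c b) * (lin (e 1) a - lin (e 2) a)) +
      2 * (lin (e 0) c * (lin (e 1) (M a b) - lin (e 2) (M a b))) -
      MvPolynomial.C u * (lin (e 0) c * ∑ t, lin t (F t)) ∈ I →
      4 * ((M c a p * b q - M c a q * b p) + (M c b p * a q - M c b q * a p) +
        (c p * M a b q - c q * M a b p)) =
        u * (c p * (F (e 1) q - F (e 2) q) - c q * (F (e 1) p - F (e 2) p)) := by
    intro e u h
    have h1 := hI.Alt2_eq_zero (ξ := Pi.single p 1) (ζ := Pi.single q 1)
      (sum_comp_symm_eq_zero e (α := ![1, -1, 0, 0]) (by simp [Fin.sum_univ_four]))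
      (sum_comp_symm_eq_zero e (α := ![0, 1, -1, 0]) (by simp [Fin.sum_univ_four])) h
    rw [← Equiv.sum_comp e, Fin.sum_univ_four] at h1
    simp only [two_mul, mul_add, mul_sub, sub_mul, map_add, map_sub, ← MvPolynomial.smul_eq_C_mul,
      map_smul, Alt2_lin_mul, Function.comp_apply, Equiv.symm_apply_apply,
      single_one_dotProduct] at h1
    simp at h1
    linear_combination h1
  have k1 := key _ _ h1
  have k2 := key _ _ h2
  have e1 : Equiv.swap (0 : Fin 4) 3 1 = 1 := rfl
  have e2 : Equiv.swap (0 : Fin 4) 3 2 = 2 := rfl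
  rw [e1, e2] at k2
  simp only [Equiv.Perm.one_apply] at k1
  have : (8 : k) * ((M c a p * b q - M c a q * b p) + (M c b p * a q - M c b q * a p) +
        (c p * M a b q - c q * M a b p)) = 0 := by linear_combination k1 + k2
  simpa using this

end

end GaloisClosure

/-! ### Linear independence and trivial negative tangents for n = 4 -/

namespace GaloisClosure

noncomputable section

variable {k : Type*} [Field k] {n : ℕ}

local notation "Poly" => MvPolynomial (Fin (n - 1) × Fin n) k
local notation "Poly₄" => MvPolynomial (Fin (4 - 1) × Fin 4) k

theorem linearIndependent_of_dual [CharZero k] (hn : 1 ≤ n) {ι : Type*} {σ : ι → Poly}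
    {Λ : ι → Poly →ₗ[k] k} (hΛ : ∀ i, ∀ f ∈ relIdeal k n, Λ i f = 0)
    (h0 : ∀ i j, i ≠ j → Λ i (σ j) = 0) (h1 : ∀ i, Λ i (σ i) ≠ 0) :
    LinearIndependent k fun i => G.presentation k n (σ i) := by
  rw [linearIndependent_iff']
  intro s c hc i hi
  have h2 : ∑ j ∈ s, c j • σ j ∈ relIdeal k n := by
    rw [← ker_presentation hn, RingHom.mem_ker]
    change G.presentation k n _ = 0
    rw [map_sum, ← hc]
    exact Finset.sum_congr rfl fun j _ => map_smul _ _ _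
  have h3 := hΛ i _ h2
  rw [map_sum, Finset.sum_eq_single i (fun j _ hj => by
    rw [map_smul, h0 i j hj.symm, smul_zero]) (fun h => absurd hi h), map_smul, smul_eq_mul] at h3
  exact (mul_eq_zero.1 h3).resolve_right (h1 i)

theorem isWeightedHomogeneous_sym2 (i j : Fin n) (a b : Fin (n - 1)) :
    (sym2 i j (Pi.single a (1 : k)) (Pi.single b 1)).IsWeightedHomogeneous
      (fun p : Fin (n - 1) × Fin n => (Pi.single p.1 1 : Fin (n - 1) → ℕ))
      (Pi.single a 1 + Pi.single b 1) := by
  rw [sym2, lin_single, lin_single, lin_single, lin_single]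
  refine MvPolynomial.IsWeightedHomogeneous.add
    ((MvPolynomial.isWeightedHomogeneous_X k _ _).mul (MvPolynomial.isWeightedHomogeneous_X k _ _))
    ?_
  rw [add_comm]
  exact (MvPolynomial.isWeightedHomogeneous_X k _ _).mul (MvPolynomial.isWeightedHomogeneous_X k _ _)

theorem isWeightedHomogeneous_quad (i j l m : Fin n) (a b : Fin (n - 1)) :
    (quad i j l m (Pi.single a (1 : k)) (Pi.single b 1)).IsWeightedHomogeneous
      (fun p : Fin (n - 1) × Fin n => (Pi.single p.1 1 : Fin (n - 1) → ℕ))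
      (Pi.single a 1 + Pi.single b 1) :=
  (MvPolynomial.weightedHomogeneousSubmodule k _ _).add_mem
    ((MvPolynomial.weightedHomogeneousSubmodule k _ _).sub_mem
      ((MvPolynomial.weightedHomogeneousSubmodule k _ _).sub_mem
        (isWeightedHomogeneous_sym2 ..) (isWeightedHomogeneous_sym2 ..))
      (isWeightedHomogeneous_sym2 ..)) (isWeightedHomogeneous_sym2 ..)

/-- The pairs `a ≤ b` of indices of variables for `n = 4`. -/
def pairs₄ : Fin 6 → Fin (4 - 1) × Fin (4 - 1) :=
  ![(0, 0), (0, 1), (0, 2), (1, 1), (1, 2), (2, 2)]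

theorem pairs₄_ne : ∀ i j, i ≠ j → ¬(pairs₄ i = pairs₄ j) ∧ ¬(pairs₄ i = (pairs₄ j).swap) := by
  decide

theorem exists_pairs₄ : ∀ a b : Fin (4 - 1), ∃ i, pairs₄ i = (a, b) ∨ pairs₄ i = (b, a) := by
  decide

variable (k) in
/-- The socle generators for `n = 4`. -/
def gen₄ (x : Fin 2 × Fin 6) : MvPolynomial (Fin (4 - 1) × Fin 4) k :=
  if x.1 = 0 then quad 0 3 1 2 (Pi.single (pairs₄ x.2).1 1) (Pi.single (pairs₄ x.2).2 1)
  else quad 0 1 2 3 (Pi.single (pairs₄ x.2).1 1) (Pi.single (pairs₄ x.2).2 1)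

theorem gen₄_induction {C : Poly₄ → (Fin (4 - 1) → k) → (Fin (4 - 1) → k) → Prop}
    (h1 : ∀ a b, C (quad 0 3 1 2 a b) a b) (h2 : ∀ a b, C (quad 0 1 2 3 a b) a b)
    (x : Fin 2 × Fin 6) :
    C (gen₄ k x) (Pi.single (pairs₄ x.2).1 1) (Pi.single (pairs₄ x.2).2 1) := by
  rw [gen₄]
  split_ifs
  · exact h1 _ _
  · exact h2 _ _

/-- Products of two basis vectors pair diagonally in the symmetric square, with diagonal values 1 or
2. -/
theorem pairing₄_ne [CharZero k] (i j : Fin 6) (a b c d : Fin (4 - 1) → k)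
    (ha : a = Pi.single (pairs₄ i).1 1) (hb : b = Pi.single (pairs₄ i).2 1)
    (hc : c = Pi.single (pairs₄ j).1 1) (hd : d = Pi.single (pairs₄ j).2 1) :
    (a ⬝ᵥ c) * (b ⬝ᵥ d) + (a ⬝ᵥ d) * (b ⬝ᵥ c) = 0 ↔ i ≠ j := by
  subst ha hb hc hd
  simp only [single_one_dotProduct, Pi.single_apply]
  constructor
  · rintro h rfl
    revert h
    simp only [if_true, mul_one]
    split_ifs <;> norm_num
  · intro h
    have := pairs₄_ne i j h
    simp only [Prod.ext_iff, Prod.fst_swap, Prod.snd_swap, not_and_or] at this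
    rcases this.1 with h1 | h1 <;> rcases this.2 with h2 | h2 <;> simp [h1, h2]

theorem linearIndependent_gen₄ [CharZero k] :
    LinearIndependent k fun x => G.presentation k 4 (gen₄ k x) := by
  refine linearIndependent_of_dual (by norm_num) (Λ := fun x : Fin 2 × Fin 6 =>
    if x.1 = 0 then thetaB (Pi.single (pairs₄ x.2).1 1) (Pi.single (pairs₄ x.2).2 1)
      else thetaA (Pi.single (pairs₄ x.2).1 1) (Pi.single (pairs₄ x.2).2 1)) ?_ ?_ ?_
  · intro x f hf
    split_ifs
    · exact thetaB_relIdeal _ _ hf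
    · exact thetaA_relIdeal _ _ hf
  · rintro ⟨x, i⟩ ⟨y, j⟩ h
    simp only [gen₄]
    split_ifs with hx hy hy
    · rw [thetaB_quad, (pairing₄_ne i j _ _ _ _ rfl rfl rfl rfl).2, mul_zero]
      rintro rfl
      exact h (by rw [hx, hy])
    · exact thetaB_quad' ..
    · exact thetaA_quad ..
    · rw [thetaA_quad', (pairing₄_ne i j _ _ _ _ rfl rfl rfl rfl).2, mul_zero]
      rintro rfl
      exact h (by rw [show x = y by omega])
  · rintro ⟨x, i⟩
    simp only [gen₄]
    split_ifs with hx
    · rw [thetaB_quad]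
      exact mul_ne_zero (by norm_num) fun h => (pairing₄_ne i i _ _ _ _ rfl rfl rfl rfl).1 h rfl
    · rw [thetaA_quad']
      exact mul_ne_zero (by norm_num) fun h => (pairing₄_ne i i _ _ _ _ rfl rfl rfl rfl).1 h rfl

theorem X_mul_gen₄_mem [CharZero k] (x : Fin 2 × Fin 6) (p) :
    MvPolynomial.X p * gen₄ k x ∈ relIdeal k 4 :=
  (X_mul_mem_relIdeal_iff (by norm_num) _).2
    (gen₄_induction (C := fun f _ _ => G.presentation k 4 f ∈ G.socle k 4)
      (fun a b => presentation_quad_mem_socle (by decide) (by decide) (by decide) (by decide) a b)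
      (fun a b => presentation_quad_mem_socle (by decide) (by decide) (by decide) (by decide) a b)
      x) p

theorem isAdmissible_gen₄ [CharZero k] {ι : Type*} (f : ι → Fin 2 × Fin 6) :
    IsAdmissible (relIdeal k 4 ⊔ Ideal.span (Set.range fun i => gen₄ k (f i))) :=
  isAdmissible_sup_span (fun i p => X_mul_gen₄_mem (f i) p)
    (fun i _ _ => gen₄_induction (C := fun f _ _ => T1 _ _ f = 0) (fun _ _ => T1_quad ..)
      (fun _ _ => T1_quad ..) (f i))
    (fun i _ _ _ _ => gen₄_induction (C := fun f _ _ => Alt2 _ _ _ _ f = 0)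
      (fun _ _ => Alt2_quad ..) (fun _ _ => Alt2_quad ..) (f i))

/-- Either only the first family of generators occurs, and `thetaA` vanishes on the ideal; or the
whole first family lies in the ideal, and `IsTangent.four_eq_zero_of_quad_mem` applies. -/
theorem hasTrivialNegativeTangents_gen₄ [CharZero k] {r : ℕ} (f : Fin r → Fin 2 × Fin 6)
    (hf : (∀ i, (f i).1 = 0) ∨ ∀ j, ∃ i, f i = (0, j)) :
    HasTrivialNegativeTangents
      (relIdeal k 4 ⊔ Ideal.span (Set.range fun i => gen₄ k (f i))) := by
  have hI := isAdmissible_gen₄ (k := k) f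
  refine hI.hasTrivialNegativeTangents (by norm_num) rfl (d := 2)
    (fun i => gen₄_induction (C := fun f _ _ => f.IsHomogeneous 2)
      (fun _ _ => isHomogeneous_quad ..) (fun _ _ => isHomogeneous_quad ..) (f i))
    (fun i p => X_mul_gen₄_mem (f i) p) (fun m hm g hg hX => ?_)
    (fun Γ M h => h.four_wedge hI) (fun Γ M h => ?_)
  · interval_cases m
    · exact hI.mem_of_forall_X_mul_mem_zero (by norm_num) hg hX
    · exact hI.mem_of_forall_X_mul_mem_one (by norm_num) hg hX
  · rcases hf with hf | hf
    · refine h.four_eq_zero_of_thetaA fun ξ g hg => ?_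
      refine eq_zero_of_mem_sup_span (fun i p => X_mul_gen₄_mem (f i) p)
        (fun g hg => thetaA_relIdeal ξ ξ hg) (fun i => ?_) hg
      rw [gen₄, if_pos (hf i)]
      exact thetaA_quad ..
    · refine h.four_eq_zero_of_quad_mem hI fun a b => ?_
      obtain ⟨l, hl⟩ := exists_pairs₄ a b
      obtain ⟨i, hi⟩ := hf l
      have h1 : gen₄ k (f i) ∈ relIdeal k 4 ⊔ Ideal.span (Set.range fun i => gen₄ k (f i)) :=
        Ideal.mem_sup_right (Ideal.subset_span ⟨i, rfl⟩)
      rw [hi, gen₄, if_pos rfl] at h1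
      rcases hl with hl | hl
      · rw [hl] at h1; exact h1
      · rw [hl] at h1
        convert h1 using 1
        simp only [quad, sym2]
        ring

theorem exists_socle_four [CharZero k] {r : ℕ} (hr : r ≤ 12) :
    ∃ (s : Fin r → G k 4) (d : Fin r → Fin (4 - 1) → ℕ), LinearIndependent k s ∧
      (∀ i, s i ∈ G.socle k 4) ∧ (∀ i, s i ∈ G.component k 4 (d i)) ∧ (∀ i, ∑ j, d i j = 2) ∧
      HasTrivialNegativeTangents
        ((Ideal.span (Set.range s)).comap (G.presentation k 4)) := by
  -- The enumeration lists the six generators of the first family before the second, so every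
  -- initial segment falls under one of the two cases.
  set f : Fin r → Fin 2 × Fin 6 := fun i => finProdFinEquiv.symm (Fin.castLE hr i) with hf
  refine ⟨fun i => G.presentation k 4 (gen₄ k (f i)),
    fun i => Pi.single (pairs₄ (f i).2).1 1 + Pi.single (pairs₄ (f i).2).2 1, ?_, ?_, ?_, ?_, ?_⟩
  · exact linearIndependent_gen₄.comp f
      (finProdFinEquiv.symm.injective.comp (Fin.castLE_injective hr))
  · intro i
    exact (X_mul_mem_relIdeal_iff (by norm_num) _).1 fun p => X_mul_gen₄_mem (f i) p
  · intro i
    refine Submodule.mem_map_of_mem ?_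
    rw [MvPolynomial.mem_weightedHomogeneousSubmodule, gen₄]
    split_ifs
    · exact isWeightedHomogeneous_quad ..
    · exact isWeightedHomogeneous_quad ..
  · intro i
    simp [Finset.sum_add_distrib]
  · rw [comap_presentation_span (by norm_num)]
    refine hasTrivialNegativeTangents_gen₄ f ?_
    rcases le_or_gt r 6 with h | h
    · refine Or.inl fun i => ?_
      have : (i : ℕ) / 6 = 0 := Nat.div_eq_of_lt (by omega)
      exact Fin.ext this
    · refine Or.inr fun j => ⟨⟨j, by omega⟩, ?_⟩
      rw [hf, Equiv.symm_apply_eq]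
      ext
      rw [finProdFinEquiv_apply_val]
      simp

end

end GaloisClosure

namespace GaloisClosure

noncomputable section

variable {k : Type*} [Field k] {n : ℕ}

local notation "Poly₅" => MvPolynomial (Fin (5 - 1) × Fin 5) k

/-! ### The socle generators for `n = 5` -/

theorem sym2_mul_lin (i j l : Fin n) (a b c : Fin (n - 1) → k) :
    sym2 i j a b * lin l c = lin i a * lin j b * lin l c + lin i b * lin j a * lin l c := by
  rw [sym2, add_mul]

variable (α β γ : Fin n → k)

/-- Half of the functional dual to the generators. -/
def hookSum (a b c : Fin (n - 1)) : MvPolynomial (Fin (n - 1) × Fin n) k →ₗ[k] k :=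
  Hook3 (Pi.single a 1) (Pi.single c 1) (Pi.single b 1) α β γ +
    Hook3 (Pi.single b 1) (Pi.single c 1) (Pi.single a 1) α β γ

/-- The functional which is dual to the generators. -/
def hookDual (a b c : Fin (n - 1)) : MvPolynomial (Fin (n - 1) × Fin n) k →ₗ[k] k :=
  (2 : k) • hookSum α β γ a b c + hookSum α β γ a c b

theorem hookDual_relIdeal {α β γ : Fin n → k} (hα : ∑ j, α j = 0) (hβ : ∑ j, β j = 0)
    (hγ : ∑ j, γ j = 0) (hαγ : ∀ j, α j * γ j = 0) (hβγ : ∀ j, β j * γ j = 0)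
    (a b c : Fin (n - 1)) {f} (hf : f ∈ relIdeal k n) : hookDual α β γ a b c f = 0 := by
  simp [hookDual, hookSum, Hook3_relIdeal hα hβ hγ hαγ hβγ hf]

/-- The weights 2 and 1 in `hookDual` are those for which the generators with b and c exchanged are
annihilated, as `hookDual_gen'` shows; this separates the two kinds of generators with the same
letters. -/
theorem hookDual_gen {a b c : Fin (n - 1)} (hab : a ≠ b) (hac : a ≠ c) (hbc : b ≠ c)
    (i j l : Fin n) : hookDual α β γ a b c
      (sym2 i j (Pi.single a 1) (Pi.single b 1) * lin l (Pi.single c 1)) =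
      3 * ((α i * β l - α l * β i) * γ j + (α j * β l - α l * β j) * γ i) := by
  simp only [sym2_mul_lin, hookDual, hookSum, Hook3, LinearMap.add_apply, LinearMap.sub_apply,
    LinearMap.smul_apply, map_add, T3_lin_mul_mul, single_one_dotProduct, Pi.single_eq_same,
    Pi.single_eq_of_ne hab, Pi.single_eq_of_ne hab.symm, Pi.single_eq_of_ne hac,
    Pi.single_eq_of_ne hac.symm, Pi.single_eq_of_ne hbc, Pi.single_eq_of_ne hbc.symm, smul_eq_mul]
  ring

theorem hookDual_gen' {a b c : Fin (n - 1)} (hab : a ≠ b) (hac : a ≠ c) (hbc : b ≠ c)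
    (i j l : Fin n) : hookDual α β γ a b c
      (sym2 i j (Pi.single a 1) (Pi.single c 1) * lin l (Pi.single b 1)) = 0 := by
  simp only [sym2_mul_lin, hookDual, hookSum, Hook3, LinearMap.add_apply, LinearMap.sub_apply,
    LinearMap.smul_apply, map_add, T3_lin_mul_mul, single_one_dotProduct, Pi.single_eq_same,
    Pi.single_eq_of_ne hab, Pi.single_eq_of_ne hab.symm, Pi.single_eq_of_ne hac,
    Pi.single_eq_of_ne hac.symm, Pi.single_eq_of_ne hbc, Pi.single_eq_of_ne hbc.symm, smul_eq_mul]
  ring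

theorem hookDual_gen_of_ne {a b c a' b' c' o : Fin (n - 1)} (ho : a = o ∨ b = o ∨ c = o)
    (ha : a' ≠ o) (hb : b' ≠ o) (hc : c' ≠ o) (i j l : Fin n) : hookDual α β γ a b c
      (sym2 i j (Pi.single a' 1) (Pi.single b' 1) * lin l (Pi.single c' 1)) = 0 := by
  simp only [sym2_mul_lin, hookDual, hookSum, Hook3, LinearMap.add_apply, LinearMap.sub_apply,
    LinearMap.smul_apply, map_add, T3_lin_mul_mul, single_one_dotProduct]
  rcases ho with rfl | rfl | rfl <;>
  · simp only [Pi.single_eq_of_ne ha.symm, Pi.single_eq_of_ne hb.symm, Pi.single_eq_of_ne hc.symm,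
      smul_eq_mul]
    ring

/-- The columns which appear in the generators. -/
def cols₅ : Fin 5 → Fin 5 × Fin 5 × Fin 5 :=
  ![(0, 3, 2), (0, 2, 3), (0, 3, 4), (0, 1, 3), (0, 1, 4)]

/-- The directions of the dual functionals. -/
def dirA : Fin 5 → Fin 5 → ℤ :=
  ![![1, -1, 0, 0, 0], ![1, -1, 0, 0, 0], ![1, -1, 0, 0, 0], ![1, 0, -1, 0, 0], ![0, 1, -1, 0, 0]]

/-- The directions of the dual functionals. -/
def dirB : Fin 5 → Fin 5 → ℤ :=
  ![![0, 1, -1, 0, 0], ![0, 1, 0, -1, 0], ![0, 1, 0, 0, -1], ![0, 0, 1, -1, 0], ![0, 0, 1, 0, -1]]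

/-- The directions of the dual functionals. -/
def dirC : Fin 5 → Fin 5 → ℤ :=
  ![![0, 0, 0, 1, -1], ![0, 0, 1, 0, -1], ![0, 0, 1, -1, 0], ![0, 1, 0, 0, -1], ![1, 0, 0, -1, 0]]

/-- Up to the factor 3 these are the values in `hookDual_gen`: the directions make the 5 × 5 matrix
of pairings diagonal with nonzero diagonal. -/
theorem dir_pairing (m m' : Fin 5) :
    (dirA m (cols₅ m').1 * dirB m (cols₅ m').2.2 - dirA m (cols₅ m').2.2 * dirB m (cols₅ m').1) *
      dirC m (cols₅ m').2.1 +
    (dirA m (cols₅ m').2.1 * dirB m (cols₅ m').2.2 -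
      dirA m (cols₅ m').2.2 * dirB m (cols₅ m').2.1) * dirC m (cols₅ m').1 = 0 ↔ m ≠ m' := by
  revert m m'; decide

/-- The indices of the variables which appear in the generators: all but one. -/
def letters₅ (o : Fin 4) (y : Fin 2) (x : Fin 3) : Fin (5 - 1) :=
  o.succAbove (if y = 0 then x else Equiv.swap 1 2 x)

theorem letters₅_ne (o : Fin 4) (y : Fin 2) (x : Fin 3) : letters₅ o y x ≠ o :=
  Fin.succAbove_ne _ _

theorem letters₅_injective (o : Fin 4) (y : Fin 2) : Function.Injective (letters₅ o y) := by
  intro x x' h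
  have := Fin.succAbove_right_injective h
  split_ifs at this
  · exact this
  · exact (Equiv.swap 1 2).injective this

theorem exists_letters₅ : ∀ o o' : Fin 4, o ≠ o' → ∀ y, letters₅ o y 0 = o' ∨
    letters₅ o y 1 = o' ∨ letters₅ o y 2 = o' := by
  decide

variable (k) in
/-- The socle generators for `n = 5`. -/
def gen₅ (x : Fin 4 × Fin 2 × Fin 5) : MvPolynomial (Fin (5 - 1) × Fin 5) k :=
  sym2 (cols₅ x.2.2).1 (cols₅ x.2.2).2.1 (Pi.single (letters₅ x.1 x.2.1 0) 1)
    (Pi.single (letters₅ x.1 x.2.1 1) 1) *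
      lin (cols₅ x.2.2).2.2 (Pi.single (letters₅ x.1 x.2.1 2) 1)

variable (k) in
/-- The functionals which are dual to the generators. -/
def dual₅ (x : Fin 4 × Fin 2 × Fin 5) : MvPolynomial (Fin (5 - 1) × Fin 5) k →ₗ[k] k :=
  hookDual (fun j => (dirA x.2.2 j : k)) (fun j => (dirB x.2.2 j : k)) (fun j => (dirC x.2.2 j : k))
    (letters₅ x.1 x.2.1 0) (letters₅ x.1 x.2.1 1) (letters₅ x.1 x.2.1 2)

theorem dual₅_relIdeal (x : Fin 4 × Fin 2 × Fin 5) {f} (hf : f ∈ relIdeal k 5) :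
    dual₅ k x f = 0 := by
  refine hookDual_relIdeal ?_ ?_ ?_ (fun j => ?_) (fun j => ?_) _ _ _ hf
  · exact_mod_cast congrArg (Int.cast : ℤ → k) ((by decide : ∀ m, ∑ j, dirA m j = 0) x.2.2)
  · exact_mod_cast congrArg (Int.cast : ℤ → k) ((by decide : ∀ m, ∑ j, dirB m j = 0) x.2.2)
  · exact_mod_cast congrArg (Int.cast : ℤ → k) ((by decide : ∀ m, ∑ j, dirC m j = 0) x.2.2)
  · exact_mod_cast congrArg (Int.cast : ℤ → k)
      ((by decide : ∀ m j, dirA m j * dirC m j = 0) x.2.2 j)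
  · exact_mod_cast congrArg (Int.cast : ℤ → k)
      ((by decide : ∀ m j, dirB m j * dirC m j = 0) x.2.2 j)

theorem dual₅_gen₅_self [CharZero k] (o : Fin 4) (y : Fin 2) (m m' : Fin 5) :
    dual₅ k (o, y, m) (gen₅ k (o, y, m')) = 0 ↔ m ≠ m' := by
  have hne : ∀ {x x'}, x ≠ x' → letters₅ o y x ≠ letters₅ o y x' :=
    (letters₅_injective o y).ne
  rw [dual₅, gen₅, hookDual_gen _ _ _ (hne (by decide)) (hne (by decide)) (hne (by decide)),
    mul_eq_zero, or_iff_right (by norm_num), ← dir_pairing]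
  norm_cast

theorem dual₅_gen₅_swap (o : Fin 4) {y y' : Fin 2} (hy : y ≠ y') (m m' : Fin 5) :
    dual₅ k (o, y, m) (gen₅ k (o, y', m')) = 0 := by
  have hne : ∀ {x x'}, x ≠ x' → letters₅ o y x ≠ letters₅ o y x' :=
    (letters₅_injective o y).ne
  have h := (by decide : ∀ o, ∀ y y' : Fin 2, y ≠ y' → letters₅ o y' 0 = letters₅ o y 0 ∧
    letters₅ o y' 1 = letters₅ o y 2 ∧ letters₅ o y' 2 = letters₅ o y 1) o y y' hy
  simp only [dual₅, gen₅, h.1, h.2.1, h.2.2]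
  exact hookDual_gen' _ _ _ (hne (by decide)) (hne (by decide)) (hne (by decide)) _ _ _

/-- Generators are told apart by the omitted letter, by which letter stands in the unsymmetrized
factor, and by the columns; each distinction is handled by one of the evaluations of the dual
functionals. -/
theorem linearIndependent_gen₅ [CharZero k] :
    LinearIndependent k fun x => G.presentation k 5 (gen₅ k x) := by
  refine linearIndependent_of_dual (by norm_num) (Λ := dual₅ k) (fun x f hf => dual₅_relIdeal x hf)
    ?_ fun x => ?_
  · rintro ⟨o, y, m⟩ ⟨o', y', m'⟩ h
    by_cases ho : o = o'
    · subst ho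
      by_cases hy : y = y'
      · subst hy
        refine (dual₅_gen₅_self _ _ _ _).2 ?_
        rintro rfl
        exact h rfl
      · exact dual₅_gen₅_swap _ hy _ _
    · exact hookDual_gen_of_ne _ _ _ (exists_letters₅ o o' ho y) (letters₅_ne _ _ _)
        (letters₅_ne _ _ _) (letters₅_ne _ _ _) _ _ _
  · exact fun h => (dual₅_gen₅_self x.1 x.2.1 x.2.2 x.2.2).1 h rfl

theorem X_mul_gen₅_mem [CharZero k] (x : Fin 4 × Fin 2 × Fin 5) (p) :
    MvPolynomial.X p * gen₅ k x ∈ relIdeal k 5 := by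
  refine (X_mul_mem_relIdeal_iff (by norm_num) _).2 ?_ p
  have h := (by decide : ∀ m, (cols₅ m).1 ≠ (cols₅ m).2.1 ∧ (cols₅ m).1 ≠ (cols₅ m).2.2 ∧
    (cols₅ m).2.1 ≠ (cols₅ m).2.2) x.2.2
  have := presentation_sym2_mul_mem_socle h.1 (Pi.single (letters₅ x.1 x.2.1 0) 1)
    (Pi.single (letters₅ x.1 x.2.1 1) (1 : k)) (T := {(cols₅ x.2.2).2.2})
    (by simpa using h.2.1) (by simpa using h.2.2) (by simp)
    (fun _ => Pi.single (letters₅ x.1 x.2.1 2) 1)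
  rwa [Finset.prod_singleton] at this

theorem isHomogeneous_gen₅ (x : Fin 4 × Fin 2 × Fin 5) : (gen₅ k x).IsHomogeneous 3 :=
  (isHomogeneous_sym2 ..).mul (isHomogeneous_lin ..)

theorem isWeightedHomogeneous_gen₅ (x : Fin 4 × Fin 2 × Fin 5) :
    (gen₅ k x).IsWeightedHomogeneous
      (fun p : Fin (5 - 1) × Fin 5 => (Pi.single p.1 1 : Fin (5 - 1) → ℕ))
      (Pi.single (letters₅ x.1 x.2.1 0) 1 + Pi.single (letters₅ x.1 x.2.1 1) 1 +
        Pi.single (letters₅ x.1 x.2.1 2) 1) := by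
  rw [gen₅, lin_single]
  exact (isWeightedHomogeneous_sym2 ..).mul (MvPolynomial.isWeightedHomogeneous_X k _ _)

/-- The functional alternates in the three vectors, while a generator is symmetric in two of them.
-/
theorem Alt3_gen₅ (ξ ζ η : Fin (5 - 1) → k) (α β γ : Fin 5 → k) (x : Fin 4 × Fin 2 × Fin 5) :
    Alt3 ξ ζ η α β γ (gen₅ k x) = 0 := by
  simp only [gen₅, sym2_mul_lin, Alt3, LinearMap.add_apply, LinearMap.sub_apply, map_add,
    T3_lin_mul_mul]
  ring

/-- Every term of this functional uses the p-coordinates of two different factors, but the three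
letters of a generator are distinct. -/
theorem Hook3_gen₅ (p q : Fin (5 - 1)) (α β γ : Fin 5 → k) (x : Fin 4 × Fin 2 × Fin 5) :
    Hook3 (Pi.single p 1) (Pi.single q 1) (Pi.single p 1) α β γ (gen₅ k x) = 0 := by
  have hne : ∀ {i j}, i ≠ j → letters₅ x.1 x.2.1 i ≠ letters₅ x.1 x.2.1 j :=
    (letters₅_injective _ _).ne
  have h : ∀ {i j}, i ≠ j → (Pi.single (letters₅ x.1 x.2.1 i) 1 : Fin (5 - 1) → k) p *
      (Pi.single (letters₅ x.1 x.2.1 j) 1 : Fin (5 - 1) → k) p = 0 := by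
    intro i j hij
    by_cases hp : p = letters₅ x.1 x.2.1 i
    · rw [hp, Pi.single_eq_of_ne (hne hij), mul_zero]
    · rw [Pi.single_eq_of_ne hp, zero_mul]
  have h1 := h (i := 0) (j := 1) (by decide)
  have h2 := h (i := 0) (j := 2) (by decide)
  have h3 := h (i := 1) (j := 2) (by decide)
  simp only [gen₅, sym2_mul_lin, Hook3, LinearMap.sub_apply, map_add, T3_lin_mul_mul,
    single_one_dotProduct]
  generalize (Pi.single (letters₅ x.1 x.2.1 0) 1 : Fin (5 - 1) → k) = a at *
  generalize (Pi.single (letters₅ x.1 x.2.1 1) 1 : Fin (5 - 1) → k) = b at *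
  generalize (Pi.single (letters₅ x.1 x.2.1 2) 1 : Fin (5 - 1) → k) = c at *
  rcases mul_eq_zero.1 h1 with ha | hb
  · rcases mul_eq_zero.1 h3 with hb | hc
    · rw [ha, hb]; ring
    · rw [ha, hc]; ring
  · rcases mul_eq_zero.1 h2 with ha | hc
    · rw [ha, hb]; ring
    · rw [hb, hc]; ring

theorem isAdmissible_gen₅ [CharZero k] {ι : Type*} (f : ι → Fin 4 × Fin 2 × Fin 5) :
    IsAdmissible (relIdeal k 5 ⊔ Ideal.span (Set.range fun i => gen₅ k (f i))) :=
  isAdmissible_sup_span (fun i p => X_mul_gen₅_mem (f i) p)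
    (fun i _ _ => by rw [gen₅, sym2_mul_lin, map_add, T1_lin_mul_mul, T1_lin_mul_mul, add_zero])
    (fun i _ _ _ _ => by
      rw [gen₅, sym2_mul_lin, map_add, Alt2_lin_mul_mul, Alt2_lin_mul_mul, add_zero])

end

end GaloisClosure

namespace GaloisClosure

noncomputable section

variable {k : Type*} [Field k] {n : ℕ}

local notation "Poly₅" => MvPolynomial (Fin (5 - 1) × Fin 5) k

/-! ### Tangents for `n = 5` -/

theorem Alt3_lin_mul_mul (ξ ζ η : Fin (n - 1) → k) (α β γ : Fin n → k) (s t u : Fin n)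
    (a b c : Fin (n - 1) → k) : Alt3 ξ ζ η α β γ (lin s a * lin t b * lin u c) =
      (α s * (β t * γ u - β u * γ t) - α t * (β s * γ u - β u * γ s) +
        α u * (β s * γ t - β t * γ s)) *
      ((ξ ⬝ᵥ a) * ((ζ ⬝ᵥ b) * (η ⬝ᵥ c) - (ζ ⬝ᵥ c) * (η ⬝ᵥ b)) -
        (ξ ⬝ᵥ b) * ((ζ ⬝ᵥ a) * (η ⬝ᵥ c) - (ζ ⬝ᵥ c) * (η ⬝ᵥ a)) +
        (ξ ⬝ᵥ c) * ((ζ ⬝ᵥ a) * (η ⬝ᵥ b) - (ζ ⬝ᵥ b) * (η ⬝ᵥ a))) := by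
  simp only [Alt3, LinearMap.add_apply, LinearMap.sub_apply, T3_lin_mul_mul]
  ring

/-- This is the syzygy of `IsTangent.four_mem` multiplied by c_4; the extra summand v_4 of the trace
is accounted for by the relation c_4 v_4. -/
theorem IsTangent.five_mem {I : Ideal Poly₅} {Γ : Submodule Poly₅ (Poly₅ × Poly₅)} {M : _}
    (h : IsTangent I Γ M) (e : Equiv.Perm (Fin 5)) (c v : Fin (5 - 1) → k) :
    (lin (e 0) (M (e 0) v v) - lin (e 1) (M (e 1) v v)) * (lin (e 2) v - lin (e 3) v) *
        lin (e 4) c +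
      (lin (e 0) v - lin (e 1) v) * (lin (e 2) (M (e 2) v v) - lin (e 3) (M (e 3) v v)) *
        lin (e 4) c +
      (lin (e 0) v - lin (e 1) v) * (lin (e 2) v - lin (e 3) v) * lin (e 4) (M (e 4) c v) ∈ I := by
  rw [← h.zero_mem_iff]
  have hL := h.sum_lin_mem v
  rw [← Equiv.sum_comp e, Fin.sum_univ_five] at hL
  have hq := fun j => h.lin_mul_lin_mem (e j) v v
  have := Γ.sub_mem (Γ.add_mem (Γ.add_mem
    (Γ.smul_mem (lin (e 4) c * (lin (e 2) v - lin (e 3) v)) (Γ.sub_mem (hq 0) (hq 1)))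
    (Γ.smul_mem (lin (e 4) c * (lin (e 0) v - lin (e 1) v)) (Γ.sub_mem (hq 2) (hq 3))))
    (Γ.smul_mem ((lin (e 0) v - lin (e 1) v) * (lin (e 2) v - lin (e 3) v))
      (h.lin_mul_lin_mem (e 4) c v)))
    (Γ.smul_mem (lin (e 4) c * (lin (e 0) v - lin (e 1) v) * (lin (e 2) v - lin (e 3) v)) hL)
  convert this using 1
  refine Prod.ext ?_ ?_
  · simp only [Prod.fst_sub, Prod.fst_add, Prod.smul_fst, smul_eq_mul]
    ring
  · simp only [Prod.snd_sub, Prod.snd_add, Prod.smul_snd, smul_eq_mul]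
    ring

theorem IsTangent.five_wedge [CharZero k] {I : Ideal Poly₅}
    (hI : ∀ ξ ζ η (α β γ : Fin 5 → k), ∑ j, α j = 0 → ∑ j, β j = 0 → ∑ j, γ j = 0 → ∀ f ∈ I,
      Alt3 ξ ζ η α β γ f = 0) {Γ : Submodule Poly₅ (Poly₅ × Poly₅)} {M : _}
    (h : IsTangent I Γ M) (i j : Fin 5) (v : Fin (5 - 1) → k) (p q : Fin (5 - 1)) :
    M i v v p * v q - M i v v q * v p = M j v v p * v q - M j v v q * v p := by
  refine eq_of_forall_perm (n := 2) (μ := fun i => M i v v p * v q - M i v v q * v p)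
    (fun e => ?_) i j
  -- With c = e_r for a third index r, the 3 × 3 determinants of vectors reduce to their minors in
  -- p, q; the terms with M(c, v) contain v twice and drop out.
  obtain ⟨r, hp, hq⟩ := exists_ne_ne (n := 5 - 1) (by norm_num) p q
  have h1 := hI (Pi.single p 1) (Pi.single q 1) (Pi.single r 1) _ _ _
    (sum_comp_symm_eq_zero e (α := ![1, -1, 0, 0, 0]) (by simp [Fin.sum_univ_five]))
    (sum_comp_symm_eq_zero e (α := ![0, 1, -1, 0, 0]) (by simp [Fin.sum_univ_five]))
    (sum_comp_symm_eq_zero e (α := ![0, 0, 1, 0, -1]) (by simp [Fin.sum_univ_five])) _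
    (h.five_mem e (Pi.single r 1) v)
  simp only [mul_sub, sub_mul, map_add, map_sub, Alt3_lin_mul_mul, Function.comp_apply,
    Equiv.symm_apply_apply, single_one_dotProduct, Pi.single_eq_same, Pi.single_eq_of_ne hp.symm,
    Pi.single_eq_of_ne hq.symm, Matrix.cons_val] at h1
  linear_combination -h1

/-- The factor v_i is cancelled by moving v to v + e_i and v - e_i where it vanishes. The quadratic
relation that remains is polarized and evaluated on basis vectors, which kills all coefficients of
M. -/
theorem eq_zero_of_hook_relation [CharZero k] {ι : Type*} [Fintype ι] [DecidableEq ι]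
    (hι : 2 ≤ Fintype.card ι)
    {M : (ι → k) →ₗ[k] (ι → k) →ₗ[k] (ι → k)} (hs : ∀ a b, M a b = M b a)
    (h : ∀ v i j, i ≠ j → (2 * M v v i + v i * M (Pi.single j 1) v j -
      v j * M (Pi.single j 1) v i) * v i = 0) : M = 0 := by
  set e : ι → ι → k := fun i => Pi.single i 1 with he
  have e1 : ∀ i, e i i = 1 := fun i => Pi.single_eq_same _ _
  have e0 : ∀ {i j}, j ≠ i → e i j = 0 := fun h => Pi.single_eq_of_ne h _
  change ∀ v i j, i ≠ j → (2 * M v v i + v i * M (e j) v j - v j * M (e j) v i) * v i = 0 at h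
  have h0 : ∀ v i j, i ≠ j → 2 * M v v i + v i * M (e j) v j - v j * M (e j) v i = 0 := by
    intro v i j hij
    rcases mul_eq_zero.1 (h v i j hij) with h0 | h0
    · exact h0
    have h1 := h (v + e i) i j hij
    have h2 := h (v - e i) i j hij
    have h3 := h (e i) i j hij
    simp only [map_add, map_sub, LinearMap.add_apply, LinearMap.sub_apply, Pi.add_apply,
      Pi.sub_apply, e1, e0 hij.symm, h0, hs _ v] at h1 h2 h3
    have : (2 : k) * (2 * M v v i + v i * M (e j) v j - v j * M (e j) v i) = 0 := by
      rw [h0, hs (e j) v]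
      linear_combination h1 - h2 - 2 * h3
    simpa using this
  have hB : ∀ a b i j, i ≠ j → 4 * M a b i + a i * M (e j) b j + b i * M (e j) a j -
      a j * M (e j) b i - b j * M (e j) a i = 0 := by
    intro a b i j hij
    have h1 := h0 (a + b) i j hij
    simp only [map_add, LinearMap.add_apply, Pi.add_apply, hs b a] at h1
    linear_combination h1 - h0 a i j hij - h0 b i j hij
  have c1 : ∀ i j, i ≠ j → M (e j) (e j) i = 0 := by
    intro i j hij
    have := h0 (e j) i j hij
    rw [e1, e0 hij] at this
    linear_combination this
  have c2 : ∀ i j, i ≠ j → 2 * M (e i) (e i) i + M (e j) (e i) j = 0 := by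
    intro i j hij
    have := h0 (e i) i j hij
    rw [e1, e0 hij.symm] at this
    linear_combination this
  have c3 : ∀ i j, i ≠ j → 3 * M (e i) (e j) i + M (e j) (e j) j = 0 := by
    intro i j hij
    have := hB (e i) (e j) i j hij
    rw [e1, e1, e0 hij.symm, e0 hij, hs (e j) (e i)] at this
    linear_combination this
  have : Nontrivial ι := Fintype.one_lt_card_iff_nontrivial.1 (by omega)
  have c4 : ∀ j, M (e j) (e j) j = 0 := by
    intro j
    obtain ⟨i, hij⟩ := exists_ne j
    have h1 := c3 i j hij
    have h2 := c2 j i hij.symm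
    have : (5 : k) * M (e j) (e j) j = 0 := by linear_combination 3 * h2 - h1
    simpa using this
  have c5 : ∀ i j, i ≠ j → M (e i) (e j) i = 0 := by
    intro i j hij
    have := c3 i j hij
    rw [c4] at this
    simpa using this
  have c6 : ∀ i j t, i ≠ j → i ≠ t → M (e j) (e t) i = 0 := by
    intro i j t hij hit
    by_cases hjt : j = t
    · subst hjt; exact c1 i j hij
    have := hB (e j) (e t) i j hij
    rw [e1, e0 hij, e0 hit, e0 hjt] at this
    have h3 : (3 : k) * M (e j) (e t) i = 0 := by linear_combination this
    simpa using h3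
  refine LinearMap.ext_basis (Pi.basisFun k ι) (Pi.basisFun k ι) fun i l => ?_
  rw [Pi.basisFun_apply, Pi.basisFun_apply]
  change M (e i) (e l) = 0
  ext p
  by_cases hpi : p = i
  · subst hpi
    by_cases hpl : p = l
    · subst hpl; exact c4 p
    · exact c5 p l hpl
  · by_cases hpl : p = l
    · subst hpl
      rw [hs]
      exact c5 p i hpi
    · exact c6 p i l hpi hpl

/-- Taking c = e_j in `IsTangent.five_mem` and pairing with the hook functional for e_i, e_j, e_i
yields the relation of `eq_zero_of_hook_relation`. -/
theorem IsTangent.five_eq_zero [CharZero k] {I : Ideal Poly₅}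
    (hI : ∀ p q (α β γ : Fin 5 → k), ∑ j, α j = 0 → ∑ j, β j = 0 → ∑ j, γ j = 0 →
      (∀ j, α j * γ j = 0) → (∀ j, β j * γ j = 0) → ∀ f ∈ I,
      Hook3 (Pi.single p 1) (Pi.single q 1) (Pi.single p 1) α β γ f = 0)
    {Γ : Submodule Poly₅ (Poly₅ × Poly₅)} {M : _} (h : IsTangent I Γ fun _ => M) : M = 0 := by
  refine eq_zero_of_hook_relation (by simp) (h.symm 0) fun v i j hij => ?_
  have h1 := hI i j ![1, -1, 0, 0, 0] ![0, 1, 0, 0, -1] ![0, 0, 1, -1, 0]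
    (by simp [Fin.sum_univ_five]) (by simp [Fin.sum_univ_five]) (by simp [Fin.sum_univ_five])
    (by simp [Fin.forall_fin_succ]) (by simp [Fin.forall_fin_succ]) _
    (h.five_mem 1 (Pi.single j 1) v)
  simp only [Equiv.Perm.one_apply, mul_sub, sub_mul, map_add, map_sub, Hook3, LinearMap.sub_apply,
    T3_lin_mul_mul, single_one_dotProduct, Pi.single_eq_same, Pi.single_eq_of_ne hij,
    Matrix.cons_val] at h1
  have : (2 : k) * ((2 * M v v i + v i * M (Pi.single j 1) v j -
      v j * M (Pi.single j 1) v i) * v i) = 0 := by linear_combination -h1 / 2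
  simpa using this

end

end GaloisClosure

namespace GaloisClosure

noncomputable section

variable {k : Type*} [Field k] {n : ℕ}

local notation "Poly" => MvPolynomial (Fin (n - 1) × Fin n) k
local notation "Poly₅" => MvPolynomial (Fin (5 - 1) × Fin 5) k

/-! ### The socle in degree two for `n = 5` -/

theorem eq_sum_X_mul_X_of_isHomogeneous_two [CharZero k] {σ : Type*} [Fintype σ]
    {f : MvPolynomial σ k} (hf : f.IsHomogeneous 2) :
    ∃ c : σ → σ → k, (∀ p q, c p q = c q p) ∧
      f = ∑ p, ∑ q, c p q • (MvPolynomial.X p * MvPolynomial.X q) := by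
  have h1 := hf.sum_X_mul_pderiv
  have h2 : ∀ p, ∃ c : σ → k, MvPolynomial.pderiv p f = ∑ q, c q • MvPolynomial.X q :=
    fun p => eq_sum_X_of_isHomogeneous_one hf.pderiv
  choose c hc using h2
  -- One factor 2 comes from Euler's identity in degree two, the other from symmetrizing.
  refine ⟨fun p q => (c p q + c q p) / 4, fun p q => by ring, ?_⟩
  have h3 : ∑ p, ∑ q, c p q • (MvPolynomial.X p * MvPolynomial.X q) = (2 : k) • f := by
    rw [two_smul, ← two_smul ℕ, ← h1]
    refine Finset.sum_congr rfl fun p _ => ?_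
    rw [hc, Finset.mul_sum]
    exact Finset.sum_congr rfl fun q _ => (mul_smul_comm _ _ _).symm
  have h4 : ∑ p, ∑ q, c q p • (MvPolynomial.X p * MvPolynomial.X q) = (2 : k) • f := by
    rw [Finset.sum_comm, ← h3]
    exact Finset.sum_congr rfl fun p _ => Finset.sum_congr rfl fun q _ => by rw [mul_comm]
  have h5 : ∑ p, ∑ q, ((c p q + c q p) / 4) • (MvPolynomial.X p * MvPolynomial.X q) =
      (4 : k)⁻¹ • (∑ p, ∑ q, c p q • (MvPolynomial.X p * MvPolynomial.X q : MvPolynomial σ k) +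
        ∑ p, ∑ q, c q p • (MvPolynomial.X p * MvPolynomial.X q)) := by
    simp only [← Finset.sum_add_distrib, Finset.smul_sum]
    refine Finset.sum_congr rfl fun p _ => Finset.sum_congr rfl fun q _ => ?_
    rw [← add_smul, smul_smul, div_eq_inv_mul]
  rw [h5, h3, h4, ← two_smul k, smul_smul, smul_smul]
  norm_num

/-- A matrix with vanishing off-diagonal rectangles has rank one, additively, off the diagonal. -/
theorem exists_eq_add_of_rectangles {F : Fin 5 → Fin 5 → k}
    (h : ∀ i j l m, i ≠ j → i ≠ l → i ≠ m → j ≠ l → j ≠ m → l ≠ m →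
      F i l - F i m - F j l + F j m = 0) :
    ∃ p q : Fin 5 → k, ∀ i j, i ≠ j → F i j = p i + q j := by
  -- The index w i is an auxiliary column different from 0 and i. By the rectangles, F i j - F 0 j
  -- does not depend on j, and its value at w i defines p i.
  set w : Fin 5 → Fin 5 := fun i => if i = 1 then 2 else 1 with hw
  have hw1 : ∀ i, i ≠ w i := by decide
  have hw0 : ∀ i, 0 ≠ w i := by decide
  set p : Fin 5 → k := fun i => if i = 0 then 0 else F i (w i) - F 0 (w i) with hp
  have hpi : ∀ i j, i ≠ 0 → j ≠ 0 → i ≠ j → p i = F i j - F 0 j := by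
    intro i j hi hj hij
    simp only [hp, if_neg hi]
    by_cases hjw : j = w i
    · rw [hjw]
    · linear_combination h i 0 (w i) j hi (hw1 i) hij (hw0 i) hj.symm (Ne.symm hjw)
  refine ⟨p, fun j => if j = 0 then F 1 0 - p 1 else F 0 j, fun i j hij => ?_⟩
  by_cases hi : i = 0
  · subst hi
    simp only [hp, if_true, if_neg hij.symm, zero_add]
  by_cases hj : j = 0
  · subst hj
    simp only [if_true]
    by_cases hi1 : i = 1
    · subst hi1; ring
    obtain ⟨l, h0, h1, hl⟩ := (by decide : ∀ i : Fin 5, ∃ l, l ≠ 0 ∧ l ≠ 1 ∧ i ≠ l) i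
    rw [hpi i l hi h0 hl, hpi 1 l (by decide) h0 h1.symm]
    linear_combination h i 1 0 l hi1 hi hl (by decide) h1.symm h0.symm
  · simp only [if_neg hj]
    rw [hpi i j hi hj hij]
    ring

theorem Hook3_lin_mul_mul {ξ ζ η : Fin (n - 1) → k} {α β γ : Fin n → k} {u : Fin n}
    (hα : α u = 1) (hβ : β u = 0) (hγ : γ u = 0) (c a b : Fin (n - 1) → k) (s t : Fin n) :
    Hook3 ξ ζ η α β γ (lin u c * lin s a * lin t b) =
      ((ξ ⬝ᵥ c) * (ζ ⬝ᵥ a) - (ξ ⬝ᵥ a) * (ζ ⬝ᵥ c)) * β s * ((η ⬝ᵥ b) * γ t) +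
      ((ξ ⬝ᵥ c) * (ζ ⬝ᵥ b) - (ξ ⬝ᵥ b) * (ζ ⬝ᵥ c)) * β t * ((η ⬝ᵥ a) * γ s) := by
  rw [Hook3, LinearMap.sub_apply, T3_lin_mul_mul, T3_lin_mul_mul, hα, hβ, hγ]
  ring

/-- The sums with coefficients p_s and q_t are multiples of traces, and the diagonal corrections are
multiples of products within one column. -/
theorem sum_mem_relIdeal_of_eq_add {F : Fin n → Fin n → k} {p q : Fin n → k}
    (h : ∀ i j, i ≠ j → F i j = p i + q j) (a b : Fin (n - 1)) :
    ∑ s, ∑ t, F s t • (MvPolynomial.X (a, s) * MvPolynomial.X (b, t) : Poly) ∈ relIdeal k n := by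
  have h1 : ∑ s, ∑ t, F s t • (MvPolynomial.X (a, s) * MvPolynomial.X (b, t) : Poly) =
      ∑ s, (F s s - (p s + q s)) • (MvPolynomial.X (a, s) * MvPolynomial.X (b, s) : Poly) +
      ((∑ s, p s • MvPolynomial.X (a, s)) * (∑ t, MvPolynomial.X (b, t)) +
      (∑ t, q t • MvPolynomial.X (b, t)) * (∑ s, MvPolynomial.X (a, s))) := by
    rw [Finset.sum_mul_sum, Finset.sum_mul_sum, Finset.sum_comm (s := Finset.univ)
      (f := fun t s => (q t • MvPolynomial.X (b, t) : Poly) * MvPolynomial.X (a, s)),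
      ← Finset.sum_add_distrib, ← Finset.sum_add_distrib]
    refine Finset.sum_congr rfl fun s _ => ?_
    rw [← Finset.sum_add_distrib, ← sub_eq_iff_eq_add, ← Finset.sum_sub_distrib,
      Finset.sum_eq_single s]
    · rw [smul_mul_assoc, smul_mul_assoc, mul_comm (MvPolynomial.X (b, s)), ← add_smul, ← sub_smul]
    · intro t _ hts
      rw [h s t hts.symm, smul_mul_assoc, smul_mul_assoc, mul_comm (MvPolynomial.X (b, t)),
        ← add_smul, sub_self]
    · simp
  rw [h1]
  refine Ideal.add_mem _ (Ideal.sum_mem _ fun s _ => ?_) (Ideal.add_mem _ ?_ ?_)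
  · exact Submodule.smul_of_tower_mem _ _ (X_mul_X_mem_relIdeal a b s)
  · exact Ideal.mul_mem_left _ _ (sum_X_mem_relIdeal b)
  · exact Ideal.mul_mem_left _ _ (sum_X_mem_relIdeal a)

theorem single_sub_single_mul_eq_zero {i j l m : Fin n} (hil : i ≠ l) (him : i ≠ m) (hjl : j ≠ l)
    (hjm : j ≠ m) (s : Fin n) : (Pi.single i 1 - Pi.single j 1 : Fin n → k) s *
      (Pi.single l 1 - Pi.single m 1 : Fin n → k) s = 0 := by
  have h : ∀ {a b : Fin n}, a ≠ b →
      (Pi.single a 1 : Fin n → k) s * (Pi.single b 1 : Fin n → k) s = 0 := by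
    intro a b hab
    by_cases ha : s = a
    · rw [ha, Pi.single_eq_of_ne hab, mul_zero]
    · rw [Pi.single_eq_of_ne ha, zero_mul]
  rw [Pi.sub_apply, Pi.sub_apply]
  linear_combination h hil - h him - h hjl + h hjm

theorem sum_mul_single_sub_single (g : Fin (n - 1) × Fin n → k) (a : Fin (n - 1)) (i j : Fin n) :
    ∑ p, g p * ((Pi.single p.1 1 : Fin (n - 1) → k) a *
      (Pi.single i 1 - Pi.single j 1 : Fin n → k) p.2) = g (a, i) - g (a, j) := by
  rw [Fintype.sum_prod_type, Finset.sum_eq_single a (fun b _ hb => by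
    simp [Pi.single_eq_of_ne hb.symm]) (by simp)]
  simp [mul_sub, Finset.sum_sub_distrib, Pi.single_apply]

theorem sum_sum_mul_single_sub_single (c : Fin (n - 1) × Fin n → Fin (n - 1) × Fin n → k)
    (a b : Fin (n - 1)) (i j l m : Fin n) :
    ∑ p, ∑ q, c p q * ((Pi.single p.1 1 : Fin (n - 1) → k) a *
      (Pi.single i 1 - Pi.single j 1 : Fin n → k) p.2) *
      ((Pi.single q.1 1 : Fin (n - 1) → k) b *
      (Pi.single l 1 - Pi.single m 1 : Fin n → k) q.2) =
      c (a, i) (b, l) - c (a, i) (b, m) - c (a, j) (b, l) + c (a, j) (b, m) := by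
  simp only [sum_mul_single_sub_single]
  simp only [← sub_mul]
  rw [sum_mul_single_sub_single (fun p => c p (b, l) - c p (b, m))]
  ring

/-- Given two disjoint pairs of columns, a variable in the fifth column is multiplied in and the
hook functional tests the product. This makes all off-diagonal rectangle sums of the coefficients
vanish, and `exists_eq_add_of_rectangles` then expresses g through the relations. -/
theorem mem_relIdeal_of_forall_X_mul_mem_two [CharZero k] {I : Ideal Poly₅}
    (hI : ∀ p q (α β γ : Fin 5 → k), ∑ j, α j = 0 → ∑ j, β j = 0 → ∑ j, γ j = 0 →
      (∀ j, α j * γ j = 0) → (∀ j, β j * γ j = 0) → ∀ f ∈ I,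
      Hook3 (Pi.single p 1) (Pi.single q 1) (Pi.single p 1) α β γ f = 0)
    {g : Poly₅} (hg : g.IsHomogeneous 2) (hX : ∀ p, MvPolynomial.X p * g ∈ I) :
    g ∈ relIdeal k 5 := by
  obtain ⟨c, hc, rfl⟩ := eq_sum_X_mul_X_of_isHomogeneous_two hg
  have key : ∀ (a b : Fin (5 - 1)) (i j l m : Fin 5), i ≠ j → i ≠ l → i ≠ m → j ≠ l → j ≠ m →
      l ≠ m → c (a, i) (b, l) - c (a, i) (b, m) - c (a, j) (b, l) + c (a, j) (b, m) = 0 := by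
    intro a b i j l m hij hil him hjl hjm hlm
    obtain ⟨u, hui, huj, hul, hum⟩ : ∃ u, u ≠ i ∧ u ≠ j ∧ u ≠ l ∧ u ≠ m := by
      have : ({i, j, l, m} : Finset (Fin 5)).card < Fintype.card (Fin 5) :=
        lt_of_le_of_lt Finset.card_le_four (by simp)
      obtain ⟨u, -, hu⟩ := Finset.exists_mem_notMem_of_card_lt_card (t := Finset.univ) this
      exact ⟨u, by simpa [not_or] using hu⟩
    obtain ⟨d, hd⟩ : ∃ d, d ≠ b := exists_ne b
    -- The first index x of the multiplier and the second index y of the functional are chosen so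
    -- that the alternating part extracts the a-coordinate up to sign; the case a = b needs an
    -- auxiliary index d.
    obtain ⟨x, y, ε, hε, hxy⟩ : ∃ (x y : Fin (5 - 1)) (ε : k), ε ≠ 0 ∧ ∀ p : Fin (5 - 1),
        (Pi.single x (1 : k) : Fin (5 - 1) → k) b * (Pi.single p 1 : Fin (5 - 1) → k) y -
        (Pi.single p (1 : k) : Fin (5 - 1) → k) b * (Pi.single x 1 : Fin (5 - 1) → k) y =
        ε * (Pi.single p 1 : Fin (5 - 1) → k) a := by
      by_cases hab : a = b
      · refine ⟨d, d, -1, by norm_num, fun p => ?_⟩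
        rw [hab, Pi.single_eq_of_ne hd.symm, Pi.single_eq_same]
        ring
      · refine ⟨b, a, 1, one_ne_zero, fun p => ?_⟩
        rw [Pi.single_eq_same, Pi.single_eq_of_ne hab]
        ring
    have h1 := hI b y (Pi.single u 1 - Pi.single i 1) (Pi.single i 1 - Pi.single j 1)
      (Pi.single l 1 - Pi.single m 1) (sum_single_sub_single _ _) (sum_single_sub_single _ _)
      (sum_single_sub_single _ _) (single_sub_single_mul_eq_zero hul hum hil him)
      (single_sub_single_mul_eq_zero hil him hjl hjm) _ (hX (x, u))
    have h2 : ∀ p q : Fin (5 - 1) × Fin 5, MvPolynomial.X (x, u) *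
        (MvPolynomial.X p * MvPolynomial.X q) =
        lin u (Pi.single x (1 : k)) * lin p.2 (Pi.single p.1 1) * lin q.2 (Pi.single q.1 1) := by
      intro p q
      rw [lin_single, lin_single, lin_single, mul_assoc]
    simp only [Finset.mul_sum, mul_smul_comm, map_sum, map_smul, h2] at h1
    simp only [Hook3_lin_mul_mul (show (Pi.single u 1 - Pi.single i 1 : Fin 5 → k) u = 1 by
      simp [hui]) (show (Pi.single i 1 - Pi.single j 1 : Fin 5 → k) u = 0 by simp [hui, huj])
      (show (Pi.single l 1 - Pi.single m 1 : Fin 5 → k) u = 0 by simp [hul, hum]),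
      single_one_dotProduct, smul_eq_mul, hxy] at h1
    rw [← sum_sum_mul_single_sub_single (fun p q => c p q)]
    refine mul_left_cancel₀ (mul_ne_zero (two_ne_zero' k) hε) ?_
    rw [mul_zero, ← h1, mul_assoc, two_mul]
    conv_lhs =>
      enter [2]
      rw [Finset.sum_comm]
    simp only [Finset.mul_sum, ← Finset.sum_add_distrib]
    refine Finset.sum_congr rfl fun p _ => Finset.sum_congr rfl fun q _ => ?_
    rw [hc q p]
    ring
  have h3 : ∑ p, ∑ q, c p q • (MvPolynomial.X p * MvPolynomial.X q : Poly₅) =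
      ∑ a, ∑ b, ∑ s, ∑ t, c (a, s) (b, t) •
        (MvPolynomial.X (a, s) * MvPolynomial.X (b, t) : Poly₅) := by
    simp only [Fintype.sum_prod_type]
    exact Finset.sum_congr rfl fun a _ => Finset.sum_comm
  rw [h3]
  refine Ideal.sum_mem _ fun a _ => Ideal.sum_mem _ fun b _ => ?_
  obtain ⟨p, q, hpq⟩ := exists_eq_add_of_rectangles (F := fun s t => c (a, s) (b, t)) (key a b)
  exact sum_mem_relIdeal_of_eq_add hpq a b

/-- All functionals used vanish on every generator, so any subfamily of the 40 generators is
allowed. -/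
theorem hasTrivialNegativeTangents_gen₅ [CharZero k] {ι : Type*} (f : ι → Fin 4 × Fin 2 × Fin 5) :
    HasTrivialNegativeTangents
      (relIdeal k 5 ⊔ Ideal.span (Set.range fun i => gen₅ k (f i))) := by
  have hI := isAdmissible_gen₅ (k := k) f
  have hHook : ∀ p q (α β γ : Fin 5 → k), ∑ j, α j = 0 → ∑ j, β j = 0 → ∑ j, γ j = 0 →
      (∀ j, α j * γ j = 0) → (∀ j, β j * γ j = 0) →
      ∀ g ∈ relIdeal k 5 ⊔ Ideal.span (Set.range fun i => gen₅ k (f i)),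
      Hook3 (Pi.single p 1) (Pi.single q 1) (Pi.single p 1) α β γ g = 0 :=
    fun p q α β γ hα hβ hγ hαγ hβγ g hg =>
      eq_zero_of_mem_sup_span (fun i p => X_mul_gen₅_mem (f i) p)
        (fun _ h => Hook3_relIdeal hα hβ hγ hαγ hβγ h) (fun i => Hook3_gen₅ _ _ _ _ _ (f i)) hg
  refine hI.hasTrivialNegativeTangents (by norm_num) rfl (d := 3)
    (fun i => isHomogeneous_gen₅ (f i)) (fun i p => X_mul_gen₅_mem (f i) p)
    (fun m hm g hg hX => ?_) (fun Γ M h => h.five_wedge fun ξ ζ η α β γ hα hβ hγ g hg => ?_)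
    (fun Γ M h => h.five_eq_zero hHook)
  · interval_cases m
    · exact hI.mem_of_forall_X_mul_mem_zero (by norm_num) hg hX
    · exact hI.mem_of_forall_X_mul_mem_one (by norm_num) hg hX
    · exact hI.relIdeal_le (mem_relIdeal_of_forall_X_mul_mem_two hHook hg hX)
  · exact eq_zero_of_mem_sup_span (fun i p => X_mul_gen₅_mem (f i) p)
      (fun _ h => Alt3_relIdeal hα hβ hγ h) (fun i => Alt3_gen₅ _ _ _ _ _ _ (f i)) hg

theorem exists_socle_five [CharZero k] {r : ℕ} (hr : r ≤ 40) :
    ∃ (s : Fin r → G k 5) (d : Fin r → Fin (5 - 1) → ℕ), LinearIndependent k s ∧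
      (∀ i, s i ∈ G.socle k 5) ∧ (∀ i, s i ∈ G.component k 5 (d i)) ∧ (∀ i, ∑ j, d i j = 3) ∧
      (∀ i j, d i j ≤ 1) ∧
      HasTrivialNegativeTangents
        ((Ideal.span (Set.range s)).comap (G.presentation k 5)) := by
  set f : Fin r → Fin 4 × Fin 2 × Fin 5 := fun i =>
    (Fintype.equivFinOfCardEq (n := 40) (by simp)).symm (Fin.castLE hr i) with hf
  refine ⟨fun i => G.presentation k 5 (gen₅ k (f i)),
    fun i => Pi.single (letters₅ (f i).1 (f i).2.1 0) 1 +
      Pi.single (letters₅ (f i).1 (f i).2.1 1) 1 + Pi.single (letters₅ (f i).1 (f i).2.1 2) 1,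
    ?_, ?_, ?_, ?_, ?_, ?_⟩
  · exact linearIndependent_gen₅.comp f
      ((Equiv.injective _).comp (Fin.castLE_injective hr))
  · intro i
    exact (X_mul_mem_relIdeal_iff (by norm_num) _).1 fun p => X_mul_gen₅_mem (f i) p
  · exact fun i => Submodule.mem_map_of_mem (isWeightedHomogeneous_gen₅ (f i))
  · intro i
    simp [Finset.sum_add_distrib]
  · intro i
    exact (by decide : ∀ o y j, (Pi.single (letters₅ o y 0) 1 + Pi.single (letters₅ o y 1) 1 +
      Pi.single (letters₅ o y 2) 1 : Fin (5 - 1) → ℕ) j ≤ 1) _ _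
  · rw [comap_presentation_span (by norm_num)]
    exact hasTrivialNegativeTangents_gen₅ f

end

end GaloisClosure

/-! ### Assembly of the cases n = 5, n = 4 and even n ≥ 6 -/

theorem corollary5p6 (k : Type*) [Field k] [CharZero k] (n : ℕ)
    (hn : n = 5 ∨ (4 ≤ n ∧ Even n)) (r : ℕ) (hr : r ≤ GaloisClosure.R n) :
    ∃ (s : Fin r → GaloisClosure.G k n) (d : Fin r → Fin (n - 1) → ℕ),
      LinearIndependent k s ∧
      (∀ i, s i ∈ GaloisClosure.G.socle k n) ∧
      (∀ i, s i ∈ GaloisClosure.G.component k n (d i)) ∧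
      (∀ i, ∑ j, d i j = (n + 1) / 2) ∧
      (6 ≤ n → ∀ i j, d i j ≤ n / 2 - 2) ∧
      (n = 5 → ∀ i j, d i j ≤ 1) ∧
      (n = 4 ∨ n = 5 → GaloisClosure.HasTrivialNegativeTangents
        ((Ideal.span (Set.range s)).comap (GaloisClosure.G.presentation k n))) := by
  by_cases h5 : n = 5
  · subst h5
    obtain ⟨s, d, h1, h2, h3, h4, h5, h6⟩ := GaloisClosure.exists_socle_five (k := k) (r := r) hr
    exact ⟨s, d, h1, h2, h3, h4, fun h => absurd h (by norm_num), fun _ => h5, fun _ => h6⟩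
  obtain ⟨hn4, he⟩ := hn.resolve_left h5
  by_cases h4 : n = 4
  · subst h4
    obtain ⟨s, d, h1, h2, h3, h4, h5⟩ := GaloisClosure.exists_socle_four (k := k) (r := r) hr
    exact ⟨s, d, h1, h2, h3, h4, fun h => absurd h (by norm_num), fun h => absurd h (by norm_num),
      fun _ => h5⟩
  have h6 : 6 ≤ n := by
    obtain ⟨m, rfl⟩ := he
    omega
  obtain ⟨s, d, h1, h2, h3, h4', h7⟩ := GaloisClosure.exists_socle_of_even (k := k) h6 he hr
  exact ⟨s, d, h1, h2, h3, h4', fun _ => h7, fun h => absurd h h5,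
    fun h => absurd h (by omega)⟩
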